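/- Let $k$ be an algebraically closed field of characteristic $p>2$, let $H$ be a finite group of order prime to $p$ and $\chi:H\to\mathbb F_p^\times$ a character. Let $g:Z\to\mathbb P^1_k$ be a (connected) $H$-Galois cover of smooth projective curves, and $\omega\neq0$ a meromorphic differential on $Z$ that is logarithmic ($\omega=\mathrm df/f$) and satisfies $\beta^*\omega=\chi(\beta)\,\omega$ for all $\beta\in H$. For $\tau\in\mathbb P^1_k$ and any $\xi\in Z$ above $\tau$ let $m_\tau$ be the order of the stabiliser of $\xi$ in $H$, $h_\tau=\mathrm{ord}_\xi(\omega)+1$ and $\sigma_\tau=h_\tau/m_\tau$. Call $\tau$ critical if $(m_\tau,h_\tau)\ne(1,1)$; let $\mathbb B_{\rm wild}$, $\mathbb B_{\rm prim}$ be the sets of critical points with $h_\tau=0$, resp. $0<\sigma_\tau\le1$, and $\mathbb B_{\rm new}$ the set of the remaining critical points. The pair $(g,\omega)$ is a special deformation datum of type $(H,\chi)$ if $0<\sigma_\tau\le2$ for all critical $\tau\notin\mathbb B_{\rm wild}$ and $|\mathbb B_{\rm wild}\cup\mathbb B_{\rm prim}|=3$. It is hypergeometric if $\sigma_\tau=(p+1)/(p-1)$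 for all $\tau\in\mathbb B_{\rm new}$. Assume throughout the normalisation $\mathbb B_{\rm wild}\cup\mathbb B_{\rm prim}=\{0,1,\infty\}$. The signature of a hypergeometric datum is the triple $(a_1,a_2,a_3)$ of integers with $0\le a_i<p-1$ and $a_i\equiv(p-1)\sigma_{x_i}\pmod{p-1}$, where $(x_1,x_2,x_3)=(0,1,\infty)$. (i) Every hypergeometric deformation datum has a signature $(a_1,a_2,a_3)$. Suppose that $a_1+a_2+a_3<p-1$ and that $\sigma_\tau\neq1$ for all $\tau\in\mathbb B_{\rm prim}$ (the latter holds automatically if $\chi$ is injective). Then $u=\prod_{\tau\in\mathbb B_{\rm new}}(x-\tau)$ has degree $(p-1-a_1-a_2-a_3)/2$ and satisfies $$x(x-1)u''+[(A+B+1)x-C]u'+ABu=0,$$ where $A=(1+a_1+a_2+a_3)/2$, $B=(1+a_1+a_2-a_3)/2$, $C=1+a_1$. (ii) Let $0\le a_1,a_2,a_3<p-1$ be integers with $a_1+a_2+a_3$ even and $a_1+a_2+a_3\le p-1$. If $a_1+a_2+a_3<p-1$, put $m=(p-1)/2$ if all $a_i$ are even, and $m=p-1$ otherwise; if $a_1+a_2+a_3=p-1$,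 put $m=(p-1)/\gcd(a_1,a_2,a_3)$. Let $H=\mathbb Z/m$ and let $\chi:H\to\mathbb F_p^\times$ be any injective character. Then there exists a hypergeometric deformation datum $(g,\omega)$ of type $(H,\chi)$ and signature $(a_1,a_2,a_3)$, and it is unique up to isomorphism of $H$-Galois covers of $\mathbb P^1_k$ and up to multiplying $\omega$ by an element of $\mathbb F_p^\times$. -/

import Mathlib

universe u v

open KaehlerDifferential
open scoped TensorProduct

namespace DeformationData

/-- The map on Kähler differentials induced by a homomorphism `φ` of `k`-algebras:
`a db ↦ φ(a) d(φ(b))` (see `diffMap_D` and `diffMap_smul`). -/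
noncomputable def diffMap {k A B : Type*} [CommRing k] [CommRing A] [CommRing B]
    [Algebra k A] [Algebra k B] (φ : A →ₐ[k] B) : Ω[A⁄k] →ₗ[k] Ω[B⁄k] :=
  Ideal.mapCotangent (KaehlerDifferential.ideal k A) (KaehlerDifferential.ideal k B)
    (Algebra.TensorProduct.map φ φ) (by
      intro z hz
      have key : (Algebra.TensorProduct.lmul' k (S := B)).comp
            (Algebra.TensorProduct.map φ φ)
          = φ.comp (Algebra.TensorProduct.lmul' k (S := A)) := by
        ext <;> simp
      have hz' : Algebra.TensorProduct.lmul' k (S := A) z = 0 := hz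
      have := DFunLike.congr_fun key z
      simp only [AlgHom.comp_apply, hz', map_zero] at this
      exact this)

theorem diffMap_D {k A B : Type*} [CommRing k] [CommRing A] [CommRing B]
    [Algebra k A] [Algebra k B] (φ : A →ₐ[k] B) (b : A) :
    diffMap φ (D k A b) = D k B (φ b) := by
  simp only [diffMap, KaehlerDifferential.D_apply]
  erw [Ideal.mapCotangent_toCotangent]
  congr 1
  ext
  simp

theorem diffMap_smul {k A B : Type*} [CommRing k] [CommRing A] [CommRing B]
    [Algebra k A] [Algebra k B] (φ : A →ₐ[k] B) (a : A) (w : Ω[A⁄k]) :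
    diffMap φ (a • w) = φ a • diffMap φ w := by
  obtain ⟨z, rfl⟩ := Ideal.toCotangent_surjective _ w
  have h1 : a • (KaehlerDifferential.ideal k A).toCotangent z =
      (KaehlerDifferential.ideal k A).toCotangent ((a ⊗ₜ[k] (1 : A) : A ⊗[k] A) • z) := by
    rw [map_smul]
    exact (algebraMap_smul (A ⊗[k] A) a ((KaehlerDifferential.ideal k A).toCotangent z)).symm
  simp only [diffMap]
  erw [h1, Ideal.mapCotangent_toCotangent, Ideal.mapCotangent_toCotangent]
  have h2 : ∀ (b : B) (y : KaehlerDifferential.ideal k B),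
      b • (KaehlerDifferential.ideal k B).toCotangent y =
      (KaehlerDifferential.ideal k B).toCotangent ((b ⊗ₜ[k] (1 : B) : B ⊗[k] B) • y) := by
    intro b y
    rw [map_smul]
    exact (algebraMap_smul (B ⊗[k] B) b ((KaehlerDifferential.ideal k B).toCotangent y)).symm
  erw [h2]
  congr 1
  ext
  simp

/-- A closed point of the smooth projective curve over `k` with function field `L`, given by its
normalised discrete valuation (trivial on `k`), with values in `ℤ ∪ {∞}` written
multiplicatively: `val f = exp (- ord f)`. -/
structure Point (k L : Type*) [Field k] [Field L] [Algebra k L] where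
  val : Valuation L (WithZero (Multiplicative ℤ))
  surj : Function.Surjective val
  trivial_on : ∀ c : k, c ≠ 0 → val (algebraMap k L c) = 1

/-- The order of a nonzero meromorphic differential `ω` at the point `ξ`: the integer `n` such that
`ω = g dt` with `t` a local parameter at `ξ` and `ord_ξ g = n`. -/
noncomputable def Point.ordDiff {k L : Type*} [Field k] [Field L] [Algebra k L]
    (ξ : Point k L) (ω : Ω[L⁄k]) : ℤ :=
  Classical.epsilon fun n : ℤ => ∃ t g : L,
    ξ.val t = WithZero.exp (-1 : ℤ) ∧ ξ.val g = WithZero.exp (-n) ∧ ω = g • D k L t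

/-- A (connected) `H`-Galois cover `g : Z → ℙ¹` of smooth projective curves over `k`, given by the
extension of function fields `L / k(x)`.  Every `β : H` is an automorphism of `Z` over `ℙ¹`, and
`f ↦ β^* f` is the corresponding automorphism of `L`; it satisfies `(β γ)^* = γ^* ∘ β^*`, whence
the opposite group. -/
structure GaloisCover (k : Type u) [Field k] (H : Type v) [Group H] where
  L : Type u
  [field : Field L]
  [algK : Algebra (RatFunc k) L]
  [algk : Algebra k L]
  [tower : IsScalarTower k (RatFunc k) L]
  [finite : FiniteDimensional (RatFunc k) L]
  [galois : IsGalois (RatFunc k) L]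
  pullback : H ≃* (L ≃ₐ[RatFunc k] L)ᵐᵒᵖ

attribute [instance] GaloisCover.field GaloisCover.algK GaloisCover.algk GaloisCover.tower
  GaloisCover.finite GaloisCover.galois

namespace GaloisCover

variable {k : Type u} [Field k] {H : Type v} [Group H] (Z : GaloisCover k H)

/-- `f ↦ β^* f` on the function field of `Z`. -/
noncomputable def pull (β : H) : Z.L ≃ₐ[RatFunc k] Z.L := (Z.pullback β).unop

/-- `ω ↦ β^* ω` on the meromorphic differentials of `Z`. -/
noncomputable def pullDiff (β : H) : Ω[Z.L⁄k] →ₗ[k] Ω[Z.L⁄k] :=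
  diffMap ((Z.pull β).restrictScalars k : Z.L →ₐ[k] Z.L)

/-- The coordinate function `x` of `ℙ¹`, as a function on `Z`. -/
noncomputable def x : Z.L := algebraMap (RatFunc k) Z.L RatFunc.X

/-- The point `ξ` of `Z` lies above the point `τ` of `ℙ¹ = k ∪ {∞}`. -/
def LiesOver (ξ : Point k Z.L) : OnePoint k → Prop
  | none => 1 < ξ.val Z.x
  | some c => ξ.val (Z.x - algebraMap k Z.L c) < 1

/-- The order of the stabiliser of `ξ` in `H`. -/
noncomputable def m (ξ : Point k Z.L) : ℕ :=
  Nat.card {β : H // ∀ f : Z.L, ξ.val (Z.pull β f) = ξ.val f}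

variable (ω : Ω[Z.L⁄k])

/-- `h = ord_ξ(ω) + 1`. -/
noncomputable def h (ξ : Point k Z.L) : ℤ := ξ.ordDiff ω + 1

/-- `σ = h / m`. -/
noncomputable def sigma (ξ : Point k Z.L) : ℚ := Z.h ω ξ / Z.m ξ

/-- The set of critical points.  When `ω` is an eigenvector for `H`, the numbers `m`, `h`, `σ`
depend only on the image `τ` of `ξ`, since `H` permutes transitively the points above `τ`. -/
def critical : Set (OnePoint k) :=
  {τ | ∃ ξ, Z.LiesOver ξ τ ∧ (Z.m ξ, Z.h ω ξ) ≠ (1, 1)}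

/-- The critical points with `h = 0`. -/
def wild : Set (OnePoint k) := {τ ∈ Z.critical ω | ∃ ξ, Z.LiesOver ξ τ ∧ Z.h ω ξ = 0}

/-- The critical points with `0 < σ ≤ 1`. -/
def primitive : Set (OnePoint k) :=
  {τ ∈ Z.critical ω | ∃ ξ, Z.LiesOver ξ τ ∧ 0 < Z.sigma ω ξ ∧ Z.sigma ω ξ ≤ 1}

/-- The new critical points: all the others. -/
def new : Set (OnePoint k) := Z.critical ω \ (Z.wild ω ∪ Z.primitive ω)

end GaloisCover

/-- A special deformation datum `(g, ω)` of type `(H, χ)`. -/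
structure SpecialDatum (p : ℕ) (k : Type u) [Field k] [CharP k p] (H : Type v) [Group H]
    (χ : H →* (ZMod p)ˣ) extends GaloisCover k H where
  ω : Ω[L⁄k]
  ω_ne_zero : ω ≠ 0
  logarithmic : ∃ f : L, f ≠ 0 ∧ ω = f⁻¹ • D k L f
  pull_ω : ∀ β : H,
    toGaloisCover.pullDiff β ω = ZMod.castHom (dvd_refl p) k (χ β : ZMod p) • ω
  sigma_mem : ∀ τ ∈ toGaloisCover.critical ω \ toGaloisCover.wild ω, ∀ ξ,
    toGaloisCover.LiesOver ξ τ → 0 < toGaloisCover.sigma ω ξ ∧ toGaloisCover.sigma ω ξ ≤ 2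
  card_eq : (toGaloisCover.primitive ω ∪ toGaloisCover.wild ω).ncard = 3

namespace SpecialDatum

variable {p : ℕ} {k : Type u} [Field k] [CharP k p] {H : Type v} [Group H]
  {χ : H →* (ZMod p)ˣ} (E : SpecialDatum p k H χ)

/-- The datum is hypergeometric: `σ = (p + 1) / (p - 1)` at all new critical points. -/
def IsHypergeometric : Prop :=
  ∀ τ ∈ E.new E.ω, ∀ ξ, E.LiesOver ξ τ → E.sigma E.ω ξ = ((p : ℚ) + 1) / ((p : ℚ) - 1)

/-- The three critical points that are not new are `0`, `1` and `∞`. -/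
def IsNormalised : Prop :=
  E.primitive E.ω ∪ E.wild E.ω = {((0 : k) : OnePoint k), ((1 : k) : OnePoint k), OnePoint.infty}

/-- `0 ≤ a < p - 1` and `a ≡ (p - 1) σ_τ` modulo `p - 1`. -/
def HasExponent (τ : OnePoint k) (a : ℕ) : Prop :=
  a < p - 1 ∧ ∀ ξ, E.LiesOver ξ τ →
    ∃ n : ℤ, ((p : ℚ) - 1) * E.sigma E.ω ξ = a + n * ((p : ℚ) - 1)

/-- `(a₁, a₂, a₃)` is the signature (with respect to the points `0`, `1`, `∞`). -/
def HasSignature (a₁ a₂ a₃ : ℕ) : Prop :=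
  E.HasExponent ((0 : k) : OnePoint k) a₁ ∧ E.HasExponent ((1 : k) : OnePoint k) a₂ ∧
    E.HasExponent OnePoint.infty a₃

/-- The polynomial `u = ∏ (x - τ)` over the new critical points. -/
noncomputable def newPoly : Polynomial k :=
  ∏ᶠ τ ∈ {τ : k | (τ : OnePoint k) ∈ E.new E.ω}, (Polynomial.X - Polynomial.C τ)

/-- `E` and `E'` agree up to isomorphism of `H`-Galois covers of `ℙ¹` and up to multiplying the
differential by an element of `𝔽_p^×`. -/
def EquivUpToScalar (E E' : SpecialDatum p k H χ) : Prop :=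
  ∃ φ : E.L ≃ₐ[RatFunc k] E'.L, (∀ (β : H) (f : E.L), φ (E.pull β f) = E'.pull β (φ f)) ∧
    ∃ c : (ZMod p)ˣ, diffMap ((φ.restrictScalars k : E.L ≃ₐ[k] E'.L) : E.L →ₐ[k] E'.L) E.ω
      = ZMod.castHom (dvd_refl p) k (c : ZMod p) • E'.ω

end SpecialDatum

/-- `u` solves the hypergeometric equation
`x (x - 1) u'' + [(A + B + 1) x - C] u' + A B u = 0`. -/
def SolvesHypergeometric {k : Type*} [Field k] (A B C : k) (u : Polynomial k) : Prop :=
  Polynomial.X * (Polynomial.X - 1) * Polynomial.derivative (Polynomial.derivative u)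
    + (Polynomial.C (A + B + 1) * Polynomial.X - Polynomial.C C) * Polynomial.derivative u
    + Polynomial.C (A * B) * u = 0

/-- The order of the cyclic group attached to a signature.  In the case
`a₁ + a₂ + a₃ = p - 1`, in which there are no new critical points, it is
the degree of a connected component of `z ^ (p - 1) = x ^ a₁ (x - 1) ^ a₂`. -/
def cyclicOrder (p a₁ a₂ a₃ : ℕ) : ℕ :=
  if a₁ + a₂ + a₃ < p - 1 then
    if Even a₁ ∧ Even a₂ ∧ Even a₃ then (p - 1) / 2 else p - 1
  else (p - 1) / Nat.gcd a₁ (Nat.gcd a₂ a₃)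

end DeformationData

/-! Write ω = F dx. Since χ takes values in the (p-1)-st roots of unity, G = F^(p-1) is invariant
under H, hence a rational function of x, and G encodes the whole datum. The order of H is prime to
p, so the cover is tame, m is the ramification index, and (p-1)σ equals ord G + (p-1) at a finite
point and ord G - (p-1) at infinity (`sigma_eq`). The conditions on σ therefore prescribe the
divisor of G. For a normalised hypergeometric datum without primitive points of σ = 1 one gets G = c
x^(a₁-(p-1)) (x-1)^(a₂-(p-1)) u^2, and the order at infinity gives 2 deg u + a₁ + a₂ + a₃ = p - 1
(`exists_ratPow_eq`).

Put D = d/dx. By Jacobson's formula F dx is logarithmic if and only if D^(p-1) F + F^p = 0. As F =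
F^p / G and p-th powers are constants for D, this says D^(p-1)(1/G) = -1, which is the polynomial
identity D^(p-1) Q = -c u^p with Q = x^(p-1-a₁) (x-1)^(p-1-a₂) u^(p-2) (`logarithmic_ratPow_iff`).
At a simple root τ of u, the value of D^(p-1) Q is (p-1)! times the derivative of Q / (x-τ)^(p-2),
and this vanishes exactly when the terms of order two and one of the hypergeometric operator,
applied to u, vanish at τ. Hence u divides this polynomial, whose degree is at most deg u; the
quotient is a constant, found from the leading coefficients (`hypergeometric_of_logPoly`). This is
(i).

Conversely, A = -d in characteristic p, with d the expected degree. The recursion for the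
coefficients has exactly one monic solution of degree d, and the indicial equations show that its
roots are simple and different from 0 and 1. Then D^(p-1) Q, being killed by D, is a p-th power R^p
with u dividing R, and a degree bound makes R a constant multiple of u. The constant is not zero,
because Q is not exact (`iterate_derivative_logPoly_ne_zero`). So u determines c and G, and a
component of the Kummer cover F^(p-1) = G carries the datum; its degree is the order m prescribed
for H (`exists_cover`, `cyclicOrder_dvd`).

For uniqueness, two data of the same signature have the same u, the same c, and so the same G. In a
common algebraic closure of k(x) their functions F differ by an element of 𝔽_p^×, and each generates
its function field because χ is injective (`equivUpToScalar_of_pow_eq`). -/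

namespace DeformationData

/-! ### Jacobson's formula and logarithmic derivatives. -/

section Jacobson

variable {R A : Type*} [CommRing R] [CommRing A] [Algebra R A] (D : Derivation R A A) (F : A)

/-- The operator `g ↦ D g + F g`. -/
def twisted (g : A) : A := D g + F * g

/-- The coefficient of `s ^ i` in `(D + s F) ^ n (1)`. -/
def twistedCoeff : ℕ → ℕ → A
  | 0, 0 => 1
  | 0, _ + 1 => 0
  | n + 1, 0 => D (twistedCoeff n 0)
  | n + 1, i + 1 => D (twistedCoeff n (i + 1)) + F * twistedCoeff n i

theorem twistedCoeff_eq_zero_of_lt {n i : ℕ} (h : n < i) : twistedCoeff D F n i = 0 := by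
  induction n generalizing i with
  | zero => obtain ⟨i, rfl⟩ := Nat.exists_eq_succ_of_ne_zero h.ne'; rfl
  | succ n ih =>
    obtain ⟨i, rfl⟩ := Nat.exists_eq_succ_of_ne_zero (Nat.ne_zero_of_lt h)
    simp [twistedCoeff, ih (show n < i by omega), ih (show n < i + 1 by omega)]

theorem twistedCoeff_self (n : ℕ) : twistedCoeff D F n n = F ^ n := by
  induction n with
  | zero => simp [twistedCoeff]
  | succ n ih => simp [twistedCoeff, ih, twistedCoeff_eq_zero_of_lt, pow_succ']

theorem twistedCoeff_succ_zero (n : ℕ) : twistedCoeff D F (n + 1) 0 = 0 := by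
  induction n with
  | zero => simp [twistedCoeff]
  | succ n ih => rw [twistedCoeff, ih, map_zero]

theorem twisted_iterate_one (n : ℕ) :
    (twisted D F)^[n] 1 = ∑ i ∈ Finset.range (n + 1), twistedCoeff D F n i := by
  induction n with
  | zero => simp [twistedCoeff]
  | succ n ih =>
    have h : ∑ i ∈ Finset.range (n + 1), D (twistedCoeff D F n i) =
        ∑ i ∈ Finset.range (n + 1), D (twistedCoeff D F n (i + 1)) + D (twistedCoeff D F n 0) := by
      rw [← Finset.sum_range_succ' (fun i => D (twistedCoeff D F n i)),
        Finset.sum_range_succ _ (n + 1), twistedCoeff_eq_zero_of_lt D F (Nat.lt_succ_self n),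
        map_zero, add_zero]
    rw [Function.iterate_succ_apply', ih, Finset.sum_range_succ' _ (n + 1)]
    simp only [twisted, twistedCoeff, Finset.sum_add_distrib, map_sum, Finset.mul_sum]
    rw [h]
    ring

/-- This compares the coefficients of s^i in the derivative of (D + s F)^(n+1) (1) with respect to
s. For n + 1 = p all binomial coefficients but the last are divisible by p. -/
theorem succ_mul_twistedCoeff (n i : ℕ) :
    ((i + 1 : ℕ) : A) * twistedCoeff D F (n + 1) (i + 1) =
      ∑ x ∈ Finset.HasAntidiagonal.antidiagonal n,
        ((n + 1).choose (x.1 + 1) : A) * (D^[x.1] F * twistedCoeff D F x.2 i) := by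
  induction n generalizing i with
  | zero => cases i <;> simp [twistedCoeff]
  | succ n ih =>
    have key : ((i + 1 : ℕ) : A) * twistedCoeff D F (n + 2) (i + 1) =
        F * twistedCoeff D F (n + 1) i + ∑ x ∈ Finset.HasAntidiagonal.antidiagonal n,
          ((n + 1).choose (x.1 + 1) : A) * (D^[x.1 + 1] F * twistedCoeff D F x.2 i
            + D^[x.1] F * twistedCoeff D F (x.2 + 1) i) := by
      have hD : ((i + 1 : ℕ) : A) * D (twistedCoeff D F (n + 1) (i + 1)) =
          ∑ x ∈ Finset.HasAntidiagonal.antidiagonal n, ((n + 1).choose (x.1 + 1) : A) *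
            (D^[x.1 + 1] F * twistedCoeff D F x.2 i + D^[x.1] F * D (twistedCoeff D F x.2 i)) := by
        have := congrArg D (ih i)
        rw [Derivation.leibniz, Derivation.map_natCast, smul_zero, add_zero, smul_eq_mul,
          map_sum] at this
        rw [this]
        refine Finset.sum_congr rfl fun x _ => ?_
        simp only [Derivation.leibniz, Derivation.map_natCast, smul_eq_mul,
          Function.iterate_succ_apply']
        ring
      rw [twistedCoeff, mul_add, hD]
      cases i with
      | zero => simp [twistedCoeff]; ring
      | succ i =>
        have h2 := congrArg (F * ·) (ih i)
        simp only [Finset.mul_sum] at h2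
        have : ((i + 1 + 1 : ℕ) : A) * (F * twistedCoeff D F (n + 1) (i + 1)) =
          F * twistedCoeff D F (n + 1) (i + 1) +
            F * (((i + 1 : ℕ) : A) * twistedCoeff D F (n + 1) (i + 1)) := by push_cast; ring
        rw [this, h2, add_left_comm, ← Finset.sum_add_distrib]
        congr 1
        refine Finset.sum_congr rfl fun x _ => ?_
        simp only [twistedCoeff]
        ring
    rw [key]
    have split : ∀ x ∈ Finset.HasAntidiagonal.antidiagonal (n + 1),
        ((n + 1 + 1).choose (x.1 + 1) : A) * (D^[x.1] F * twistedCoeff D F x.2 i) =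
          ((n + 1).choose x.1 : A) * (D^[x.1] F * twistedCoeff D F x.2 i) +
          ((n + 1).choose (x.1 + 1) : A) * (D^[x.1] F * twistedCoeff D F x.2 i) := by
      intro x _
      rw [Nat.choose_succ_succ]; push_cast; ring
    rw [Finset.sum_congr rfl split, Finset.sum_add_distrib, Finset.Nat.sum_antidiagonal_succ,
      Finset.Nat.sum_antidiagonal_succ' (n := n)
        (f := fun x => ((n + 1).choose (x.1 + 1) : A) * (D^[x.1] F * twistedCoeff D F x.2 i))]
    simp [mul_add, Finset.sum_add_distrib]
    ring

/-- Jacobson's formula `(D + F) ^ p (1) = D ^ (p - 1) (F) + F ^ p` (for `D ^ p = 0` it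
describes `(D + F) ^ p`). -/
theorem twisted_iterate_char_one (p : ℕ) [hp : Fact p.Prime] [CharP A p] [IsDomain A] :
    (twisted D F)^[p] 1 = D^[p - 1] F + F ^ p := by
  obtain ⟨n, rfl⟩ : ∃ n, p = n + 1 := ⟨p - 1, by have := hp.out.pos; omega⟩
  have hn : 0 < n := by have := hp.out.two_le; omega
  -- Only the term with the full power of D on F survives modulo p. Its second factor is a
  -- coefficient of 1, zero unless i = 0, so only the coefficients of s and s^p remain.
  have key : ∀ i, ((i + 1 : ℕ) : A) * twistedCoeff D F (n + 1) (i + 1) =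
      D^[n] F * twistedCoeff D F 0 i := by
    intro i
    rw [succ_mul_twistedCoeff, Finset.sum_eq_single (n, 0)]
    · simp
    · rintro ⟨a, b⟩ hab hne
      have hab' : a + b = n := by simpa using hab
      have ha : a ≠ n := by rintro rfl; exact hne (by simp; omega)
      have : ((n + 1).choose (a + 1) : A) = 0 := by
        rw [CharP.cast_eq_zero_iff A (n + 1)]
        exact hp.out.dvd_choose_self (by omega) (by omega)
      rw [this, zero_mul]
    · intro h; simp at h
  obtain ⟨n, rfl⟩ := Nat.exists_eq_succ_of_ne_zero hn.ne'
  rw [twisted_iterate_one, Finset.sum_range_succ, twistedCoeff_self, Finset.sum_range_succ',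
    twistedCoeff_succ_zero, add_zero, Finset.sum_range_succ']
  have h1 : twistedCoeff D F (n + 1 + 1) (0 + 1) = D^[n + 1] F := by
    simpa [twistedCoeff] using key 0
  rw [h1, Finset.sum_eq_zero, zero_add]
  · simp
  · intro i hi
    have h2 := key (i + 1)
    simp only [twistedCoeff, mul_zero] at h2
    refine (mul_eq_zero.1 h2).resolve_left fun h0 => ?_
    rw [CharP.cast_eq_zero_iff A (n + 1 + 1)] at h0
    have := Nat.le_of_dvd (by omega) h0
    simp at hi
    omega

theorem twisted_iterate_mul (n : ℕ) (a g : A) : (twisted D F)^[n] (a * g) =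
    ∑ x ∈ Finset.HasAntidiagonal.antidiagonal n, (n.choose x.1 : A) * (D^[x.1] a * (twisted D F)^[x.2] g) := by
  induction n with
  | zero => simp
  | succ n ih =>
    have hmul : ∀ b h : A, twisted D F (b * h) = D b * h + b * twisted D F h := by
      intro b h; simp [twisted]; ring
    have hadd : ∀ s : Finset (ℕ × ℕ), ∀ f : ℕ × ℕ → A,
        twisted D F (∑ x ∈ s, f x) = ∑ x ∈ s, twisted D F (f x) := by
      intro s f; simp [twisted, Finset.mul_sum, Finset.sum_add_distrib]
    have hnat : ∀ (m : ℕ) (h : A), twisted D F (m * h) = m * twisted D F h := by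
      intro m h; rw [hmul]; simp
    rw [Function.iterate_succ_apply', ih, hadd]
    simp only [hnat, hmul, ← Function.iterate_succ_apply']
    have split : ∀ x ∈ Finset.HasAntidiagonal.antidiagonal n,
        ((n + 1).choose (x.1 + 1) : A) * (D^[x.1 + 1] a * (twisted D F)^[x.2] g) =
          (n.choose x.1 : A) * (D^[x.1 + 1] a * (twisted D F)^[x.2] g) +
          (n.choose (x.1 + 1) : A) * (D^[x.1 + 1] a * (twisted D F)^[x.2] g) := by
      intro x _
      rw [Nat.choose_succ_succ]; push_cast; ring
    rw [Finset.Nat.sum_antidiagonal_succ, Finset.sum_congr rfl split, Finset.sum_add_distrib]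
    have h3 : ∑ x ∈ Finset.HasAntidiagonal.antidiagonal (n + 1),
        (n.choose x.1 : A) * (D^[x.1] a * (twisted D F)^[x.2] g) =
        ∑ x ∈ Finset.HasAntidiagonal.antidiagonal n, (n.choose x.1 : A) *
          (D^[x.1] a * (twisted D F)^[x.2 + 1] g) := by
      rw [Finset.Nat.sum_antidiagonal_succ']; simp
    rw [Finset.Nat.sum_antidiagonal_succ] at h3
    simp only [mul_add, Finset.sum_add_distrib, ← h3]
    simp
    ring

/-- In Leibniz' rule for a · 1 only the two extreme terms survive modulo p, and one of them contains
D^p a = 0. -/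
theorem twisted_iterate_char (p : ℕ) [hp : Fact p.Prime] [CharP A p] [IsDomain A]
    (hD : ∀ a, D^[p] a = 0) (a : A) :
    (twisted D F)^[p] a = a * (D^[p - 1] F + F ^ p) := by
  rw [← twisted_iterate_char_one]
  conv_lhs => rw [← mul_one a]
  rw [twisted_iterate_mul, Finset.sum_eq_single (0, p)]
  · simp
  · rintro ⟨i, j⟩ hij hne
    have hij' : i + j = p := by simpa using hij
    rcases eq_or_ne i p with rfl | hi
    · simp [hD]
    · have : (p.choose i : A) = 0 := by
        rw [CharP.cast_eq_zero_iff A p]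
        exact hp.out.dvd_choose_self (by rintro rfl; exact hne (by simp; omega)) (by omega)
      simp [this]
  · intro h; simp at h

/-- A function is a logarithmic derivative if and only if Jacobson's expression vanishes. -/
theorem exists_logDeriv_iff {R L : Type*} [CommRing R] [Field L] [Algebra R L]
    (D : Derivation R L L) (p : ℕ) [hp : Fact p.Prime] (hp2 : 2 < p) [CharP L p]
    (hD : ∀ a, D^[p] a = 0) (F : L) :
    (∃ f : L, f ≠ 0 ∧ D f = F * f) ↔ D^[p - 1] F + F ^ p = 0 := by
  have hodd : Odd p := hp.out.odd_of_ne_two (by omega)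
  have hneg : D^[p - 1] (-F) + (-F) ^ p = -(D^[p - 1] F + F ^ p) := by
    have hk : ∀ n, D^[n] (-F) = -D^[n] F := by
      intro n
      induction n with
      | zero => simp
      | succ n ih => rw [Function.iterate_succ_apply', Function.iterate_succ_apply', ih, map_neg]
    rw [hodd.neg_pow, hk]; ring
  -- The solutions of D f = F f form the kernel of T = D - F, and T^p is multiplication by minus
  -- Jacobson's expression, p being odd.
  have hT := twisted_iterate_char D (-F) p hD
  rw [hneg] at hT
  have hzero : ∀ n, (twisted D (-F))^[n] 0 = 0 := by
    intro n; exact Function.iterate_fixed (by simp [twisted]) n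
  constructor
  · rintro ⟨f, hf, hDf⟩
    have h0 : twisted D (-F) f = 0 := by simp [twisted, hDf]
    have h1 := hT f
    obtain ⟨n, rfl⟩ : ∃ n, p = n + 1 := ⟨p - 1, by omega⟩
    rw [Function.iterate_succ_apply, h0, hzero] at h1
    have h2 := (mul_eq_zero.1 h1.symm).resolve_left hf
    linear_combination -h2
  · intro h
    rw [h, neg_zero] at hT
    classical
    -- T is now nilpotent, so the last nonzero iterate of T on 1 lies in its kernel.
    have hex : ∃ n, (twisted D (-F))^[n] 1 = 0 := ⟨p, by simp [hT]⟩
    have hspec := Nat.find_spec hex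
    have hne : Nat.find hex ≠ 0 := by
      intro h0; rw [h0] at hspec; simp at hspec
    obtain ⟨n, hn⟩ := Nat.exists_eq_succ_of_ne_zero hne
    refine ⟨(twisted D (-F))^[n] 1, Nat.find_min hex (by omega), ?_⟩
    rw [hn, Function.iterate_succ_apply', twisted] at hspec
    linear_combination hspec

end Jacobson


/-! ### Differentials of a function field and the derivation d/dx. -/

section Differentials

variable {k L : Type*} [Field k] [Field L] [Algebra (RatFunc k) L] [Algebra k L]
  [IsScalarTower k (RatFunc k) L]

/-- A localisation followed by a separable extension is formally étale, so the differentials of L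
arise by base change from those of k[x], which are free on dx. -/
theorem exists_diffEquiv [Algebra.IsSeparable (RatFunc k) L] :
    ∃ e : Ω[L⁄k] ≃ₗ[L] L, e (D k L (algebraMap (RatFunc k) L RatFunc.X)) = 1 := by
  let _ : Algebra (Polynomial k) L :=
    ((algebraMap (RatFunc k) L).comp (algebraMap (Polynomial k) (RatFunc k))).toAlgebra
  have : IsScalarTower (Polynomial k) (RatFunc k) L := IsScalarTower.of_algebraMap_eq fun _ => rfl
  have : IsScalarTower k (Polynomial k) L := by
    refine IsScalarTower.of_algebraMap_eq fun c => ?_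
    rw [IsScalarTower.algebraMap_apply (Polynomial k) (RatFunc k) L,
      ← IsScalarTower.algebraMap_apply k (Polynomial k) (RatFunc k),
      ← IsScalarTower.algebraMap_apply k (RatFunc k) L]
  have : Algebra.FormallyEtale (RatFunc k) L := Algebra.FormallyEtale.of_isSeparable _ _
  have : Algebra.FormallyEtale (Polynomial k) (RatFunc k) :=
    Algebra.FormallyEtale.of_isLocalization (nonZeroDivisors (Polynomial k))
  have : Algebra.FormallyEtale (Polynomial k) L :=
    Algebra.FormallyEtale.comp (Polynomial k) (RatFunc k) L
  let e₁ := (KaehlerDifferential.tensorKaehlerEquivOfFormallyEtale k (Polynomial k) L).symm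
  let e₂ : L ⊗[Polynomial k] Ω[Polynomial k⁄k] ≃ₗ[L] L ⊗[Polynomial k] Polynomial k :=
    TensorProduct.AlgebraTensorModule.congr (LinearEquiv.refl L L)
      (KaehlerDifferential.polynomialEquiv k)
  let e₃ : L ⊗[Polynomial k] Polynomial k ≃ₗ[L] L :=
    TensorProduct.AlgebraTensorModule.rid (Polynomial k) L L
  refine ⟨(e₁.trans e₂).trans e₃, ?_⟩
  have hx : algebraMap (RatFunc k) L RatFunc.X = algebraMap (Polynomial k) L Polynomial.X := by
    rw [IsScalarTower.algebraMap_apply (Polynomial k) (RatFunc k) L, RatFunc.algebraMap_X]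
  rw [hx]
  simp [e₁, e₂, e₃, KaehlerDifferential.tensorKaehlerEquivOfFormallyEtale_symm_D_algebraMap]

variable (k L)

/-- The isomorphism `F dx ↦ F`. -/
noncomputable def diffEquiv [Algebra.IsSeparable (RatFunc k) L] : Ω[L⁄k] ≃ₗ[L] L :=
  (exists_diffEquiv (k := k) (L := L)).choose

/-- The derivation `d/dx`. -/
noncomputable def ddx [Algebra.IsSeparable (RatFunc k) L] : Derivation k L L :=
  (diffEquiv k L).toLinearMap.compDer (D k L)

variable {k L}

section
variable [Algebra.IsSeparable (RatFunc k) L]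

theorem ddx_X : ddx k L (algebraMap (RatFunc k) L RatFunc.X) = 1 :=
  (exists_diffEquiv (k := k) (L := L)).choose_spec

theorem diffEquiv_D (f : L) : diffEquiv k L (D k L f) = ddx k L f := rfl

theorem diffEquiv_smul_dx (ω : Ω[L⁄k]) :
    diffEquiv k L ω • D k L (algebraMap (RatFunc k) L RatFunc.X) = ω := by
  apply (diffEquiv k L).injective
  rw [map_smul, diffEquiv_D, ddx_X, smul_eq_mul, mul_one]

theorem D_X_ne_zero : D k L (algebraMap (RatFunc k) L RatFunc.X) ≠ 0 := by
  intro h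
  have := ddx_X (k := k) (L := L)
  rw [← diffEquiv_D, h, map_zero] at this
  exact zero_ne_one this

theorem ddx_aeval (q : Polynomial k) :
    ddx k L (Polynomial.aeval (algebraMap (RatFunc k) L RatFunc.X) q) =
      Polynomial.aeval (algebraMap (RatFunc k) L RatFunc.X) (Polynomial.derivative q) := by
  rw [Derivation.map_aeval, ddx_X, smul_eq_mul, mul_one]

theorem ddx_iterate_aeval (n : ℕ) (q : Polynomial k) :
    (ddx k L)^[n] (Polynomial.aeval (algebraMap (RatFunc k) L RatFunc.X) q) =
      Polynomial.aeval (algebraMap (RatFunc k) L RatFunc.X) (Polynomial.derivative^[n] q) := by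
  induction n with
  | zero => rfl
  | succ n ih => rw [Function.iterate_succ_apply', ih, ddx_aeval, Function.iterate_succ_apply']

end

theorem derivation_pow_char {R A M : Type*} [CommRing R] [CommRing A] [Algebra R A]
    [AddCommGroup M] [Module R M] [Module A M]
    (δ : Derivation R A M) (p : ℕ) [CharP A p] (a : A) : δ (a ^ p) = 0 := by
  rw [Derivation.leibniz_pow, ← Nat.cast_smul_eq_nsmul A, CharP.cast_eq_zero, zero_smul]

theorem derivation_pow_char_mul {R A : Type*} [CommRing R] [CommRing A] [Algebra R A]
    (δ : Derivation R A A) (p : ℕ) [CharP A p] (a b : A) (n : ℕ) :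
    δ^[n] (a ^ p * b) = a ^ p * δ^[n] b := by
  induction n with
  | zero => rfl
  | succ n ih =>
    rw [Function.iterate_succ_apply', ih, Derivation.leibniz, derivation_pow_char,
      Function.iterate_succ_apply']
    simp

variable (p : ℕ) [hp : Fact p.Prime] [CharP k p]

/-- `f` is a polynomial in `y` of degree less than `p` with `p`-th powers as coefficients. -/
def IsSumPow {L : Type*} [Field L] (p : ℕ) (y f : L) : Prop :=
  ∃ c : ℕ → L, f = ∑ i ∈ Finset.range p, c i ^ p * y ^ i

section
variable {p}

theorem IsSumPow.add [CharP L p] {y f g : L} (hf : IsSumPow p y f) (hg : IsSumPow p y g) :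
    IsSumPow p y (f + g) := by
  obtain ⟨c, rfl⟩ := hf
  obtain ⟨d, rfl⟩ := hg
  refine ⟨c + d, ?_⟩
  simp only [Pi.add_apply, add_pow_char, add_mul, Finset.sum_add_distrib]

omit hp in
theorem IsSumPow.pow_mul {y f : L} (hf : IsSumPow p y f) (a : L) :
    IsSumPow p y (a ^ p * f) := by
  obtain ⟨c, rfl⟩ := hf
  refine ⟨fun i => a * c i, ?_⟩
  simp only [Finset.mul_sum, mul_pow, mul_assoc]

theorem IsSumPow.of_pow (y a : L) : IsSumPow p y (a ^ p) := by
  refine ⟨fun i => if i = 0 then a else 0, ?_⟩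
  rw [Finset.sum_eq_single 0] <;> simp +contextual [hp.out.ne_zero, hp.out.pos]

theorem IsSumPow.zero (y : L) : IsSumPow p y 0 := by
  simpa [hp.out.ne_zero] using IsSumPow.of_pow (p := p) y 0

theorem IsSumPow.self_mul {y f : L} (hf : IsSumPow p y f) : IsSumPow p y (y * f) := by
  obtain ⟨c, rfl⟩ := hf
  obtain ⟨n, rfl⟩ : ∃ n, p = n + 1 := ⟨p - 1, by have := hp.out.pos; omega⟩
  refine ⟨fun i => if i = 0 then c n * y else c (i - 1), ?_⟩
  rw [Finset.sum_range_succ, Finset.sum_range_succ']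
  simp only [mul_add, Finset.mul_sum]
  congr 1
  · refine Finset.sum_congr rfl fun i _ => ?_
    simp
    ring
  · simp
    ring

omit [Algebra (RatFunc k) L] [IsScalarTower k (RatFunc k) L] in
theorem IsSumPow.aeval_mul [CharP L p] [PerfectRing k p] {y f : L} (hf : IsSumPow p y f)
    (q : Polynomial k) :
    IsSumPow p y (Polynomial.aeval y q * f) := by
  induction q using Polynomial.induction_on' with
  | add q r hq hr => rw [map_add, add_mul]; exact hq.add hr
  | monomial n a =>
    rw [Polynomial.aeval_monomial, mul_assoc]
    obtain ⟨b, rfl⟩ := surjective_frobenius k p a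
    rw [frobenius_def, map_pow]
    refine IsSumPow.pow_mul ?_ _
    induction n with
    | zero => simpa
    | succ n ih => rw [pow_succ', mul_assoc]; exact ih.self_mul
end

/-- Separability makes the p-th powers span L over k(x). A rational scalar a/b is rewritten as a
b^(p-1) / b^p, and the coefficients of a polynomial are p-th powers since k is perfect. -/
theorem isSumPow_X [PerfectRing k p] [Algebra.IsSeparable (RatFunc k) L] (f : L) :
    IsSumPow p (algebraMap (RatFunc k) L RatFunc.X) f := by
  have hchar : CharP L p := charP_of_injective_algebraMap (algebraMap k L).injective p
  have hspan := Field.span_map_pow_expChar_pow_eq_top_of_isSeparable (F := RatFunc k) (E := L)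
    p 1 (v := (id : L → L)) (by simp)
  have hf : f ∈ Submodule.span (RatFunc k) (Set.range fun a : L => (id a) ^ p ^ 1) := by
    rw [hspan]; trivial
  induction hf using Submodule.span_induction with
  | mem f h =>
    obtain ⟨a, rfl⟩ := h
    simpa using IsSumPow.of_pow _ a
  | zero => exact IsSumPow.zero _
  | add f g _ _ hf hg => exact hf.add hg
  | smul g f _ hf =>
    have h := (hf.aeval_mul (g.num * g.denom ^ (p - 1))).pow_mul
      (Polynomial.aeval (algebraMap (RatFunc k) L RatFunc.X) g.denom)⁻¹
    have haeval : ∀ q : Polynomial k, Polynomial.aeval (algebraMap (RatFunc k) L RatFunc.X) q =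
        algebraMap (RatFunc k) L (algebraMap (Polynomial k) (RatFunc k) q) := by
      intro q
      rw [Polynomial.aeval_algebraMap_apply, RatFunc.aeval_X_left_eq_algebraMap]
    have hd : algebraMap (RatFunc k) L (algebraMap (Polynomial k) (RatFunc k) g.denom) ≠ 0 := by
      simp [RatFunc.denom_ne_zero]
    convert h using 1
    rw [Algebra.smul_def]
    conv_lhs => rw [← RatFunc.num_div_denom g]
    rw [haeval, haeval, map_div₀, map_mul, map_mul, map_pow, map_pow]
    have hpp : ∀ d : L, d ^ p = d * d ^ (p - 1) := fun d => by
      rw [← pow_succ', Nat.sub_add_cancel hp.out.pos]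
    rw [inv_pow, hpp]
    field_simp

/-- The derivation is linear over p-th powers, and p derivatives kill x^i for i < p. -/
theorem ddx_iterate_char [PerfectRing k p] [Algebra.IsSeparable (RatFunc k) L] (f : L) :
    (ddx k L)^[p] f = 0 := by
  have hchar : CharP L p := charP_of_injective_algebraMap (algebraMap k L).injective p
  obtain ⟨c, rfl⟩ := isSumPow_X (k := k) p f
  have hlin : ∀ (n : ℕ) (s : Finset ℕ) (g : ℕ → L),
      (ddx k L)^[n] (∑ i ∈ s, g i) = ∑ i ∈ s, (ddx k L)^[n] (g i) := by
    intro n s g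
    induction n with
    | zero => rfl
    | succ n ih => simp only [Function.iterate_succ_apply', ih, map_sum]
  rw [hlin]
  refine Finset.sum_eq_zero fun i hi => ?_
  have : algebraMap (RatFunc k) L RatFunc.X ^ i =
    Polynomial.aeval (algebraMap (RatFunc k) L RatFunc.X) (Polynomial.X ^ i : Polynomial k) := by
    simp
  rw [derivation_pow_char_mul, this, ddx_iterate_aeval,
    Polynomial.iterate_derivative_eq_zero (by simpa using hi), map_zero, mul_zero]

end Differentials


/-! ### Orders at a point and its residue field. -/

namespace Point

section Basic

variable {k L : Type*} [Field k] [Field L] [Algebra k L] (ξ : Point k L)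

/-- The order of a function at a point (with junk value `0` at the zero function). -/
noncomputable def ord (f : L) : ℤ := -WithZero.log (ξ.val f)

variable {ξ}

theorem val_ne_zero {f : L} (hf : f ≠ 0) : ξ.val f ≠ 0 := (Valuation.ne_zero_iff _).2 hf

theorem val_eq {f : L} (hf : f ≠ 0) : ξ.val f = WithZero.exp (-ξ.ord f) := by
  rw [ord, neg_neg, WithZero.exp_log (val_ne_zero hf)]

theorem ord_of_val {f : L} {n : ℤ} (h : ξ.val f = WithZero.exp (-n)) : ξ.ord f = n := by
  rw [ord, h, WithZero.log_exp, neg_neg]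

theorem ne_zero_of_val {f : L} {n : ℤ} (h : ξ.val f = WithZero.exp n) : f ≠ 0 := by
  rintro rfl
  rw [map_zero] at h
  exact WithZero.exp_ne_zero h.symm

theorem ord_mul {f g : L} (hf : f ≠ 0) (hg : g ≠ 0) : ξ.ord (f * g) = ξ.ord f + ξ.ord g := by
  rw [ord, map_mul, WithZero.log_mul (val_ne_zero hf) (val_ne_zero hg), ord, ord]; ring

theorem ord_pow (f : L) (n : ℕ) : ξ.ord (f ^ n) = n * ξ.ord f := by
  rw [ord, map_pow, WithZero.log_pow, ord]; simp

theorem ord_inv (f : L) : ξ.ord f⁻¹ = -ξ.ord f := by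
  rw [ord, map_inv₀, WithZero.log_inv, ord]

theorem ord_zpow (f : L) (n : ℤ) : ξ.ord (f ^ n) = n * ξ.ord f := by
  rw [ord, map_zpow₀, WithZero.log_zpow, ord]; simp

theorem val_le_one_iff {f : L} (hf : f ≠ 0) : ξ.val f ≤ 1 ↔ 0 ≤ ξ.ord f := by
  rw [val_eq hf, ← WithZero.exp_zero, WithZero.exp_le_exp]; omega

theorem val_lt_one_iff {f : L} (hf : f ≠ 0) : ξ.val f < 1 ↔ 0 < ξ.ord f := by
  rw [val_eq hf, ← WithZero.exp_zero, WithZero.exp_lt_exp]; omega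

theorem val_eq_one_iff {f : L} (hf : f ≠ 0) : ξ.val f = 1 ↔ ξ.ord f = 0 := by
  rw [val_eq hf, ← WithZero.exp_zero, WithZero.exp_inj]; omega

theorem val_algebraMap_le_one (c : k) : ξ.val (algebraMap k L c) ≤ 1 := by
  by_cases h : c = 0
  · simp [h]
  · exact (ξ.trivial_on c h).le

variable (ξ)

theorem exists_uniformizer : ∃ t, ξ.val t = WithZero.exp (-1 : ℤ) := ξ.surj _

variable {ξ}

theorem exp_neg_one_lt_one : WithZero.exp (-1 : ℤ) < 1 := by
  rw [← WithZero.exp_zero, WithZero.exp_lt_exp]; omega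

theorem val_le_exp_of_lt_one {f : L} (h : ξ.val f < 1) : ξ.val f ≤ WithZero.exp (-1 : ℤ) := by
  by_cases hf : f = 0
  · simp [hf]
  · rw [val_lt_one_iff hf] at h
    rw [val_eq hf, WithZero.exp_le_exp]; omega

/-- Divided by a power of t, an algebraic relation would have a nonzero constant term, a unit lying
in the maximal ideal. -/
theorem transcendental_of_val_lt_one {t : L} (ht : t ≠ 0) (h : ξ.val t < 1) :
    Transcendental k t := by
  intro halg
  obtain ⟨q, hq, hqt⟩ := halg
  obtain ⟨r, hr, hr0⟩ := Polynomial.exists_eq_pow_rootMultiplicity_mul_and_not_dvd q hq 0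
  rw [hr] at hqt
  simp only [map_zero, sub_zero, map_mul, map_pow, Polynomial.aeval_X, mul_eq_zero] at hqt
  have h1 : Polynomial.aeval t r = 0 := hqt.resolve_left (pow_ne_zero _ ht)
  have h2 : r.coeff 0 ≠ 0 := by
    rw [map_zero, sub_zero, Polynomial.X_dvd_iff] at hr0; exact hr0
  rw [← Polynomial.divX_mul_X_add r, map_add, Polynomial.aeval_C, map_mul, Polynomial.aeval_X]
    at h1
  have h3 : ξ.val (Polynomial.aeval t r.divX) ≤ 1 := by
    rw [Polynomial.aeval_eq_sum_range]
    refine ξ.val.map_sum_le fun i _ => ?_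
    rw [Algebra.smul_def, map_mul, map_pow]
    exact mul_le_one' (val_algebraMap_le_one _) (pow_le_one' h.le _)
  have h4 := ξ.trivial_on _ h2
  rw [← neg_eq_iff_add_eq_zero] at h1
  rw [← h1, Valuation.map_neg, map_mul] at h4
  exact absurd h4 (mul_lt_one_of_nonneg_of_lt_one_right h3 zero_le h).ne

theorem val_aeval_le_one {f : L} (hf : ξ.val f ≤ 1) (q : Polynomial k) :
    ξ.val (Polynomial.aeval f q) ≤ 1 := by
  rw [Polynomial.aeval_eq_sum_range]
  refine ξ.val.map_sum_le fun i _ => ?_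
  rw [Algebra.smul_def, map_mul, map_pow]
  exact mul_le_one' (val_algebraMap_le_one _) (pow_le_one' hf _)

/-- The constant is the coefficient of t^n: the bound on the value forces all lower coefficients to
vanish. -/
theorem exists_coeff {t : L} (ht : t ≠ 0) (h : ξ.val t < 1) (n : ℕ) (q : Polynomial k)
    (hq : ξ.val (Polynomial.aeval t q) ≤ ξ.val t ^ n) :
    ∃ c : k, ξ.val (algebraMap k L c * t ^ n - Polynomial.aeval t q) < ξ.val t ^ n := by
  have hvt : 0 < ξ.val t := zero_lt_iff.2 (val_ne_zero ht)
  induction n generalizing q with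
  | zero =>
    refine ⟨q.coeff 0, ?_⟩
    have h3 : algebraMap k L (q.coeff 0) * t ^ 0 - Polynomial.aeval t q =
        -(Polynomial.aeval t q.divX * t) := by
      conv_lhs => enter [2]; rw [← Polynomial.divX_mul_X_add q]
      simp
    rw [h3, Valuation.map_neg, map_mul, pow_zero]
    exact mul_lt_one_of_nonneg_of_lt_one_right (val_aeval_le_one h.le _) zero_le h
  | succ n ih =>
    have h0 : q.coeff 0 = 0 := by
      by_contra h0
      have h1 : ξ.val (Polynomial.aeval t q) < 1 :=
        hq.trans_lt (pow_lt_one₀ zero_le h (by omega))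
      have h2 := ξ.trivial_on _ h0
      have h3 : algebraMap k L (q.coeff 0) =
          Polynomial.aeval t q - Polynomial.aeval t q.divX * t := by
        conv_rhs => enter [1]; rw [← Polynomial.divX_mul_X_add q]
        simp
      rw [h3] at h2
      refine absurd h2 (ne_of_lt (ξ.val.map_sub_lt h1 ?_))
      rw [map_mul]
      exact mul_lt_one_of_nonneg_of_lt_one_right (val_aeval_le_one h.le _) zero_le h
    have hqt : Polynomial.aeval t q = Polynomial.aeval t q.divX * t := by
      conv_lhs => rw [← Polynomial.divX_mul_X_add q]
      simp [h0]
    rw [hqt, map_mul, pow_succ] at hq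
    obtain ⟨c, hc⟩ := ih q.divX (le_of_mul_le_mul_right hq hvt)
    refine ⟨c, ?_⟩
    have : algebraMap k L c * t ^ (n + 1) - Polynomial.aeval t q =
        (algebraMap k L c * t ^ n - Polynomial.aeval t q.divX) * t := by rw [hqt]; ring
    rw [this, map_mul, pow_succ]
    exact mul_lt_mul_of_pos_right hc hvt

/-- The residue field is the constant field. -/
theorem exists_residue_of_trdeg [IsAlgClosed k] (htr : Algebra.trdeg k L = 1) {f : L}
    (hf : ξ.val f ≤ 1) : ∃ c : k, ξ.val (f - algebraMap k L c) < 1 := by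
  obtain ⟨t, ht⟩ := ξ.exists_uniformizer
  have ht0 : t ≠ 0 := ne_zero_of_val ht
  have ht1 : ξ.val t < 1 := ht ▸ exp_neg_one_lt_one
  -- The transcendence degree is one, and t is already transcendental.
  have halg : IsAlgebraic (Algebra.adjoin k (Set.range fun _ : Unit => t)) f := by
    by_contra hnot
    have hind : AlgebraicIndependent k (fun _ : Unit => t) :=
      algebraicIndependent_unique_type_iff.2 (transcendental_of_val_lt_one ht0 ht1)
    have h2 := ((hind.option_iff_transcendental f).2 hnot).lift_cardinalMk_le_trdeg
    rw [htr] at h2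
    simp at h2
  obtain ⟨P, hP, hPf⟩ := halg
  have hcoef : ∀ i, ∃ q : Polynomial k, Polynomial.aeval t q = (P.coeff i : L) := by
    have hmem : ∀ s ∈ Algebra.adjoin k (Set.range fun _ : Unit => t),
        ∃ q : Polynomial k, Polynomial.aeval t q = s := by
      intro s hs
      rw [Set.range_const, Algebra.adjoin_singleton_eq_range_aeval] at hs
      exact hs
    exact fun i => hmem _ (P.coeff i).2
  choose q hq using hcoef
  obtain ⟨j, hj, hjmax⟩ := Finset.exists_max_image P.support (fun i => ξ.val (P.coeff i : L))
    (Polynomial.support_nonempty.2 hP)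
  have hj0 : (P.coeff j : L) ≠ 0 := by
    simpa using Polynomial.mem_support_iff.1 hj
  obtain ⟨n, hn⟩ : ∃ n : ℕ, ξ.val (P.coeff j : L) = ξ.val t ^ n := by
    have h1 : ξ.val (P.coeff j : L) ≤ 1 := by rw [← hq]; exact val_aeval_le_one ht1.le _
    rw [val_le_one_iff hj0] at h1
    refine ⟨(ξ.ord (P.coeff j : L)).toNat, ?_⟩
    rw [val_eq hj0, ht, ← WithZero.exp_nsmul, WithZero.exp_inj]
    simp; omega
  have hle : ∀ i, ξ.val (P.coeff i : L) ≤ ξ.val t ^ n := by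
    intro i
    by_cases hi : i ∈ P.support
    · exact hn ▸ hjmax i hi
    · rw [Polynomial.notMem_support_iff.1 hi]; simp
  have hvt : 0 < ξ.val t ^ n := zero_lt_iff.2 (pow_ne_zero _ (val_ne_zero ht0))
  choose c hc using fun i => exists_coeff ht0 ht1 n (q i) (by rw [hq]; exact hle i)
  have hcj : c j ≠ 0 := by
    intro h0
    have := hc j
    rw [h0, hq, map_zero, zero_mul, zero_sub, Valuation.map_neg, hn] at this
    exact this.ne rfl
  -- Divided by t^n, the largest of them in value, the coefficients of P reduce to the constants c
  -- i, not all zero; the reduced relation puts Q(f) in the maximal ideal.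
  set Q : Polynomial k := ∑ i ∈ Finset.range (P.natDegree + 1), Polynomial.C (c i) * Polynomial.X ^ i
    with hQ
  have hQ0 : Q ≠ 0 := by
    intro h0
    apply hcj
    have := congrArg (fun r => Polynomial.coeff r j) h0
    simp only [hQ, Polynomial.finsetSum_coeff, Polynomial.coeff_C_mul, Polynomial.coeff_X_pow,
      Polynomial.coeff_zero] at this
    rw [Finset.sum_eq_single j] at this
    · simpa using this
    · intro b _ hb; simp [hb.symm]
    · intro hb
      exact absurd (Finset.mem_range.2 (Nat.lt_succ_of_le (Polynomial.le_natDegree_of_mem_supp j hj))) hb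
  have hQf : ξ.val (Polynomial.aeval f Q) < 1 := by
    have h1 : Polynomial.aeval f Q * t ^ n = ∑ i ∈ Finset.range (P.natDegree + 1),
        (algebraMap k L (c i) * t ^ n - Polynomial.aeval t (q i)) * f ^ i := by
      rw [Polynomial.aeval_eq_sum_range] at hPf
      have hPf' : ∑ i ∈ Finset.range (P.natDegree + 1), (P.coeff i : L) * f ^ i = 0 := by
        rw [← hPf]; rfl
      simp only [hq, sub_mul, Finset.sum_sub_distrib, hPf', sub_zero, hQ, map_sum, map_mul,
        Polynomial.aeval_C, map_pow, Polynomial.aeval_X, Finset.sum_mul]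
      exact Finset.sum_congr rfl fun i _ => by ring
    have h2 : ξ.val (Polynomial.aeval f Q * t ^ n) < ξ.val t ^ n := by
      rw [h1]
      refine ξ.val.map_sum_lt hvt.ne' fun i _ => ?_
      rw [map_mul, map_pow]
      exact (mul_le_of_le_one_right' (pow_le_one' hf i)).trans_lt (hc i)
    rw [map_mul, map_pow] at h2
    by_contra h3
    exact absurd h2 (not_lt.2 (le_mul_of_one_le_left' (not_lt.1 h3)))
  -- Q splits over k, so one of the factors f - a must lie in the maximal ideal.
  by_contra! hno
  have hno' : ∀ a : k, ξ.val (f - algebraMap k L a) = 1 := fun a =>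
    le_antisymm (ξ.val.map_sub_le hf (val_algebraMap_le_one a)) (hno a)
  have hsplit := (IsAlgClosed.splits Q).eq_prod_roots
  rw [hsplit, map_mul, map_multiset_prod, map_mul, map_multiset_prod, Polynomial.aeval_C,
    ξ.trivial_on _ (Polynomial.leadingCoeff_ne_zero.2 hQ0), one_mul] at hQf
  refine hQf.ne (Multiset.prod_eq_one fun a ha => ?_)
  simp only [Multiset.map_map, Multiset.mem_map, Function.comp_apply] at ha
  obtain ⟨b, _, rfl⟩ := ha
  simp [hno']

end Basic

section FunctionField

variable {k L : Type u} [Field k] [Field L] [Algebra (RatFunc k) L] [Algebra k L]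
  [IsScalarTower k (RatFunc k) L]

theorem trdeg_functionField [Algebra.IsAlgebraic (RatFunc k) L] : Algebra.trdeg k L = 1 := by
  have h1 := trdeg_add_eq k (RatFunc k) (A := L)
  have h2 := trdeg_add_eq k (Polynomial k) (A := RatFunc k)
  have : Algebra.IsAlgebraic (Polynomial k) (RatFunc k) :=
    IsLocalization.isAlgebraic (RatFunc k) (nonZeroDivisors (Polynomial k))
  rw [_root_.trdeg_eq_zero (R := RatFunc k), add_zero, ← h2, Polynomial.trdeg_of_isDomain,
    _root_.trdeg_eq_zero, add_zero] at h1
  exact h1.symm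

theorem exists_residue [IsAlgClosed k] [Algebra.IsAlgebraic (RatFunc k) L] {ξ : Point k L} {f : L}
    (hf : ξ.val f ≤ 1) : ∃ c : k, ξ.val (f - algebraMap k L c) < 1 :=
  exists_residue_of_trdeg (trdeg_functionField (k := k)) hf

end FunctionField

end Point


/-! ### Local parameters and the order of a differential. -/

namespace Point

section Uniformizer

variable {k L : Type u} [Field k] [Field L] [Algebra k L]
  (p : ℕ) [hp : Fact p.Prime] {ξ : Point k L}

/-- The nonzero terms have orders p ord (c i) + i, which are incongruent modulo p. Hence no
cancellation takes place. -/
theorem val_term_le_val_sum {t : L} (ht : ξ.val t = WithZero.exp (-1 : ℤ)) (c : ℕ → L)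
    {j : ℕ} (hj : j < p) :
    ξ.val (c j ^ p * t ^ j) ≤ ξ.val (∑ i ∈ Finset.range p, c i ^ p * t ^ i) := by
  have ht0 : t ≠ 0 := ne_zero_of_val ht
  obtain ⟨m, hm, hmax⟩ := Finset.exists_max_image (Finset.range p)
    (fun i => ξ.val (c i ^ p * t ^ i)) ⟨j, Finset.mem_range.2 hj⟩
  refine (hmax j (Finset.mem_range.2 hj)).trans ?_
  by_cases hcm : c m = 0
  · simp [hcm, hp.out.ne_zero]
  refine (ξ.val.map_sum_eq_of_lt (f := fun i => c i ^ p * t ^ i) hm fun i hi => ?_).ge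
  rw [Finset.mem_sdiff, Finset.mem_singleton, Finset.mem_range] at hi
  by_cases hci : c i = 0
  · rw [hci, zero_pow hp.out.ne_zero, zero_mul, map_zero]
    exact zero_lt_iff.2 (val_ne_zero (mul_ne_zero (pow_ne_zero _ hcm) (pow_ne_zero _ ht0)))
  refine lt_of_le_of_ne (hmax i (Finset.mem_range.2 hi.1)) fun heq => hi.2 ?_
  rw [val_eq (mul_ne_zero (pow_ne_zero _ hci) (pow_ne_zero _ ht0)),
    val_eq (mul_ne_zero (pow_ne_zero _ hcm) (pow_ne_zero _ ht0)), WithZero.exp_inj,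
    ord_mul (pow_ne_zero _ hci) (pow_ne_zero _ ht0),
    ord_mul (pow_ne_zero _ hcm) (pow_ne_zero _ ht0), ord_pow, ord_pow, ord_pow, ord_pow,
    ord_of_val ht] at heq
  have h1 : ((i : ℤ) - m) = p * (ξ.ord (c m) - ξ.ord (c i)) := by linarith
  have h2 : (p : ℤ) ∣ (i : ℤ) - m := ⟨_, h1⟩
  have hm' := Finset.mem_range.1 hm
  have h3 := Int.eq_zero_of_abs_lt_dvd h2 (by rw [abs_lt]; omega)
  omega

variable [CharP k p] [Algebra (RatFunc k) L] [IsScalarTower k (RatFunc k) L]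
  [Algebra.IsSeparable (RatFunc k) L]

/-- The powers of x below p span L over its subfield of p-th powers, so the degree is at most p. The
powers of t below p are independent by the absence of cancellation, hence form a basis. -/
theorem isSumPow_uniformizer [PerfectRing k p] {t : L}
    (ht : ξ.val t = WithZero.exp (-1 : ℤ)) (f : L) : IsSumPow p t f := by
  have hchar : CharP L p := charP_of_injective_algebraMap (algebraMap k L).injective p
  classical
  let M : Subfield L := (frobenius L p).fieldRange
  have hMmem : ∀ a : M, ∃ b : L, b ^ p = a := fun a => by
    obtain ⟨b, hb⟩ := a.2
    exact ⟨b, hb⟩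
  let x : L := algebraMap (RatFunc k) L RatFunc.X
  have hspan : Submodule.span M (Set.range fun i : Fin p => x ^ (i : ℕ)) = ⊤ := by
    rw [eq_top_iff]
    intro g _
    obtain ⟨c, rfl⟩ := isSumPow_X (k := k) p g
    refine Submodule.sum_mem _ fun i hi => ?_
    have h1 : c i ^ p * x ^ i = (⟨c i ^ p, c i, rfl⟩ : M) • x ^ i := rfl
    rw [h1]
    exact Submodule.smul_mem _ _ (Submodule.subset_span ⟨⟨i, Finset.mem_range.1 hi⟩, rfl⟩)
  have hfin : Module.Finite M L := ⟨⟨Finset.univ.image fun i : Fin p => x ^ (i : ℕ), by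
    rw [Finset.coe_image, Finset.coe_univ, Set.image_univ]; exact hspan⟩⟩
  have hle : Module.finrank M L ≤ p := by
    have := finrank_range_le_card (R := M) fun i : Fin p => x ^ (i : ℕ)
    rwa [Set.finrank, hspan, finrank_top, Fintype.card_fin] at this
  have hli : LinearIndependent M fun i : Fin p => t ^ (i : ℕ) := by
    rw [Fintype.linearIndependent_iff]
    intro g hg i
    choose b hb using fun i => hMmem (g i)
    let c : ℕ → L := fun i => if h : i < p then b ⟨i, h⟩ else 0
    have hsum : ∑ i ∈ Finset.range p, c i ^ p * t ^ i = 0 := by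
      rw [Finset.sum_range, ← hg]
      refine Finset.sum_congr rfl fun j _ => ?_
      simp only [c, j.2, dif_pos, Fin.eta, hb]
      rfl
    have := val_term_le_val_sum p ht c i.2
    rw [hsum, map_zero, le_zero_iff, Valuation.zero_iff] at this
    have h2 := (mul_eq_zero.1 this).resolve_right (pow_ne_zero _ (ne_zero_of_val ht))
    simp only [c, i.2, dif_pos, Fin.eta, hb] at h2
    exact Subtype.ext h2
  have hcard : Fintype.card (Fin p) = Module.finrank M L :=
    le_antisymm (by simpa using hli.fintype_card_le_finrank) (by simpa using hle)
  have htop := hli.span_eq_top_of_card_eq_finrank' hcard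
  have hf : f ∈ Submodule.span M (Set.range fun i : Fin p => t ^ (i : ℕ)) := by
    rw [htop]; trivial
  rw [Submodule.mem_span_range_iff_exists_fun] at hf
  obtain ⟨g, rfl⟩ := hf
  choose b hb using fun i => hMmem (g i)
  refine ⟨fun i => if h : i < p then b ⟨i, h⟩ else 0, ?_⟩
  rw [Finset.sum_range]
  refine Finset.sum_congr rfl fun j _ => ?_
  simp only [j.2, dif_pos, Fin.eta, hb]
  rfl

/-- The differential of a regular function is a regular multiple of the differential of a
local parameter. -/
theorem exists_D_eq_smul [PerfectRing k p] {t : L} (ht : ξ.val t = WithZero.exp (-1 : ℤ)) (f : L) :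
    ∃ a : L, D k L f = a • D k L t ∧ (ξ.val f ≤ 1 → ξ.val a ≤ 1) := by
  have hchar : CharP L p := charP_of_injective_algebraMap (algebraMap k L).injective p
  obtain ⟨c, rfl⟩ := isSumPow_uniformizer (k := k) p ht f
  refine ⟨∑ i ∈ Finset.range p, c i ^ p * (i * t ^ (i - 1)), ?_, fun hf => ?_⟩
  · rw [map_sum, Finset.sum_smul]
    refine Finset.sum_congr rfl fun i _ => ?_
    rw [Derivation.leibniz, derivation_pow_char _ p, smul_zero, add_zero, Derivation.leibniz_pow,
      mul_smul, mul_smul, Nat.cast_smul_eq_nsmul]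
  · refine ξ.val.map_sum_le fun i hi => ?_
    have hterm := (val_term_le_val_sum p ht c (Finset.mem_range.1 hi)).trans hf
    have hvt : ξ.val t ≤ 1 := ht ▸ exp_neg_one_lt_one.le
    have hnat : ξ.val (i : L) ≤ 1 := by
      rw [← map_natCast (algebraMap k L)]; exact val_algebraMap_le_one _
    have hci : ξ.val (c i) ≤ 1 := by
      by_cases h0 : c i = 0
      · simp [h0]
      have ht0 := ne_zero_of_val ht
      rw [val_le_one_iff (mul_ne_zero (pow_ne_zero _ h0) (pow_ne_zero _ ht0)),
        ord_mul (pow_ne_zero _ h0) (pow_ne_zero _ ht0), ord_pow, ord_pow, ord_of_val ht] at hterm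
      rw [val_le_one_iff h0]
      have := Finset.mem_range.1 hi
      by_contra hneg
      have h1 : (p : ℤ) * ξ.ord (c i) ≤ p * (-1) :=
        mul_le_mul_of_nonneg_left (by omega) (by omega)
      omega
    rw [map_mul, map_mul, map_pow, map_pow]
    exact mul_le_one' (pow_le_one' hci _) (mul_le_one' hnat (pow_le_one' hvt _))

theorem D_uniformizer_ne_zero [PerfectRing k p] {t : L} (ht : ξ.val t = WithZero.exp (-1 : ℤ)) :
    D k L t ≠ 0 := by
  intro h
  obtain ⟨a, ha, -⟩ := exists_D_eq_smul (k := k) p ht (algebraMap (RatFunc k) L RatFunc.X)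
  rw [h, smul_zero] at ha
  exact D_X_ne_zero ha

omit [Algebra (RatFunc k) L] [IsScalarTower k (RatFunc k) L] [Algebra.IsSeparable (RatFunc k) L]
  [CharP k p] hp in
theorem eq_of_smul_eq_smul {a b : L} {w : Ω[L⁄k]} (hw : w ≠ 0) (h : a • w = b • w) : a = b := by
  rw [← sub_eq_zero, ← sub_smul] at h
  exact sub_eq_zero.1 ((smul_eq_zero.1 h).resolve_right hw)

/-- The differentials of two local parameters are regular multiples of each other, hence differ by a
unit, so the integer selected by `Classical.epsilon` is the only candidate. -/
theorem ordDiff_eq [PerfectRing k p] {t g : L} {n : ℤ} (ht : ξ.val t = WithZero.exp (-1 : ℤ))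
    (hg : ξ.val g = WithZero.exp (-n)) : ξ.ordDiff (g • D k L t) = n := by
  have hspec : ∃ t' g' : L, ξ.val t' = WithZero.exp (-1 : ℤ) ∧
      ξ.val g' = WithZero.exp (-ξ.ordDiff (g • D k L t)) ∧ g • D k L t = g' • D k L t' :=
    Classical.epsilon_spec (p := fun n : ℤ => ∃ t' g' : L, ξ.val t' = WithZero.exp (-1 : ℤ) ∧
      ξ.val g' = WithZero.exp (-n) ∧ g • D k L t = g' • D k L t') ⟨n, t, g, ht, hg, rfl⟩
  obtain ⟨t', g', ht', hg', heq⟩ := hspec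
  obtain ⟨a, ha, ha1⟩ := exists_D_eq_smul (k := k) p ht t'
  obtain ⟨b, hb, hb1⟩ := exists_D_eq_smul (k := k) p ht' t
  have hva := ha1 (ht' ▸ exp_neg_one_lt_one.le)
  have hvb := hb1 (ht ▸ exp_neg_one_lt_one.le)
  have hab : b * a = 1 := by
    apply eq_of_smul_eq_smul (D_uniformizer_ne_zero (k := k) p ht)
    rw [mul_smul, ← ha, ← hb, one_smul]
  have hva' : ξ.val a = 1 := by
    have h1 := congrArg ξ.val hab
    rw [map_mul, map_one] at h1
    refine le_antisymm hva ?_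
    rw [← h1]
    exact mul_le_of_le_one_left' hvb
  rw [ha, ← mul_smul] at heq
  have h2 := eq_of_smul_eq_smul (D_uniformizer_ne_zero (k := k) p ht) heq
  rw [h2, map_mul, hva', mul_one, hg', WithZero.exp_inj] at hg
  omega

/-- The order of `F dy` when `y` vanishes to an order `e` that is prime to the characteristic. -/
theorem ordDiff_smul_D [PerfectRing k p] {y F : L} {e : ℕ} (hy0 : y ≠ 0) (hy : ξ.ord y = e)
    (hpe : ¬ p ∣ e) (hF : F ≠ 0) : ξ.ordDiff (F • D k L y) = ξ.ord F + e - 1 := by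
  have hchar : CharP L p := charP_of_injective_algebraMap (algebraMap k L).injective p
  obtain ⟨t, ht⟩ := ξ.exists_uniformizer
  have ht0 := ne_zero_of_val ht
  have he : 0 < e := Nat.pos_of_ne_zero (by rintro rfl; simp at hpe)
  obtain ⟨n, rfl⟩ := Nat.exists_eq_succ_of_ne_zero he.ne'
  set w := y / t ^ (n + 1) with hw
  have hw0 : w ≠ 0 := div_ne_zero hy0 (pow_ne_zero _ ht0)
  have hyw : y = w * t ^ (n + 1) := by rw [hw]; field_simp
  have hvw : ξ.val w = 1 := by
    rw [val_eq_one_iff hw0]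
    have h1 : ξ.ord y = ξ.ord w + (n + 1) := by
      conv_lhs => rw [hyw]
      rw [ord_mul hw0 (pow_ne_zero _ ht0), ord_pow, ord_of_val ht]; push_cast; ring
    rw [hy] at h1
    push_cast at h1
    omega
  obtain ⟨a, ha, ha1⟩ := exists_D_eq_smul (k := k) p ht w
  have hva := ha1 hvw.le
  -- From y = w t^(n+1) one gets dy = t^n b dt, and b is a unit because n + 1 is prime to p.
  set b : L := w * ((n + 1 : ℕ) : L) + t * a with hb
  have hDy : D k L y = (t ^ n * b) • D k L t := by
    rw [hyw, Derivation.leibniz, Derivation.leibniz_pow, ha, ← Nat.cast_smul_eq_nsmul L,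
      ← mul_smul, ← mul_smul, ← mul_smul, ← add_smul, hb]
    congr 1
    simp only [Nat.add_sub_cancel]
    ring
  have hn1 : ξ.val ((n + 1 : ℕ) : L) = 1 := by
    rw [← map_natCast (algebraMap k L)]
    exact ξ.trivial_on _ fun h => hpe ((CharP.cast_eq_zero_iff k p _).1 h)
  have hvb : ξ.val b = 1 := by
    have h1 : ξ.val (w * ((n + 1 : ℕ) : L)) = 1 := by rw [map_mul, hvw, hn1, one_mul]
    rw [hb, Valuation.map_add_eq_of_lt_left, h1]
    rw [h1, map_mul]
    exact mul_lt_one_of_nonneg_of_lt_one_left zero_le (ht ▸ exp_neg_one_lt_one) hva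
  have hb0 : b ≠ 0 := by rintro h; rw [h, map_zero] at hvb; exact zero_ne_one hvb
  have htb : t ^ n * b ≠ 0 := mul_ne_zero (pow_ne_zero _ ht0) hb0
  rw [hDy, ← mul_smul]
  refine (ordDiff_eq (k := k) p ht (n := ξ.ord (F * (t ^ n * b))) (val_eq (mul_ne_zero hF htb))).trans ?_
  rw [ord_mul hF htb, ord_mul (pow_ne_zero _ ht0) hb0, ord_pow, ord_of_val ht,
    (val_eq_one_iff hb0).1 hvb]
  push_cast
  ring

end Uniformizer

end Point


/-! ### Weak approximation for points. -/

namespace Point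

section Approximation

variable {k L : Type*} [Field k] [Field L] [Algebra k L]

/-- Units for η are units for ξ, so the order at ξ is a nonnegative multiple of the order at η;
surjectivity makes the factor 1. -/
theorem val_eq_of_le_one_imp {ξ η : Point k L} (h : ∀ f, η.val f ≤ 1 → ξ.val f ≤ 1) (f : L) :
    ξ.val f = η.val f := by
  have hunit : ∀ u, η.val u = 1 → ξ.val u = 1 := by
    intro u hu
    refine le_antisymm (h u hu.le) ?_
    have h1 := h u⁻¹ (by rw [map_inv₀, hu, inv_one])
    have hu0 : u ≠ 0 := by rintro rfl; rw [map_zero] at hu; exact zero_ne_one hu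
    rw [val_le_one_iff (inv_ne_zero hu0), ord_inv] at h1
    rw [← not_lt, val_lt_one_iff hu0]
    omega
  obtain ⟨t, ht⟩ := η.exists_uniformizer
  have ht0 := ne_zero_of_val ht
  have hmul : ∀ f, f ≠ 0 → ξ.ord f = η.ord f * ξ.ord t := by
    intro f hf
    have hz := zpow_ne_zero (η.ord f) ht0
    have hz' := inv_ne_zero hz
    have h1 : ξ.val (f * (t ^ η.ord f)⁻¹) = 1 := by
      apply hunit
      rw [val_eq_one_iff (mul_ne_zero hf hz'), ord_mul hf hz', ord_inv, ord_zpow, ord_of_val ht]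
      ring
    rw [val_eq_one_iff (mul_ne_zero hf hz'), ord_mul hf hz', ord_inv, ord_zpow] at h1
    linarith
  have hc : 0 ≤ ξ.ord t := by
    rw [← val_le_one_iff ht0]
    exact h t (ht ▸ exp_neg_one_lt_one.le)
  obtain ⟨s, hs⟩ := ξ.exists_uniformizer
  have h1 := hmul s (ne_zero_of_val hs)
  rw [ord_of_val hs] at h1
  have hc1 : ξ.ord t = 1 := Int.eq_one_of_dvd_one hc ⟨η.ord s, by linarith⟩
  by_cases hf : f = 0
  · simp [hf]
  rw [val_eq hf, val_eq hf, hmul f hf, hc1, mul_one]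

theorem exists_one_lt_lt_one {ξ η : Point k L} (h : ∃ f, ξ.val f ≠ η.val f) :
    ∃ z, 1 < ξ.val z ∧ η.val z < 1 := by
  obtain ⟨a, ha1, ha2⟩ : ∃ a, ξ.val a ≤ 1 ∧ 1 < η.val a := by
    by_contra! hno
    obtain ⟨f, hf⟩ := h
    exact hf (val_eq_of_le_one_imp hno f).symm
  obtain ⟨b, hb1, hb2⟩ : ∃ b, η.val b ≤ 1 ∧ 1 < ξ.val b := by
    by_contra! hno
    obtain ⟨f, hf⟩ := h
    exact hf (val_eq_of_le_one_imp hno f)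
  have ha0 : a ≠ 0 := by rintro rfl; simp at ha2
  have hb0 : b ≠ 0 := by rintro rfl; simp at hb2
  rw [← not_le, val_le_one_iff ha0] at ha2
  rw [← not_le, val_le_one_iff hb0] at hb2
  rw [val_le_one_iff ha0] at ha1
  rw [val_le_one_iff hb0] at hb1
  have hz : b * a⁻¹ ≠ 0 := mul_ne_zero hb0 (inv_ne_zero ha0)
  refine ⟨b * a⁻¹, ?_, ?_⟩
  · rw [← not_le, val_le_one_iff hz, ord_mul hb0 (inv_ne_zero ha0), ord_inv]; omega
  · rw [val_lt_one_iff hz, ord_mul hb0 (inv_ne_zero ha0), ord_inv]; omega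

theorem val_one_add_of_lt_one {ξ : Point k L} {a : L} (h : ξ.val a < 1) : ξ.val (1 + a) = 1 := by
  rw [Valuation.map_add_eq_of_lt_left, map_one]
  rwa [map_one]

theorem val_one_add_of_one_lt {ξ : Point k L} {a : L} (h : 1 < ξ.val a) :
    ξ.val (1 + a) = ξ.val a := by
  rw [Valuation.map_add_eq_of_lt_right]
  rwa [map_one]

theorem exists_pow_mul_lt_one {ι : Type*} (S : Finset ι) (η : ι → Point k L) (z y : L)
    (hz : ∀ i ∈ S, (η i).val z < 1) :
    ∃ N₀ : ℕ, ∀ N ≥ N₀, ∀ i ∈ S, (η i).val (z ^ N * y) < 1 := by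
  refine ⟨∑ i ∈ S, ((η i).ord y).natAbs + 1, fun N hN i hi => ?_⟩
  by_cases hy0 : y = 0
  · simp [hy0]
  by_cases hz0 : z = 0
  · simp [hz0, show N ≠ 0 by omega]
  have h1 := hz i hi
  rw [val_lt_one_iff hz0] at h1
  have h2 : ((η i).ord y).natAbs ≤ ∑ i ∈ S, ((η i).ord y).natAbs :=
    Finset.single_le_sum (f := fun i => ((η i).ord y).natAbs) (fun _ _ => Nat.zero_le _) hi
  rw [val_lt_one_iff (mul_ne_zero (pow_ne_zero _ hz0) hy0), ord_mul (pow_ne_zero _ hz0) hy0,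
    ord_pow]
  have h3 : (N : ℤ) * 1 ≤ N * (η i).ord z := mul_le_mul_of_nonneg_left (by omega) (by omega)
  omega

/-- Induction on the number of points. If z is regular at the new point, z^N y works. Otherwise y is
multiplied by z^N / (1 + z^N), which is a unit where z has a pole and is small where z vanishes. -/
theorem exists_one_lt_forall_lt_one {ι : Type*} (S : Finset ι) (ξ : Point k L) (η : ι → Point k L)
    (h : ∀ i ∈ S, ∃ f, ξ.val f ≠ (η i).val f) :
    ∃ z, 1 < ξ.val z ∧ ∀ i ∈ S, (η i).val z < 1 := by
  classical
  induction S using Finset.induction_on with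
  | empty =>
    obtain ⟨t, ht⟩ := ξ.surj (WithZero.exp 1)
    exact ⟨t, by rw [ht, ← WithZero.exp_zero, WithZero.exp_lt_exp]; omega, by simp⟩
  | insert i S hi ih =>
    obtain ⟨z, hz1, hz2⟩ := ih fun j hj => h j (Finset.mem_insert_of_mem hj)
    obtain ⟨y, hy1, hy2⟩ := exists_one_lt_lt_one (h i (Finset.mem_insert_self _ _))
    obtain ⟨N₀, hN₀⟩ := exists_pow_mul_lt_one S η z y hz2
    set N := N₀ + 1 with hN
    have hsmall := hN₀ N (by omega)
    by_cases hzi : (η i).val z ≤ 1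
    · refine ⟨z ^ N * y, ?_, ?_⟩
      · rw [map_mul, map_pow]
        exact one_lt_mul_of_le_of_lt (one_le_pow_of_one_le' hz1.le N) hy1
      · intro j hj
        rcases Finset.mem_insert.1 hj with rfl | hj
        · rw [map_mul, map_pow]
          exact (mul_le_of_le_one_left' (pow_le_one' hzi N)).trans_lt hy2
        · exact hsmall j hj
    · have hbig : ∀ ζ : Point k L, 1 < ζ.val z → ζ.val (z ^ N * (1 + z ^ N)⁻¹ * y) = ζ.val y := by
        intro ζ hζ
        have h1 : 1 < ζ.val (z ^ N) := by
          rw [map_pow]; exact one_lt_pow' hζ (by omega)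
        rw [map_mul, map_mul, map_inv₀, val_one_add_of_one_lt h1, mul_inv_cancel₀, one_mul]
        exact (zero_lt_one.trans h1).ne'
      refine ⟨z ^ N * (1 + z ^ N)⁻¹ * y, by rwa [hbig ξ hz1], fun j hj => ?_⟩
      rcases Finset.mem_insert.1 hj with rfl | hj
      · rwa [hbig _ (not_le.1 hzi)]
      · have h1 : (η j).val (z ^ N) < 1 := by
          rw [map_pow]; exact pow_lt_one₀ zero_le (hz2 j hj) (by omega)
        have h2 := hsmall j hj
        rw [mul_right_comm, map_mul, map_inv₀, val_one_add_of_lt_one h1, inv_one, mul_one]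
        exact h2

/-- Weak approximation: a local parameter at one point that is a unit at finitely many others. -/
theorem exists_uniformizer_forall_unit {ι : Type*} (S : Finset ι) (ξ : Point k L)
    (η : ι → Point k L) (h : ∀ i ∈ S, ∃ f, ξ.val f ≠ (η i).val f) :
    ∃ s, ξ.val s = WithZero.exp (-1 : ℤ) ∧ ∀ i ∈ S, (η i).val s = 1 := by
  obtain ⟨z, hz1, hz2⟩ := exists_one_lt_forall_lt_one S ξ η h
  obtain ⟨t, ht⟩ := ξ.exists_uniformizer
  obtain ⟨N₀, hN₀⟩ := exists_pow_mul_lt_one S η z t hz2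
  set N := N₀ + 2 with hN
  have hz0 : z ≠ 0 := by rintro rfl; simp at hz1
  -- u is small at ξ and close to 1 at the η i, so the combination below is close to t at ξ and to 1
  -- at the others. N ≥ 2 makes the order of u at ξ exceed that of t.
  set u := (1 + z ^ N)⁻¹ with hu
  refine ⟨z ^ N * u * t + u, ?_, fun i hi => ?_⟩
  · have h1 : 1 < ξ.val (z ^ N) := by rw [map_pow]; exact one_lt_pow' hz1 (by omega)
    have hvu : ξ.val u = (ξ.val z ^ N)⁻¹ := by
      rw [hu, map_inv₀, val_one_add_of_one_lt h1, map_pow]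
    have hzu : ξ.val (z ^ N * u * t) = WithZero.exp (-1 : ℤ) := by
      rw [map_mul, map_mul, hvu, map_pow, mul_inv_cancel₀ (pow_ne_zero _ (val_ne_zero hz0)),
        one_mul, ht]
    rw [Valuation.map_add_eq_of_lt_left, hzu]
    rw [hzu, hvu, val_eq hz0, ← WithZero.exp_nsmul, ← WithZero.exp_neg, WithZero.exp_lt_exp]
    rw [← not_le, val_le_one_iff hz0] at hz1
    have : (N : ℤ) * ξ.ord z ≤ N * (-1) := mul_le_mul_of_nonneg_left (by omega) (by omega)
    simp only [nsmul_eq_mul]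
    rw [mul_neg, neg_neg]
    omega
  · have h1 : (η i).val (z ^ N) < 1 := by
      rw [map_pow]; exact pow_lt_one₀ zero_le (hz2 i hi) (by omega)
    have hvu : (η i).val u = 1 := by rw [hu, map_inv₀, val_one_add_of_lt_one h1, inv_one]
    rw [Valuation.map_add_eq_of_lt_right, hvu]
    rw [hvu, mul_right_comm, map_mul, hvu, mul_one]
    exact hN₀ N (by omega) i hi

/-- The point `f ↦ ξ (σ f)`. -/
def comap (ξ : Point k L) (σ : L ≃ₐ[k] L) : Point k L where
  val := ξ.val.comap (σ : L →+* L)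
  surj := fun y => by
    obtain ⟨f, hf⟩ := ξ.surj y
    exact ⟨σ.symm f, by simpa using hf⟩
  trivial_on := fun c hc => by simpa using ξ.trivial_on c hc

end Approximation

end Point


/-! ### Tame ramification of a Galois cover. -/

namespace GaloisCover

section Ramification

variable {k : Type u} [Field k] {H : Type v} [Group H] (Z : GaloisCover k H)

theorem pull_one (f : Z.L) : Z.pull 1 f = f := by
  simp [pull]

theorem pull_mul (β γ : H) (f : Z.L) : Z.pull (β * γ) f = Z.pull γ (Z.pull β f) := by
  simp [pull]

theorem pull_inv_pull (β : H) (f : Z.L) : Z.pull β⁻¹ (Z.pull β f) = f := by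
  rw [← pull_mul, mul_inv_cancel, pull_one]

theorem pull_algebraMap (β : H) (g : RatFunc k) :
    Z.pull β (algebraMap (RatFunc k) Z.L g) = algebraMap (RatFunc k) Z.L g :=
  (Z.pull β).commutes g

theorem pull_algebraMap' (β : H) (c : k) :
    Z.pull β (algebraMap k Z.L c) = algebraMap k Z.L c := by
  rw [IsScalarTower.algebraMap_apply k (RatFunc k) Z.L, pull_algebraMap]

theorem eq_one_of_pull_eq {β : H} (h : ∀ f, Z.pull β f = f) : β = 1 := by
  apply Z.pullback.injective
  rw [map_one]
  apply MulOpposite.unop_injective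
  ext f
  exact h f

theorem exists_algebraMap_eq {f : Z.L} (h : ∀ β, Z.pull β f = f) :
    ∃ g : RatFunc k, algebraMap (RatFunc k) Z.L g = f := by
  refine (IsGalois.mem_range_algebraMap_iff_fixed f).2 fun σ => ?_
  have := h (Z.pullback.symm (MulOpposite.op σ))
  simpa [pull] using this

/-- The stabiliser of a point. -/
def IsStab (ξ : Point k Z.L) (β : H) : Prop := ∀ f : Z.L, ξ.val (Z.pull β f) = ξ.val f

variable {Z} {ξ : Point k Z.L}

theorem IsStab.mul {β γ : H} (hβ : Z.IsStab ξ β) (hγ : Z.IsStab ξ γ) : Z.IsStab ξ (β * γ) :=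
  fun f => by rw [pull_mul, hγ, hβ]

theorem IsStab.inv {β : H} (hβ : Z.IsStab ξ β) : Z.IsStab ξ β⁻¹ := fun f => by
  rw [← hβ, ← pull_mul, inv_mul_cancel, pull_one]

section
variable [IsAlgClosed k]

/-- The residue field is k, so the whole stabiliser acts trivially on it. -/
theorem IsStab.val_pull_sub_lt_one {β : H} (hβ : Z.IsStab ξ β) {f : Z.L} (hf : ξ.val f ≤ 1) :
    ξ.val (Z.pull β f - f) < 1 := by
  obtain ⟨c, hc⟩ := Point.exists_residue hf
  have h1 : Z.pull β f - f =
      Z.pull β (f - algebraMap k Z.L c) - (f - algebraMap k Z.L c) := by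
    rw [map_sub, pull_algebraMap']; ring
  rw [h1]
  exact ξ.val.map_sub_lt (by rwa [hβ]) hc

/-- Writing a regular f as c + t g gives β^* f - f = t (β^* g - g), so by induction this difference
vanishes to every order. -/
theorem IsStab.eq_one_of_pull_uniformizer {β : H} (hβ : Z.IsStab ξ β) {t : Z.L}
    (ht : ξ.val t = WithZero.exp (-1 : ℤ)) (h : Z.pull β t = t) : β = 1 := by
  have hN : ∀ (N : ℕ) (f : Z.L), ξ.val f ≤ 1 →
      ξ.val (Z.pull β f - f) ≤ WithZero.exp (-(N : ℤ)) := by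
    intro N
    induction N with
    | zero => intro f hf; simpa using (hβ.val_pull_sub_lt_one hf).le
    | succ N ih =>
      intro f hf
      obtain ⟨c, hc⟩ := Point.exists_residue hf
      have ht0 := Point.ne_zero_of_val ht
      set g := (f - algebraMap k Z.L c) / t with hg
      have hfg : f = algebraMap k Z.L c + t * g := by rw [hg]; field_simp; ring
      have hvg : ξ.val g ≤ 1 := by
        rw [hg, map_div₀, ht]
        exact (div_le_one₀ (by simp)).2 (Point.val_le_exp_of_lt_one hc)
      have h1 : Z.pull β f - f = t * (Z.pull β g - g) := by
        conv_lhs => rw [hfg]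
        rw [map_add, map_mul, pull_algebraMap', h]; ring
      rw [h1, map_mul, ht]
      calc WithZero.exp (-1 : ℤ) * ξ.val (Z.pull β g - g)
          ≤ WithZero.exp (-1 : ℤ) * WithZero.exp (-(N : ℤ)) := by gcongr; exact ih g hvg
        _ = _ := by rw [← WithZero.exp_add]; congr 1; push_cast; ring
  have hint : ∀ f : Z.L, ξ.val f ≤ 1 → Z.pull β f = f := by
    intro f hf
    by_contra hne
    have hne' := sub_ne_zero.2 hne
    have h1 := hN ((ξ.ord (Z.pull β f - f)).toNat + 1) f hf
    rw [Point.val_eq hne', WithZero.exp_le_exp] at h1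
    push_cast at h1
    omega
  refine Z.eq_one_of_pull_eq fun f => ?_
  rcases le_total (ξ.val f) 1 with hf | hf
  · exact hint f hf
  · by_cases hf0 : f = 0
    · simp [hf0]
    have h2 := hint f⁻¹ (by rw [map_inv₀]; exact inv_le_one_of_one_le₀ hf)
    rw [map_inv₀] at h2
    exact inv_injective h2

/-- Tameness: a stabilising element that fixes a local parameter to first order is trivial. -/
theorem IsStab.eq_one_of_val_lt [Finite H] {p : ℕ} [hp : Fact p.Prime] [CharP k p]
    (hcop : (Nat.card H).Coprime p) {β : H} (hβ : Z.IsStab ξ β) {t : Z.L}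
    (ht : ξ.val t = WithZero.exp (-1 : ℤ)) (h : ξ.val (Z.pull β t - t) < ξ.val t) : β = 1 := by
  have hpow : ∀ i : ℕ, ξ.val (Z.pull (β ^ i) t - t) < ξ.val t := by
    intro i
    induction i with
    | zero => rw [pow_zero, pull_one, sub_self, map_zero, ht]; simp
    | succ i ih =>
      have h1 : Z.pull (β ^ (i + 1)) t - t =
          Z.pull β (Z.pull (β ^ i) t - t) + (Z.pull β t - t) := by
        rw [pow_succ, pull_mul, map_sub]; ring
      rw [h1]
      exact ξ.val.map_add_lt (by rwa [hβ]) h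
  set n := orderOf β with hn
  -- The trace of t over the powers of β is fixed by β and agrees with n t to first order. It is
  -- again a local parameter, since n is prime to p.
  set s := ∑ i ∈ Finset.range n, Z.pull (β ^ i) t with hs
  have hnk : ((n : ℕ) : k) ≠ 0 := by
    rw [Ne, CharP.cast_eq_zero_iff k p]
    intro hdvd
    have h1 := hcop.symm.eq_one_of_dvd (hdvd.trans (orderOf_dvd_natCard β))
    exact hp.out.one_lt.ne' h1
  have hns : ξ.val (algebraMap k Z.L n * t) = ξ.val t := by
    rw [map_mul, ξ.trivial_on _ hnk, one_mul]
  have hvs : ξ.val s = WithZero.exp (-1 : ℤ) := by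
    have h1 : ξ.val (s - algebraMap k Z.L n * t) < ξ.val (algebraMap k Z.L n * t) := by
      rw [hns]
      have h2 : s - algebraMap k Z.L n * t = ∑ i ∈ Finset.range n, (Z.pull (β ^ i) t - t) := by
        rw [Finset.sum_sub_distrib, hs]; simp
      rw [h2]
      exact ξ.val.map_sum_lt (by rw [ht]; simp) fun i _ => hpow i
    rw [Valuation.map_eq_of_sub_lt _ h1, hns, ht]
  refine hβ.eq_one_of_pull_uniformizer hvs ?_
  have h3 : ∑ i ∈ Finset.range (n + 1), Z.pull (β ^ i) t = s + t := by
    rw [Finset.sum_range_succ, hn, pow_orderOf_eq_one, pull_one]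
  have h4 := h3
  rw [Finset.sum_range_succ', pow_zero, pull_one] at h4
  conv_rhs => rw [← add_right_cancel h4]
  rw [hs, map_sum]
  exact Finset.sum_congr rfl fun i _ => by rw [pow_succ, pull_mul]

/-- The residue of β^* t / t embeds the stabiliser into the e-th roots of unity: π = w t^e is fixed,
so the e-th power of this quotient is w / β^* w, of residue 1. Injectivity is tameness. -/
theorem m_le_of_ord_eq [Finite H] {p : ℕ} [Fact p.Prime] [CharP k p]
    (hcop : (Nat.card H).Coprime p) {π : RatFunc k} (hπ : π ≠ 0) {e : ℕ} (he : 0 < e)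
    (hord : ξ.ord (algebraMap (RatFunc k) Z.L π) = e) : Z.m ξ ≤ e := by
  obtain ⟨t, ht⟩ := ξ.exists_uniformizer
  have ht0 := Point.ne_zero_of_val ht
  set y := algebraMap (RatFunc k) Z.L π with hy
  have hy0 : y ≠ 0 := by simpa [hy] using hπ
  have hvt : 0 < ξ.val t := by rw [ht]; simp
  have hres : ∀ β : {β : H // Z.IsStab ξ β}, ∃ c : k,
      ξ.val (Z.pull β t / t - algebraMap k Z.L c) < 1 := fun β =>
    Point.exists_residue (by rw [map_div₀, β.2, div_self hvt.ne'])
  choose c hc using hres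
  have hmem : ∀ β, c β ∈ Polynomial.nthRootsFinset e (1 : k) := by
    intro β
    rw [Polynomial.mem_nthRootsFinset he]
    set w := y / t ^ e with hw
    have hw0 : w ≠ 0 := div_ne_zero hy0 (pow_ne_zero _ ht0)
    have hvw : ξ.val w = 1 := by
      rw [hw, map_div₀, map_pow, ht, Point.val_eq hy0, hord, ← WithZero.exp_nsmul]
      simp
    have hβw0 : Z.pull β w ≠ 0 := by simpa using hw0
    have h1 : (Z.pull β t / t) ^ e = w / Z.pull β w := by
      have h2 : Z.pull β y = y := Z.pull_algebraMap _ _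
      have hβt : Z.pull β t ≠ 0 := by simpa using ht0
      rw [hw, map_div₀, map_pow, h2, div_pow]
      field_simp
    have h2 : ξ.val ((Z.pull β t / t) ^ e - 1) < 1 := by
      have h3 : w / Z.pull β w - 1 = -((Z.pull β w - w) / Z.pull β w) := by field_simp; ring
      rw [h1, h3, Valuation.map_neg, map_div₀, β.2, hvw, div_one]
      exact β.2.val_pull_sub_lt_one hvw.le
    have h3 : ξ.val ((Z.pull β t / t) ^ e - algebraMap k Z.L (c β) ^ e) < 1 := by
      have h5 := (Commute.all (Z.pull β t / t) (algebraMap k Z.L (c β))).mul_geom_sum₂ e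
      rw [← h5, map_mul]
      refine mul_lt_one_of_nonneg_of_lt_one_left zero_le (hc β) ?_
      refine ξ.val.map_sum_le fun i _ => ?_
      rw [map_mul, map_pow, map_pow, map_div₀, β.2, div_self hvt.ne', one_pow, one_mul]
      exact pow_le_one' (Point.val_algebraMap_le_one _) _
    by_contra hne
    have h4 := ξ.trivial_on _ (sub_ne_zero.2 hne)
    have h5 : algebraMap k Z.L (c β ^ e - 1) = ((Z.pull β t / t) ^ e - 1) -
        ((Z.pull β t / t) ^ e - algebraMap k Z.L (c β) ^ e) := by
      rw [map_sub, map_pow, map_one]; ring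
    rw [h5] at h4
    exact (ξ.val.map_sub_lt h2 h3).ne h4
  have hinj : Function.Injective fun β => (⟨c β, hmem β⟩ : Polynomial.nthRootsFinset e (1 : k)) := by
    intro β γ hβγ
    have hcc : c β = c γ := congrArg Subtype.val hβγ
    have h1 : ξ.val (Z.pull β t - Z.pull γ t) < ξ.val t := by
      have h2 : Z.pull β t - Z.pull γ t = ((Z.pull β t / t - algebraMap k Z.L (c β)) -
          (Z.pull γ t / t - algebraMap k Z.L (c γ))) * t := by
        rw [hcc]; field_simp; ring
      rw [h2, map_mul]
      have h3 := ξ.val.map_sub_lt (hc β) (hc γ)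
      exact mul_lt_of_lt_one_left hvt h3
    have h2 : ξ.val (Z.pull ((β : H) * (γ : H)⁻¹) t - t) < ξ.val t := by
      have h3 : Z.pull ((β : H) * (γ : H)⁻¹) t - t = Z.pull (γ : H)⁻¹ (Z.pull β t - Z.pull γ t) := by
        rw [pull_mul, map_sub, pull_inv_pull]
      rw [h3, γ.2.inv]
      exact h1
    exact Subtype.ext (mul_inv_eq_one.1 ((β.2.mul γ.2.inv).eq_one_of_val_lt hcop ht h2))
  have := Nat.card_le_card_of_injective _ hinj
  refine this.trans ?_
  classical
  rw [Nat.card_eq_fintype_card, Fintype.card_coe]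
  exact (Multiset.toFinset_card_le _).trans (Polynomial.card_nthRoots e 1)

end

/-- Take the norm of a local parameter at ξ that is a unit at the other conjugates of ξ: each
stabilising element contributes 1 to the order, the others 0. -/
theorem exists_ord_eq_m [Finite H] (ξ : Point k Z.L) :
    ∃ g : RatFunc k, g ≠ 0 ∧ ξ.ord (algebraMap (RatFunc k) Z.L g) = Z.m ξ := by
  classical
  have := Fintype.ofFinite H
  obtain ⟨s, hs, hs'⟩ := Point.exists_uniformizer_forall_unit
    (Finset.univ.filter fun β => ¬ Z.IsStab ξ β) ξ
    (fun β => ξ.comap ((Z.pull β).restrictScalars k)) (by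
      intro β hβ
      have h1 := (Finset.mem_filter.1 hβ).2
      rw [IsStab] at h1
      push Not at h1
      obtain ⟨f, hf⟩ := h1
      exact ⟨f, hf.symm⟩)
  have hs0 := Point.ne_zero_of_val hs
  have hfix : ∀ γ, Z.pull γ (∏ β, Z.pull β s) = ∏ β, Z.pull β s := by
    intro γ
    rw [map_prod]
    refine Fintype.prod_equiv (Equiv.mulRight γ) _ _ fun β => ?_
    rw [Equiv.coe_mulRight, pull_mul]
  obtain ⟨g, hg⟩ := Z.exists_algebraMap_eq hfix
  have hval : ξ.val (∏ β, Z.pull β s) = WithZero.exp (-(Z.m ξ : ℤ)) := by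
    have h1 : ∀ β, ξ.val (Z.pull β s) = if Z.IsStab ξ β then WithZero.exp (-1 : ℤ) else 1 := by
      intro β
      split_ifs with h
      · rw [h, hs]
      · exact hs' β (by simpa using h)
    rw [map_prod, Finset.prod_congr rfl fun β _ => h1 β, Finset.prod_ite, Finset.prod_const_one,
      mul_one, Finset.prod_const, ← WithZero.exp_nsmul]
    congr 1
    have h2 : Z.m ξ = (Finset.univ.filter fun β => Z.IsStab ξ β).card := by
      rw [← Fintype.card_subtype, ← Nat.card_eq_fintype_card]
      rfl
    rw [h2]; simp
  rw [← hg] at hval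
  refine ⟨g, ?_, Point.ord_of_val hval⟩
  rintro rfl
  rw [map_zero, map_zero] at hval
  exact WithZero.exp_ne_zero hval.symm

/-- The tame character gives m ≤ e and the norm gives e ∣ m; as m divides the order of H, it is
prime to p. -/
theorem m_eq_of_ord_eq [IsAlgClosed k] [Finite H] {p : ℕ} [hp : Fact p.Prime] [CharP k p]
    (hcop : (Nat.card H).Coprime p) {π : RatFunc k} (hπ : π ≠ 0) {e : ℕ} (he : 0 < e)
    (hord : ξ.ord (algebraMap (RatFunc k) Z.L π) = e)
    (hdvd : ∀ g : RatFunc k, g ≠ 0 → (e : ℤ) ∣ ξ.ord (algebraMap (RatFunc k) Z.L g)) :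
    Z.m ξ = e ∧ ¬ p ∣ e := by
  have hle := m_le_of_ord_eq hcop hπ he hord
  obtain ⟨g, hg, hgm⟩ := exists_ord_eq_m ξ
  have h1 := hdvd g hg
  rw [hgm, Int.natCast_dvd_natCast] at h1
  have hm : 0 < Z.m ξ := by
    have : Nonempty {β : H // ∀ f : Z.L, ξ.val (Z.pull β f) = ξ.val f} :=
      ⟨1, fun f => by rw [pull_one]⟩
    exact Nat.card_pos
  have heq := le_antisymm hle (Nat.le_of_dvd hm h1)
  refine ⟨heq, fun hpe => ?_⟩
  let S : Subgroup H :=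
    { carrier := {β | Z.IsStab ξ β}
      mul_mem' := fun ha hb => ha.mul hb
      one_mem' := fun f => by rw [pull_one]
      inv_mem' := fun ha => ha.inv }
  have h2 : Z.m ξ ∣ Nat.card H := S.card_subgroup_dvd_card
  rw [heq] at h2
  have h3 := hcop.symm.eq_one_of_dvd (hpe.trans h2)
  exact hp.out.one_lt.ne' h3

end Ramification

end GaloisCover


/-! ### Orders on the projective line, and σ in terms of G. -/

section OrdAt

variable {k : Type u} [Field k]

/-- A local parameter at a point of the projective line. -/
noncomputable def localParam : OnePoint k → RatFunc k
  | none => RatFunc.X⁻¹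
  | some c => RatFunc.X - RatFunc.C c

/-- The order of a rational function at a point of the projective line. -/
noncomputable def ordAt : OnePoint k → RatFunc k → ℤ
  | none, g => -g.intDegree
  | some c, g => g.num.rootMultiplicity c - g.denom.rootMultiplicity c

theorem localParam_ne_zero (τ : OnePoint k) : localParam τ ≠ 0 := by
  cases τ with
  | infty => exact inv_ne_zero RatFunc.X_ne_zero
  | coe c =>
    change RatFunc.X - RatFunc.C c ≠ 0
    rw [← RatFunc.algebraMap_X, ← RatFunc.algebraMap_C, ← map_sub]
    exact RatFunc.algebraMap_ne_zero (Polynomial.X_sub_C_ne_zero c)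

end OrdAt

namespace GaloisCover

section Orders

variable {k : Type u} [Field k] {H : Type v} [Group H] {Z : GaloisCover k H} {ξ : Point k Z.L}

theorem algebraMap_localParam_some (c : k) :
    algebraMap (RatFunc k) Z.L (localParam (c : OnePoint k)) = Z.x - algebraMap k Z.L c := by
  change algebraMap (RatFunc k) Z.L (RatFunc.X - RatFunc.C c) = _
  rw [map_sub, ← RatFunc.algebraMap_eq_C, ← IsScalarTower.algebraMap_apply]; rfl

theorem liesOver_iff (τ : OnePoint k) :
    Z.LiesOver ξ τ ↔ 0 < ξ.ord (algebraMap (RatFunc k) Z.L (localParam τ)) := by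
  have h0 : algebraMap (RatFunc k) Z.L (localParam τ) ≠ 0 := by simp [localParam_ne_zero]
  rw [← Point.val_lt_one_iff h0]
  cases τ with
  | infty =>
    change 1 < ξ.val Z.x ↔ ξ.val (algebraMap (RatFunc k) Z.L RatFunc.X⁻¹) < 1
    have hx : Z.x ≠ 0 := by simp [x, RatFunc.X_ne_zero]
    have hv : 0 < ξ.val (algebraMap (RatFunc k) Z.L RatFunc.X) :=
      zero_lt_iff.2 (Point.val_ne_zero hx)
    rw [map_inv₀, map_inv₀, inv_lt_one₀ hv]
    rfl
  | coe c =>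
    rw [algebraMap_localParam_some]
    rfl

theorem aeval_x (q : Polynomial k) : Polynomial.aeval Z.x q =
    algebraMap (RatFunc k) Z.L (algebraMap (Polynomial k) (RatFunc k) q) := by
  rw [x, Polynomial.aeval_algebraMap_apply, RatFunc.aeval_X_left_eq_algebraMap]

theorem ord_aeval_some {c : k} (hξ : Z.LiesOver ξ (c : OnePoint k)) {q : Polynomial k}
    (hq : q ≠ 0) : ξ.ord (Polynomial.aeval Z.x q) =
      ξ.ord (algebraMap (RatFunc k) Z.L (localParam (c : OnePoint k))) * q.rootMultiplicity c := by
  obtain ⟨r, hr, hr0⟩ := Polynomial.exists_eq_pow_rootMultiplicity_mul_and_not_dvd q hq c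
  have hloc : algebraMap (RatFunc k) Z.L (localParam (c : OnePoint k)) =
      Polynomial.aeval Z.x (Polynomial.X - Polynomial.C c) := by
    rw [aeval_x, map_sub, RatFunc.algebraMap_X, RatFunc.algebraMap_C]; rfl
  have hpos : ξ.val (Polynomial.aeval Z.x (Polynomial.X - Polynomial.C c)) < 1 := by
    have h1 : ξ.val (Z.x - algebraMap k Z.L c) < 1 := hξ
    simpa using h1
  have hvr : ξ.val (Polynomial.aeval Z.x r) = 1 := by
    have hdiv := Polynomial.modByMonic_add_div r (Polynomial.X - Polynomial.C c)
    rw [Polynomial.modByMonic_X_sub_C_eq_C_eval] at hdiv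
    have hrc : r.eval c ≠ 0 := by
      rwa [Polynomial.dvd_iff_isRoot] at hr0
    have hx1 : ξ.val Z.x ≤ 1 := by
      have h1 : Z.x = (Z.x - algebraMap k Z.L c) + algebraMap k Z.L c := by ring
      rw [h1]
      exact ξ.val.map_add_le hξ.le (Point.val_algebraMap_le_one c)
    have h1 := ξ.trivial_on _ hrc
    rw [← hdiv, map_add, map_mul, Polynomial.aeval_C, Valuation.map_add_eq_of_lt_left, h1]
    rw [h1, map_mul]
    exact mul_lt_one_of_nonneg_of_lt_one_left zero_le hpos (Point.val_aeval_le_one hx1 _)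
  have hr0' : Polynomial.aeval Z.x r ≠ 0 := by
    intro h; rw [h, map_zero] at hvr; exact zero_ne_one hvr
  have hX0 : Polynomial.aeval Z.x (Polynomial.X - Polynomial.C c) ≠ 0 := by
    rw [← hloc]; simp [localParam_ne_zero]
  rw [hloc]
  conv_lhs => rw [hr]
  rw [map_mul, map_pow, Point.ord_mul (pow_ne_zero _ hX0) hr0', Point.ord_pow,
    (Point.val_eq_one_iff hr0').1 hvr]
  ring

theorem ord_aeval_infty (hξ : Z.LiesOver ξ OnePoint.infty) {q : Polynomial k} (hq : q ≠ 0) :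
    ξ.ord (Polynomial.aeval Z.x q) = ξ.ord Z.x * q.natDegree := by
  have hx : 1 < ξ.val Z.x := hξ
  have hx0 : Z.x ≠ 0 := by rintro h; rw [h, map_zero] at hx; exact absurd hx (by simp)
  have hlc : ξ.val (algebraMap k Z.L (q.coeff q.natDegree) * Z.x ^ q.natDegree) =
      ξ.val Z.x ^ q.natDegree := by
    have h1 : q.coeff q.natDegree ≠ 0 := Polynomial.leadingCoeff_ne_zero.2 hq
    rw [map_mul, map_pow, ξ.trivial_on _ h1, one_mul]
  have hval : ξ.val (Polynomial.aeval Z.x q) = ξ.val (Z.x ^ q.natDegree) := by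
    rw [map_pow, Polynomial.aeval_eq_sum_range, Finset.sum_range_succ, Algebra.smul_def,
      Valuation.map_add_eq_of_lt_right, hlc]
    rw [hlc]
    refine ξ.val.map_sum_lt (pow_ne_zero _ (Point.val_ne_zero hx0)) fun i hi => ?_
    rw [Algebra.smul_def, map_mul, map_pow]
    exact (mul_le_of_le_one_left' (Point.val_algebraMap_le_one _)).trans_lt
      (pow_lt_pow_right₀ hx (Finset.mem_range.1 hi))
  rw [Point.ord, hval, ← Point.ord, Point.ord_pow, mul_comm]

theorem ord_algebraMap {τ : OnePoint k} (hξ : Z.LiesOver ξ τ) {g : RatFunc k} (hg : g ≠ 0) :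
    ξ.ord (algebraMap (RatFunc k) Z.L g) =
      ξ.ord (algebraMap (RatFunc k) Z.L (localParam τ)) * ordAt τ g := by
  have hn := RatFunc.num_ne_zero hg
  have hd := RatFunc.denom_ne_zero g
  have hdiv : algebraMap (RatFunc k) Z.L g =
      Polynomial.aeval Z.x g.num * (Polynomial.aeval Z.x g.denom)⁻¹ := by
    rw [aeval_x, aeval_x, ← div_eq_mul_inv, ← map_div₀, RatFunc.num_div_denom]
  have hne : ∀ q : Polynomial k, q ≠ 0 → Polynomial.aeval Z.x q ≠ 0 := by
    intro q hq; rw [aeval_x]; simpa using hq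
  rw [hdiv, Point.ord_mul (hne _ hn) (inv_ne_zero (hne _ hd)), Point.ord_inv]
  cases τ with
  | infty =>
    rw [ord_aeval_infty hξ hn, ord_aeval_infty hξ hd]
    change _ = ξ.ord (algebraMap (RatFunc k) Z.L RatFunc.X⁻¹) * -RatFunc.intDegree g
    rw [map_inv₀, Point.ord_inv, RatFunc.intDegree]
    change _ = - ξ.ord Z.x * _
    ring
  | coe c =>
    rw [ord_aeval_some hξ hn, ord_aeval_some hξ hd]
    change _ = _ * ((g.num.rootMultiplicity c : ℤ) - g.denom.rootMultiplicity c)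
    ring

/-- The stabiliser has the order of the ramification index, which is prime to `p`. -/
theorem m_eq_ord_localParam [IsAlgClosed k] [Finite H] {p : ℕ} [hp : Fact p.Prime] [CharP k p]
    (hcop : (Nat.card H).Coprime p) {τ : OnePoint k} (hξ : Z.LiesOver ξ τ) :
    ξ.ord (algebraMap (RatFunc k) Z.L (localParam τ)) = Z.m ξ ∧ 0 < Z.m ξ ∧ ¬ p ∣ Z.m ξ := by
  have hpos := (liesOver_iff τ).1 hξ
  obtain ⟨e, he⟩ := Int.eq_ofNat_of_zero_le hpos.le
  have he0 : 0 < e := by omega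
  obtain ⟨h1, h2⟩ := m_eq_of_ord_eq hcop (localParam_ne_zero τ) he0 he fun g hg => by
    rw [ord_algebraMap hξ hg, he]; exact dvd_mul_right _ _
  rw [h1]
  exact ⟨he, he0, h2⟩

variable {p : ℕ} [hp : Fact p.Prime] [CharP k p] [IsAlgClosed k] {ω : Ω[Z.L⁄k]}

/-- The value of `(p - 1) σ` at a point, in terms of the rational function `G = F ^ (p - 1)`,
where `ω = F dx`. -/
noncomputable def scaledSigma (p : ℕ) (G : RatFunc k) : OnePoint k → ℤ
  | none => ordAt OnePoint.infty G - (p - 1)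
  | some c => ordAt (c : OnePoint k) G + (p - 1)

/-- A local parameter of the line at τ has order m, prime to p, on Z, so its differential has order
m - 1 and h = ord F + m at a finite point. At infinity dx = -x^2 d(1/x) turns this into ord F - m.
Moreover (p-1) ord F is m times the order of G at τ. -/
theorem h_mul_eq [Finite H] (hcop : (Nat.card H).Coprime p) {F : Z.L} (hω : ω = F • D k Z.L Z.x)
    {G : RatFunc k} (hG0 : G ≠ 0) (hG : algebraMap (RatFunc k) Z.L G = F ^ (p - 1))
    {τ : OnePoint k} (hξ : Z.LiesOver ξ τ) :
    ((p : ℤ) - 1) * Z.h ω ξ = Z.m ξ * scaledSigma p G τ := by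
  obtain ⟨he, he0, hpe⟩ := m_eq_ord_localParam hcop hξ
  have hp1 : p - 1 ≠ 0 := by have := hp.out.two_le; omega
  have hF0 : F ≠ 0 := by
    rintro rfl
    rw [zero_pow hp1, map_eq_zero] at hG
    exact hG0 hG
  have hF : ((p : ℤ) - 1) * ξ.ord F = Z.m ξ * ordAt τ G := by
    have h1 := ord_algebraMap hξ hG0
    rw [hG, Point.ord_pow, he] at h1
    rw [← h1, Nat.cast_sub hp.out.one_le, Nat.cast_one]
  have hx0 : Z.x ≠ 0 := by simp [x, RatFunc.X_ne_zero]
  cases τ with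
  | infty =>
    have hxe : ξ.ord Z.x = -Z.m ξ := by
      rw [← he]
      change _ = - ξ.ord (algebraMap (RatFunc k) Z.L RatFunc.X⁻¹)
      rw [map_inv₀, Point.ord_inv, neg_neg]; rfl
    have hω' : ω = (-(F * Z.x ^ 2)) • D k Z.L Z.x⁻¹ := by
      rw [hω, Derivation.leibniz_inv, ← mul_smul]
      congr 1
      field_simp
    have hne : -(F * Z.x ^ 2) ≠ 0 := neg_ne_zero.2 (mul_ne_zero hF0 (pow_ne_zero _ hx0))
    have hord : ξ.ord (-(F * Z.x ^ 2)) = ξ.ord F - 2 * Z.m ξ := by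
      rw [Point.ord, Valuation.map_neg, ← Point.ord, Point.ord_mul hF0 (pow_ne_zero _ hx0),
        Point.ord_pow, hxe]; push_cast; ring
    have h2 : Z.h ω ξ = ξ.ord F - Z.m ξ := by
      rw [h, hω', Point.ordDiff_smul_D p (inv_ne_zero hx0) (e := Z.m ξ) (by
        rw [Point.ord_inv, hxe, neg_neg]) hpe hne, hord]; ring
    rw [h2]
    change _ = _ * (_ - _)
    change _ = _ * ordAt OnePoint.infty G at hF
    rw [mul_sub, hF]; ring
  | coe c =>
    have hloc := algebraMap_localParam_some (Z := Z) c
    have hω' : ω = F • D k Z.L (Z.x - algebraMap k Z.L c) := by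
      rw [map_sub, Derivation.map_algebraMap, sub_zero, hω]
    have hy0 : Z.x - algebraMap k Z.L c ≠ 0 := by
      rw [← hloc]; simp [localParam_ne_zero]
    have h2 : Z.h ω ξ = ξ.ord F + Z.m ξ := by
      rw [h, hω', Point.ordDiff_smul_D p hy0 (e := Z.m ξ) (by rw [← hloc, he]) hpe hF0]; ring
    rw [h2]
    change _ = _ * (_ + _)
    rw [mul_add, hF]; ring

theorem sigma_eq [Finite H] (hcop : (Nat.card H).Coprime p) {F : Z.L} (hω : ω = F • D k Z.L Z.x)
    {G : RatFunc k} (hG0 : G ≠ 0) (hG : algebraMap (RatFunc k) Z.L G = F ^ (p - 1))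
    {τ : OnePoint k} (hξ : Z.LiesOver ξ τ) :
    ((p : ℚ) - 1) * Z.sigma ω ξ = scaledSigma p G τ := by
  have h1 := h_mul_eq hcop hω hG0 hG hξ
  obtain ⟨-, he0, -⟩ := m_eq_ord_localParam hcop hξ
  have h2 : ((p : ℚ) - 1) * Z.h ω ξ = Z.m ξ * scaledSigma p G τ := by exact_mod_cast h1
  have h3 : (Z.m ξ : ℚ) ≠ 0 := by exact_mod_cast he0.ne'
  rw [sigma, mul_div_assoc', h2]
  field_simp

/-- The stabiliser is trivial where the order of `F` is divisible by the ramification index. -/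
theorem m_eq_one {χ : H →* (ZMod p)ˣ} (hχ : Function.Injective χ) {F : Z.L}
    (hF : ∀ β, Z.pull β F = algebraMap k Z.L (ZMod.castHom (dvd_refl p) k (χ β : ZMod p)) * F)
    {G : RatFunc k} (hG0 : G ≠ 0) (hG : algebraMap (RatFunc k) Z.L G = F ^ (p - 1))
    {τ : OnePoint k} (hξ : Z.LiesOver ξ τ) (hdvd : ((p : ℤ) - 1) ∣ ordAt τ G) : Z.m ξ = 1 := by
  have hp1 : p - 1 ≠ 0 := by have := hp.out.two_le; omega
  have hF0 : F ≠ 0 := by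
    rintro rfl
    rw [zero_pow hp1, map_eq_zero] at hG
    exact hG0 hG
  obtain ⟨n, hn⟩ := hdvd
  set y := algebraMap (RatFunc k) Z.L (localParam τ) with hy
  have hy0 : y ≠ 0 := by simp [hy, localParam_ne_zero]
  have hordF : ξ.ord F = ξ.ord y * n := by
    have h1 := ord_algebraMap hξ hG0
    rw [hG, Point.ord_pow, hn, Nat.cast_sub hp.out.one_le, Nat.cast_one] at h1
    have h2 : ((p : ℤ) - 1) ≠ 0 := by have := hp.out.two_le; omega
    apply mul_left_cancel₀ h2
    rw [h1]; ring
  -- β acts on the unit w by the scalar χ(β), while a stabilising β preserves residues; hence χ(β) =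
  -- 1.
  set w := F * (y ^ n)⁻¹ with hw
  have hyn := inv_ne_zero (zpow_ne_zero n hy0)
  have hw0 : w ≠ 0 := mul_ne_zero hF0 hyn
  have hvw : ξ.val w = 1 := by
    rw [Point.val_eq_one_iff hw0, Point.ord_mul hF0 hyn, Point.ord_inv, Point.ord_zpow, hordF]
    ring
  have hstab : ∀ β, Z.IsStab ξ β → β = 1 := by
    intro β hβ
    have h1 := hβ.val_pull_sub_lt_one hvw.le
    have hpy : Z.pull β y = y := Z.pull_algebraMap _ _
    have h2 : Z.pull β w - w =
        algebraMap k Z.L (ZMod.castHom (dvd_refl p) k (χ β : ZMod p) - 1) * w := by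
      rw [hw, map_mul, map_inv₀, map_zpow₀, hpy, hF, map_sub, map_one]; ring
    rw [h2, map_mul, hvw, mul_one] at h1
    have h3 : ZMod.castHom (dvd_refl p) k (χ β : ZMod p) - 1 = 0 := by
      by_contra hne
      exact h1.ne (ξ.trivial_on _ hne)
    have h4 : (χ β : ZMod p) = 1 := by
      apply (ZMod.castHom (dvd_refl p) k).injective
      rw [map_one]; exact sub_eq_zero.1 h3
    apply hχ
    rw [map_one]
    exact Units.ext h4
  rw [m, Nat.card_eq_one_iff_unique]
  refine ⟨⟨fun a b => Subtype.ext ?_⟩, ⟨1, fun f => by rw [pull_one]⟩⟩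
  rw [hstab a a.2, hstab b b.2]

end Orders

end GaloisCover


/-! ### Existence of points above every point of the line. -/

section ExistsPoint

variable {k L : Type u} [Field k] [Field L] [Algebra k L]

/-- The integral closure of k[x] in L is a Dedekind domain, and a prime of it above x - c supplies
the valuation. -/
theorem exists_point_of_algebra [Algebra (RatFunc k) L] [IsScalarTower k (RatFunc k) L]
    [FiniteDimensional (RatFunc k) L] [Algebra.IsSeparable (RatFunc k) L] (c : k) :
    ∃ ξ : Point k L, ξ.val (algebraMap (RatFunc k) L (RatFunc.X - RatFunc.C c)) < 1 := by
  let _ : Algebra (Polynomial k) L :=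
    ((algebraMap (RatFunc k) L).comp (algebraMap (Polynomial k) (RatFunc k))).toAlgebra
  have : IsScalarTower (Polynomial k) (RatFunc k) L := IsScalarTower.of_algebraMap_eq fun _ => rfl
  have htow : ∀ c : k, algebraMap (Polynomial k) L (Polynomial.C c) = algebraMap k L c := by
    intro c
    rw [IsScalarTower.algebraMap_apply (Polynomial k) (RatFunc k) L, RatFunc.algebraMap_C,
      ← RatFunc.algebraMap_eq_C, ← IsScalarTower.algebraMap_apply]
  let B := integralClosure (Polynomial k) L
  have : IsFractionRing B L := integralClosure.isFractionRing_of_finite_extension (RatFunc k) L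
  have : IsDedekindDomain B := integralClosure.isDedekindDomain (Polynomial k) (RatFunc k) L
  have hinj : Function.Injective (algebraMap (Polynomial k) B) := by
    have h1 : Function.Injective (algebraMap (Polynomial k) L) := by
      rw [IsScalarTower.algebraMap_eq (Polynomial k) (RatFunc k) L]
      exact (algebraMap (RatFunc k) L).injective.comp (RatFunc.algebraMap_injective k)
    rw [IsScalarTower.algebraMap_eq (Polynomial k) B L, RingHom.coe_comp] at h1
    exact Function.Injective.of_comp h1
  let P : Ideal (Polynomial k) := Ideal.span {Polynomial.X - Polynomial.C c}
  have hP : P.IsPrime := (Ideal.span_singleton_prime (Polynomial.X_sub_C_ne_zero c)).2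
    (Polynomial.prime_X_sub_C c)
  obtain ⟨Q, hQ, hQP⟩ := Ideal.exists_ideal_over_prime_of_isIntegral_of_isDomain (S := B) P (by
    rw [(RingHom.injective_iff_ker_eq_bot _).1 hinj]; exact bot_le)
  have hmem : algebraMap (Polynomial k) B (Polynomial.X - Polynomial.C c) ∈ Q := by
    rw [← Ideal.mem_comap, hQP]; exact Ideal.mem_span_singleton_self _
  have hQ0 : Q ≠ ⊥ := by
    rintro rfl
    have h1 := (Ideal.mem_bot).1 hmem
    rw [map_eq_zero_iff _ hinj] at h1
    exact Polynomial.X_sub_C_ne_zero c h1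
  let v : IsDedekindDomain.HeightOneSpectrum B := ⟨Q, hQ, hQ0⟩
  have hconst : ∀ c : k, v.valuation L (algebraMap k L c) ≤ 1 := by
    intro c
    rw [← htow, IsScalarTower.algebraMap_apply (Polynomial k) B L]
    exact v.valuation_le_one _
  refine ⟨⟨v.valuation L, v.valuation_surjective L, fun c hc => ?_⟩, ?_⟩
  · refine le_antisymm (hconst c) ?_
    have h1 := hconst c⁻¹
    rw [map_inv₀, map_inv₀] at h1
    have h2 : 0 < v.valuation L (algebraMap k L c) :=
      zero_lt_iff.2 ((Valuation.ne_zero_iff _).2 (by simpa using hc))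
    exact (inv_le_one₀ h2).1 h1
  · have h1 : algebraMap (RatFunc k) L (RatFunc.X - RatFunc.C c) =
        algebraMap B L (algebraMap (Polynomial k) B (Polynomial.X - Polynomial.C c)) := by
      rw [← IsScalarTower.algebraMap_apply,
        IsScalarTower.algebraMap_apply (Polynomial k) (RatFunc k) L, map_sub (algebraMap _ (RatFunc k)),
        RatFunc.algebraMap_X, RatFunc.algebraMap_C]
    rw [h1]
    exact (v.valuation_lt_one_iff_mem _).2 hmem

theorem exists_invHom : ∃ ι : RatFunc k ≃ₐ[k] RatFunc k, ι RatFunc.X = RatFunc.X⁻¹ := by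
  have htr : Transcendental k (RatFunc.X⁻¹ : RatFunc k) := by
    intro h
    exact RatFunc.transcendental_X (K := k) (IsAlgebraic.inv_iff.1 h)
  have hinj : Function.Injective (Polynomial.aeval (R := k) (RatFunc.X⁻¹ : RatFunc k)) :=
    transcendental_iff_injective.1 htr
  let f : RatFunc k →ₐ[k] RatFunc k := RatFunc.liftAlgHom (Polynomial.aeval (RatFunc.X⁻¹))
    (nonZeroDivisors_le_comap_nonZeroDivisors_of_injective _ hinj)
  have hp : ∀ q : Polynomial k, f (algebraMap _ _ q) = Polynomial.aeval (RatFunc.X⁻¹) q := by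
    intro q
    have := RatFunc.liftAlgHom_apply_div (Polynomial.aeval (R := k) (RatFunc.X⁻¹ : RatFunc k))
      (nonZeroDivisors_le_comap_nonZeroDivisors_of_injective _ hinj) q 1
    simpa using this
  have hX : f RatFunc.X = RatFunc.X⁻¹ := by
    rw [← RatFunc.algebraMap_X, hp, Polynomial.aeval_X]; rfl
  have hff : ∀ g, f (f g) = g := by
    intro g
    have h1 : ∀ q : Polynomial k, f (f (algebraMap _ _ q)) = algebraMap _ _ q := by
      intro q
      rw [hp, ← Polynomial.aeval_algHom_apply, map_inv₀, hX, inv_inv,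
        RatFunc.aeval_X_left_eq_algebraMap]
    rw [← RatFunc.num_div_denom g, map_div₀, map_div₀, h1, h1]
  exact ⟨AlgEquiv.ofAlgHom f f (AlgHom.ext hff) (AlgHom.ext hff), hX⟩

theorem exists_point_of_ringHom (φ : RatFunc k →+* L)
    (hφ : ∀ c, φ (algebraMap k (RatFunc k) c) = algebraMap k L c)
    (hfin : @Module.Finite (RatFunc k) L _ _ φ.toAlgebra.toModule)
    (hsep : @Algebra.IsSeparable (RatFunc k) L _ _ φ.toAlgebra) (c : k) :
    ∃ ξ : Point k L, ξ.val (φ (RatFunc.X - RatFunc.C c)) < 1 := by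
  let _ : Algebra (RatFunc k) L := φ.toAlgebra
  have : IsScalarTower k (RatFunc k) L := IsScalarTower.of_algebraMap_eq fun c => (hφ c).symm
  exact exists_point_of_algebra c

theorem exists_point_infty [Algebra (RatFunc k) L] [IsScalarTower k (RatFunc k) L]
    [FiniteDimensional (RatFunc k) L] [Algebra.IsSeparable (RatFunc k) L] :
    ∃ ξ : Point k L, 1 < ξ.val (algebraMap (RatFunc k) L RatFunc.X) := by
  obtain ⟨ι, hι⟩ := exists_invHom (k := k)
  -- L is regarded as an extension of k(x) through x ↦ 1/x, which moves infinity to 0. The twist is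
  -- by an automorphism of the base, so finiteness and separability persist.
  let φ : RatFunc k →+* L := (algebraMap (RatFunc k) L).comp (ι : RatFunc k →+* RatFunc k)
  have he : RingHom.comp (@algebraMap (RatFunc k) L _ _ φ.toAlgebra)
      (ι.symm.toRingEquiv : RatFunc k →+* RatFunc k) =
      RingHom.comp ((RingEquiv.refl L : L ≃+* L) : L →+* L) (algebraMap (RatFunc k) L) := by
    ext g
    change algebraMap (RatFunc k) L (ι (ι.symm g)) = algebraMap (RatFunc k) L g
    rw [AlgEquiv.apply_symm_apply]
  obtain ⟨ξ, hξ⟩ := exists_point_of_ringHom φ (fun c => by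
      change algebraMap (RatFunc k) L (ι (algebraMap k (RatFunc k) c)) = _
      rw [AlgEquiv.commutes, ← IsScalarTower.algebraMap_apply])
    (@Module.Finite.of_equiv_equiv (RatFunc k) L (RatFunc k) L _ _ _ _ _ φ.toAlgebra
      ι.symm.toRingEquiv (RingEquiv.refl L) he _)
    (@Algebra.IsSeparable.of_equiv_equiv (RatFunc k) L (RatFunc k) L _ _ _ _ _ φ.toAlgebra
      ι.symm.toRingEquiv (RingEquiv.refl L) he _) 0
  refine ⟨ξ, ?_⟩
  have h1 : φ (RatFunc.X - RatFunc.C 0) = (algebraMap (RatFunc k) L RatFunc.X)⁻¹ := by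
    rw [map_zero, sub_zero, ← map_inv₀, ← hι]; rfl
  rw [h1, map_inv₀] at hξ
  have hx : algebraMap (RatFunc k) L RatFunc.X ≠ 0 := by simp [RatFunc.X_ne_zero]
  exact (inv_lt_one₀ (zero_lt_iff.2 (Point.val_ne_zero hx))).1 hξ

theorem GaloisCover.exists_liesOver {H : Type v} [Group H] (Z : GaloisCover k H) (τ : OnePoint k) :
    ∃ ξ : Point k Z.L, Z.LiesOver ξ τ := by
  cases τ with
  | infty => exact exists_point_infty
  | coe c =>
    obtain ⟨ξ, hξ⟩ := exists_point_of_algebra (k := k) (L := Z.L) c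
    refine ⟨ξ, ?_⟩
    change ξ.val (Z.x - algebraMap k Z.L c) < 1
    rw [← GaloisCover.algebraMap_localParam_some]
    exact hξ

end ExistsPoint


/-! ### Polynomial solutions of the hypergeometric equation. -/

section HypergeometricPolynomials

open Polynomial

variable {k : Type*} [Field k]

/-- The differential operator `x (x - 1) D² + [(1 + a₁) (x - 1) + (1 + a₂) x] D`. -/
noncomputable def odeOp (a₁ a₂ : ℕ) (u : k[X]) : k[X] :=
  X * (X - 1) * derivative (derivative u) +
    (C (1 + a₁ : k) * (X - 1) + C (1 + a₂ : k) * X) * derivative u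

theorem coeff_odeOp (a₁ a₂ : ℕ) (u : k[X]) (j : ℕ) : (odeOp a₁ a₂ u).coeff j =
    j * (j + 1 + a₁ + a₂) * u.coeff j - (j + 1) * (j + 1 + a₁) * u.coeff (j + 1) := by
  have h : odeOp a₁ a₂ u = X * (X * derivative (derivative u)) - X * derivative (derivative u) +
      C (2 + a₁ + a₂ : k) * (X * derivative u) - C (1 + a₁ : k) * derivative u := by
    rw [odeOp]
    have : (C (2 + a₁ + a₂ : k) : k[X]) = C (1 + a₁ : k) + C (1 + a₂ : k) := by
      rw [← C_add]; congr 1; ring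
    rw [this]; ring
  rw [h]
  simp only [coeff_add, coeff_sub, coeff_C_mul]
  rcases j with _ | j
  · simp [coeff_derivative]
  · rcases j with _ | j
    · simp [coeff_derivative, coeff_X_mul]; ring
    · simp [coeff_derivative, coeff_X_mul]; ring

variable {p : ℕ} [hp : Fact p.Prime] [CharP k p]

omit hp in
theorem two_ne_zero_of_char (hp2 : 2 < p) : (2 : k) ≠ 0 := by
  have h := CharP.cast_eq_zero_iff k p 2
  intro h2
  have := Nat.le_of_dvd (by omega) (h.1 (by exact_mod_cast h2))
  omega

omit hp in
theorem natCast_ne_zero_of_lt {n : ℕ} (h0 : 0 < n) (hn : n < p) : (n : k) ≠ 0 := by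
  rw [Ne, CharP.cast_eq_zero_iff k p]
  intro h
  have := Nat.le_of_dvd h0 h
  omega

/-- In k one has 2d + a₁ + a₂ + a₃ + 1 = p = 0. That A is -d is what allows a solution of degree d.
-/
theorem hypergeometric_coeff {a₁ a₂ a₃ d : ℕ} (hp2 : 2 < p)
    (hd : 2 * d + (a₁ + a₂ + a₃) = p - 1) :
    ((1 + a₁ + a₂ + a₃) / 2 : k) = -d ∧ ((1 + a₁ + a₂ - a₃) / 2 : k) = -(d + a₃) := by
  have h2 := two_ne_zero_of_char (k := k) hp2
  have h1 : ((2 * d + (a₁ + a₂ + a₃) + 1 : ℕ) : k) = 0 := by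
    rw [hd, Nat.sub_add_cancel hp.out.one_le, CharP.cast_eq_zero]
  push_cast at h1
  constructor
  · field_simp; linear_combination h1
  · field_simp; linear_combination h1

theorem solvesHypergeometric_iff {a₁ a₂ a₃ d : ℕ} (hp2 : 2 < p)
    (hd : 2 * d + (a₁ + a₂ + a₃) = p - 1) (u : k[X]) :
    SolvesHypergeometric ((1 + a₁ + a₂ + a₃) / 2 : k) ((1 + a₁ + a₂ - a₃) / 2 : k)
      (1 + a₁ : k) u ↔ odeOp a₁ a₂ u + C (d * (d + a₃) : k) * u = 0 := by
  obtain ⟨hA, hB⟩ := hypergeometric_coeff (k := k) hp2 hd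
  have h2 := two_ne_zero_of_char (k := k) hp2
  have hAB : ((1 + a₁ + a₂ + a₃) / 2 : k) + ((1 + a₁ + a₂ - a₃) / 2 : k) + 1 =
      (1 + a₁) + (1 + a₂) := by
    field_simp; ring
  rw [SolvesHypergeometric, hAB, hA, hB, odeOp]
  have : (C (-(d : k) * -(d + a₃)) : k[X]) = C (d * (d + a₃) : k) := by congr 1; ring
  rw [this, C_add (a := 1 + (a₁ : k)) (b := 1 + (a₂ : k))]
  have hring : X * (X - 1) * derivative (derivative u) +
      ((C (1 + (a₁ : k)) + C (1 + (a₂ : k))) * X - C (1 + (a₁ : k))) * derivative u +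
        C ((d : k) * (d + a₃)) * u =
      X * (X - 1) * derivative (derivative u) +
      (C (1 + (a₁ : k)) * (X - 1) + C (1 + (a₂ : k)) * X) * derivative u +
        C ((d : k) * (d + a₃)) * u := by ring
  rw [hring]

/-- The equation is a two-term recursion. It can be solved downwards from degree d, where the factor
of the coefficient of degree j vanishes at j = d but not for j < d. -/
theorem coeff_hypergeometric {a₁ a₂ a₃ d : ℕ} (hd : 2 * d + (a₁ + a₂ + a₃) = p - 1)
    (u : k[X]) (j : ℕ) :
    (odeOp a₁ a₂ u + C (d * (d + a₃) : k) * u).coeff j =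
      (j - d) * (j - (d + a₃)) * u.coeff j - (j + 1) * (j + 1 + a₁) * u.coeff (j + 1) := by
  have h1 : ((2 * d + (a₁ + a₂ + a₃) + 1 : ℕ) : k) = 0 := by
    rw [hd, Nat.sub_add_cancel hp.out.one_le, CharP.cast_eq_zero]
  push_cast at h1
  rw [coeff_add, coeff_odeOp, coeff_C_mul]
  linear_combination (j : k) * u.coeff j * h1

omit hp in
theorem sub_mul_sub_ne_zero {a₁ a₂ a₃ d j : ℕ} (h3 : a₃ < p - 1)
    (hd : 2 * d + (a₁ + a₂ + a₃) = p - 1) (hj : j < d) :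
    ((j : k) - d) * (j - (d + a₃)) ≠ 0 := by
  have h1 := natCast_ne_zero_of_lt (k := k) (p := p) (n := d - j) (by omega) (by omega)
  have h2 := natCast_ne_zero_of_lt (k := k) (p := p) (n := d + a₃ - j) (by omega) (by omega)
  rw [Nat.cast_sub (by omega)] at h1 h2
  push_cast at h2
  refine mul_ne_zero ?_ ?_
  · intro h; exact h1 (by linear_combination -h)
  · intro h; exact h2 (by linear_combination -h)

/-- The hypergeometric equation has a monic polynomial solution of the expected degree. -/
theorem exists_hypergeometric_polynomial {a₁ a₂ a₃ d : ℕ} (h3 : a₃ < p - 1)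
    (hd : 2 * d + (a₁ + a₂ + a₃) = p - 1) :
    ∃ u : k[X], u.Monic ∧ u.natDegree = d ∧ odeOp a₁ a₂ u + C (d * (d + a₃) : k) * u = 0 := by
  -- The downward recursion, unrolled from the leading coefficient 1.
  let c : ℕ → k := fun j => ∏ i ∈ Finset.Ico j d,
    ((i + 1) * (i + 1 + a₁) / ((i - d) * (i - (d + a₃))) : k)
  let u : k[X] := ∑ j ∈ Finset.range (d + 1), C (c j) * X ^ j
  have hcoeff : ∀ j, u.coeff j = if j < d + 1 then c j else 0 := by
    intro j
    simp only [u, finsetSum_coeff, coeff_C_mul, coeff_X_pow, mul_ite, mul_one, mul_zero]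
    rw [Finset.sum_ite_eq]
    simp
  have hcd : c d = 1 := by simp [c]
  have hrec : ∀ j < d, (j - d) * (j - (d + a₃)) * c j = (j + 1) * (j + 1 + a₁) * c (j + 1) := by
    intro j hj
    have hne := sub_mul_sub_ne_zero (k := k) h3 hd hj
    have : c j = ((j + 1) * (j + 1 + a₁) / ((j - d) * (j - (d + a₃))) : k) * c (j + 1) :=
      Finset.prod_eq_prod_Ico_succ_bot hj _
    rw [this, ← mul_assoc, mul_comm _ (_ / _), div_mul_cancel₀ _ hne]
  have hlead : u.coeff d = 1 := by rw [hcoeff, if_pos (by omega), hcd]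
  have hdeg : u.natDegree = d := by
    refine natDegree_eq_of_le_of_coeff_ne_zero ?_ (by rw [hlead]; exact one_ne_zero)
    rw [natDegree_le_iff_coeff_eq_zero]
    intro j hj
    rw [hcoeff, if_neg (by omega)]
  refine ⟨u, by rw [Monic, leadingCoeff, hdeg, hlead], hdeg, ?_⟩
  ext j
  rw [coeff_hypergeometric hd, coeff_zero, hcoeff, hcoeff]
  rcases lt_trichotomy j d with hj | rfl | hj
  · rw [if_pos (by omega), if_pos (by omega), hrec j hj, sub_self]
  · simp
  · rw [if_neg (by omega), if_neg (by omega)]; simp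

/-- The monic polynomial solution of the expected degree is unique. -/
theorem hypergeometric_polynomial_unique {a₁ a₂ a₃ d : ℕ} (h3 : a₃ < p - 1)
    (hd : 2 * d + (a₁ + a₂ + a₃) = p - 1) {u v : k[X]} (hu : u.Monic) (hv : v.Monic)
    (hud : u.natDegree = d) (hvd : v.natDegree = d)
    (hu0 : odeOp a₁ a₂ u + C (d * (d + a₃) : k) * u = 0)
    (hv0 : odeOp a₁ a₂ v + C (d * (d + a₃) : k) * v = 0) : u = v := by
  have hcu : ∀ n, d - n ≤ d → u.coeff (d - n) = v.coeff (d - n) := by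
    intro n _
    induction n with
    | zero =>
      have h1 : u.coeff d = 1 := by rw [← hud]; exact hu
      have h2 : v.coeff d = 1 := by rw [← hvd]; exact hv
      rw [Nat.sub_zero, h1, h2]
    | succ n ih =>
      rcases Nat.lt_or_ge n d with hn | hn
      · have h1 := congrArg (fun q : k[X] => q.coeff (d - (n + 1))) hu0
        have h2 := congrArg (fun q : k[X] => q.coeff (d - (n + 1))) hv0
        simp only [coeff_hypergeometric hd, coeff_zero] at h1 h2
        rw [show d - (n + 1) + 1 = d - n by omega] at h1 h2
        rw [ih (by omega)] at h1
        apply mul_left_cancel₀ (sub_mul_sub_ne_zero (k := k) h3 hd (show d - (n + 1) < d by omega))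
        linear_combination h1 - h2
      · rw [show d - (n + 1) = d - n by omega]; exact ih (by omega)
  ext j
  rcases Nat.lt_or_ge d j with hj | hj
  · rw [coeff_eq_zero_of_natDegree_lt (by omega), coeff_eq_zero_of_natDegree_lt (by omega)]
  · have := hcu (d - j) (by omega)
    rwa [Nat.sub_sub_self hj] at this

theorem exists_X_sub_pow_mul {u : k[X]} (hu : u ≠ 0) (τ : k) :
    ∃ w : k[X], u = (X - C τ) ^ u.rootMultiplicity τ * w ∧ w.eval τ ≠ 0 := by
  obtain ⟨w, hw, hw0⟩ := exists_eq_pow_rootMultiplicity_mul_and_not_dvd u hu τ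
  exact ⟨w, hw, by rwa [dvd_iff_isRoot] at hw0⟩

omit [CharP k p] hp in
theorem X_sub_mul_derivative (τ : k) (r : ℕ) (w : k[X]) :
    (X - C τ) * derivative ((X - C τ) ^ r * w) =
      (X - C τ) ^ r * (C (r : k) * w + (X - C τ) * derivative w) := by
  rcases r with _ | r
  · simp
  · simp only [derivative_mul, derivative_X_sub_C_pow, Nat.add_sub_cancel]
    ring

omit [CharP k p] hp in
theorem X_sub_sq_mul_derivative (τ : k) (r : ℕ) (w : k[X]) :
    (X - C τ) ^ 2 * derivative (derivative ((X - C τ) ^ r * w)) =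
      (X - C τ) ^ r * (C ((r : k) * (r - 1)) * w + (X - C τ) *
        (C (2 * r : k) * derivative w + (X - C τ) * derivative (derivative w))) := by
  have h1 := congrArg derivative (X_sub_mul_derivative τ r w)
  rw [derivative_mul, derivative_X_sub_C, one_mul] at h1
  have h2 := congrArg ((X - C τ) * ·) h1
  simp only [mul_add] at h2
  have h3 := X_sub_mul_derivative τ r w
  have h4 := X_sub_mul_derivative τ r (C (r : k) * w + (X - C τ) * derivative w)
  rw [← mul_add (X - C τ), mul_add (X - C τ)] at h2
  have h5 : (X - C τ) * ((X - C τ) * derivative (derivative ((X - C τ) ^ r * w))) =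
      (X - C τ) ^ r * (C (r : k) * (C (r : k) * w + (X - C τ) * derivative w) + (X - C τ) *
        derivative (C (r : k) * w + (X - C τ) * derivative w)) -
      (X - C τ) ^ r * (C (r : k) * w + (X - C τ) * derivative w) := by
    rw [← h3, ← h4, mul_add ((X - C τ) ^ r)]
    linear_combination h2
  have h6 : (X - C τ) ^ 2 * derivative (derivative ((X - C τ) ^ r * w)) =
    (X - C τ) * ((X - C τ) * derivative (derivative ((X - C τ) ^ r * w))) := by ring
  rw [h6, h5]
  simp only [derivative_add, derivative_mul, derivative_C, derivative_X_sub_C, C_mul, C_sub, C_1,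
    map_ofNat]
  ring

omit hp in
/-- The roots of a polynomial solution are simple and different from the singular points. -/
theorem rootMultiplicity_of_hypergeometric {a₁ a₂ a₃ d : ℕ}
    (h1 : a₁ < p - 1) (h2 : a₂ < p - 1)
    (hd : 2 * d + (a₁ + a₂ + a₃) = p - 1) {u : k[X]} (hu : u ≠ 0) (hud : u.natDegree = d)
    (hu0 : odeOp a₁ a₂ u + C (d * (d + a₃) : k) * u = 0) :
    u.eval 0 ≠ 0 ∧ u.eval 1 ≠ 0 ∧ ∀ τ, u.rootMultiplicity τ ≤ 1 := by
  have hle : ∀ τ, u.rootMultiplicity τ ≤ d := fun τ => by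
    classical
    rw [← hud, ← count_roots]; exact (Multiset.count_le_card _ _).trans (card_roots' u)
  -- Substitute u = (X - τ)^r w, multiply by (X - τ)^2 and cancel (X - τ)^r. The lowest-order term
  -- in X - τ is the indicial equation at τ.
  have key : ∀ τ, ∃ w : k[X], w.eval τ ≠ 0 ∧ ∀ r, r = u.rootMultiplicity τ →
      X * (X - 1) * (C ((r : k) * (r - 1)) * w + (X - C τ) *
        (C (2 * r : k) * derivative w + (X - C τ) * derivative (derivative w))) +
      (C (1 + a₁ : k) * (X - 1) + C (1 + a₂ : k) * X) * (X - C τ) *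
        (C (r : k) * w + (X - C τ) * derivative w) +
      C (d * (d + a₃) : k) * (X - C τ) ^ 2 * w = 0 := by
    intro τ
    obtain ⟨w, hw, hw0⟩ := exists_X_sub_pow_mul hu τ
    refine ⟨w, hw0, ?_⟩
    rintro r rfl
    set r := u.rootMultiplicity τ
    have hne : (X - C τ) ^ r ≠ 0 := pow_ne_zero _ (X_sub_C_ne_zero τ)
    apply mul_left_cancel₀ hne
    have e1 := X_sub_mul_derivative τ r w
    have e2 := X_sub_sq_mul_derivative τ r w
    rw [← hw] at e1 e2
    rw [odeOp] at hu0
    have e3 := congrArg ((X - C τ) ^ 2 * ·) hu0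
    simp only [mul_zero] at e3
    rw [mul_zero, ← e3]
    conv_rhs => enter [2, 2, 2]; rw [hw]
    linear_combination (-X * (X - 1)) * e2 -
      (X - C τ) * (C (1 + a₁ : k) * (X - 1) + C (1 + a₂ : k) * X) * e1
  have hzero : u.eval 0 ≠ 0 := by
    intro h0
    obtain ⟨w, hw0, hw⟩ := key 0
    have hr : 0 < u.rootMultiplicity 0 := (rootMultiplicity_pos hu).2 h0
    have e1 := hw _ rfl
    set r := u.rootMultiplicity 0
    have e2 : X * ((X - 1) * (C ((r : k) * (r - 1)) * w + X *
        (C (2 * r : k) * derivative w + X * derivative (derivative w))) +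
      (C (1 + a₁ : k) * (X - 1) + C (1 + a₂ : k) * X) *
        (C (r : k) * w + X * derivative w) +
      C (d * (d + a₃) : k) * X * w) = 0 := by
      rw [← e1]; simp only [C_0, sub_zero]; ring
    have e3 := congrArg (eval 0) ((mul_eq_zero.1 e2).resolve_left X_ne_zero)
    simp at e3
    -- The exponents at 0 are 0 and -a₁, but r and r + a₁ lie strictly between 0 and p.
    have h5 : (r : k) * ((r + a₁ : ℕ) : k) * w.eval 0 = 0 := by
      push_cast; linear_combination -e3
    refine mul_ne_zero (mul_ne_zero ?_ ?_) hw0 h5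
    · exact natCast_ne_zero_of_lt hr (by have := hle 0; omega)
    · exact natCast_ne_zero_of_lt (by omega) (by have := hle 0; omega)
  have hone : u.eval 1 ≠ 0 := by
    intro h0
    obtain ⟨w, hw0, hw⟩ := key 1
    have hr : 0 < u.rootMultiplicity 1 := (rootMultiplicity_pos hu).2 h0
    have e1 := hw _ rfl
    set r := u.rootMultiplicity 1
    have e2 : (X - C 1) * (X * (C ((r : k) * (r - 1)) * w + (X - C 1) *
        (C (2 * r : k) * derivative w + (X - C 1) * derivative (derivative w))) +
      (C (1 + a₁ : k) * (X - 1) + C (1 + a₂ : k) * X) *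
        (C (r : k) * w + (X - C 1) * derivative w) +
      C (d * (d + a₃) : k) * (X - C 1) * w) = 0 := by
      rw [← e1]; simp only [C_1]; ring
    have e3 := congrArg (eval 1) ((mul_eq_zero.1 e2).resolve_left (X_sub_C_ne_zero 1))
    simp at e3
    have h5 : (r : k) * ((r + a₂ : ℕ) : k) * w.eval 1 = 0 := by
      push_cast; linear_combination e3
    refine mul_ne_zero (mul_ne_zero ?_ ?_) hw0 h5
    · exact natCast_ne_zero_of_lt hr (by have := hle 1; omega)
    · exact natCast_ne_zero_of_lt (by omega) (by have := hle 1; omega)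
  refine ⟨hzero, hone, fun τ => ?_⟩
  -- At a point other than 0 and 1 the exponents are 0 and 1, whereas here 2 ≤ r < p.
  · by_contra! hr
    obtain ⟨w, hw0, hw⟩ := key τ
    have e1 := congrArg (eval τ) (hw _ rfl)
    set r := u.rootMultiplicity τ
    have hroot : u.eval τ = 0 := (rootMultiplicity_pos hu).1 (show 0 < r by omega)
    simp at e1
    have hτ0 : τ ≠ 0 := by rintro rfl; exact hzero hroot
    have hτ1 : τ - 1 ≠ 0 := by
      intro h; rw [sub_eq_zero] at h; rw [h] at hroot; exact hone hroot
    have hr0 : (r : k) ≠ 0 := natCast_ne_zero_of_lt (p := p) (by omega) (by have := hle τ; omega)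
    have hr1 : (r : k) - 1 ≠ 0 := by
      have := natCast_ne_zero_of_lt (k := k) (p := p) (n := r - 1) (by omega)
        (by have := hle τ; omega)
      rwa [Nat.cast_sub (by omega), Nat.cast_one] at this
    simp_all

end HypergeometricPolynomials


/-! ### The logarithmic condition as a polynomial identity. -/

section LogarithmicPolynomials

open Polynomial

variable {k : Type*} [Field k]

/-- The Taylor coefficient of index n + 1 of the product at τ is that of index 1 of Q. -/
theorem eval_iterate_derivative_X_sub_C_pow_mul (τ : k) (n : ℕ) (Q : k[X]) :
    (derivative^[n + 1] ((X - C τ) ^ n * Q)).eval τ = ((n + 1).factorial : k) *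
      (derivative Q).eval τ := by
  have h : (taylor τ ((X - C τ) ^ n * Q)).coeff (n + 1) = (derivative Q).eval τ := by
    rw [taylor_mul, taylor_pow]
    have : taylor τ (X - C τ) = X := by simp
    rw [this, add_comm n 1, coeff_X_pow_mul, taylor_coeff_one]
  rw [← factorial_smul_hasseDeriv, ← h, taylor_coeff]
  simp [nsmul_eq_mul]

/-- Differentiation lowers the order of a zero by exactly one when this order is prime to p. -/
theorem X_sub_C_pow_dvd_of_derivative {p : ℕ} [CharP k p] {τ : k} {Q : k[X]} {n : ℕ}
    (hn : n < p) (h0 : Q.eval τ = 0) (h : (X - C τ) ^ n ∣ derivative Q) :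
    (X - C τ) ^ (n + 1) ∣ Q := by
  induction n with
  | zero => simpa [dvd_iff_isRoot] using h0
  | succ n ih =>
    obtain ⟨W, rfl⟩ := ih (by omega) ((pow_dvd_pow _ n.le_succ).trans h)
    have h1 : derivative ((X - C τ) ^ (n + 1) * W) =
        (X - C τ) ^ n * (C ((n + 1 : ℕ) : k) * W + (X - C τ) * derivative W) := by
      rw [derivative_mul, derivative_X_sub_C_pow]
      simp only [Nat.add_sub_cancel]; ring
    rw [h1, pow_succ] at h
    have h2 := (mul_dvd_mul_iff_left (pow_ne_zero n (X_sub_C_ne_zero τ))).1 h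
    have h3 := (dvd_add_left (Dvd.intro _ rfl)).1 h2
    rw [dvd_iff_isRoot, IsRoot, eval_mul, eval_C, mul_eq_zero, ← IsRoot.def,
      ← dvd_iff_isRoot] at h3
    rw [pow_succ _ (n + 1)]
    exact mul_dvd_mul_left _ (h3.resolve_left
      (natCast_ne_zero_of_lt (p := p) (by omega) hn))

/-- The polynomial `x ^ (p - 1 - a₁) (x - 1) ^ (p - 1 - a₂) u ^ (p - 2)`. -/
noncomputable def logPoly (p a₁ a₂ : ℕ) (u : k[X]) : k[X] :=
  X ^ (p - 1 - a₁) * (X - 1) ^ (p - 1 - a₂) * u ^ (p - 2)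

variable {p : ℕ} [hp : Fact p.Prime] [CharP k p]

omit hp in
theorem natCast_sub_one_sub {a : ℕ} (ha : a < p - 1) : ((p - 1 - a : ℕ) : k) = -(1 + a) := by
  have : ((p - 1 - a + (1 + a) : ℕ) : k) = 0 := by
    rw [show p - 1 - a + (1 + a) = p by omega, CharP.cast_eq_zero]
  push_cast at this
  linear_combination this

theorem mul_derivative_pow {n : ℕ} (hn : 0 < n) (w : k[X]) :
    w * derivative (w ^ n) = C (n : k) * w ^ n * derivative w := by
  obtain ⟨m, rfl⟩ := Nat.exists_eq_succ_of_ne_zero hn.ne'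
  rw [derivative_pow_succ, pow_succ]
  push_cast [Nat.succ_eq_add_one]; ring

/-- With u = (X - τ) w the polynomial is (X - τ)^(p-2) P, and the left value is (p-1)! P'(τ). Modulo
p the exponents of X, X - 1 and w in P are -(1 + a₁), -(1 + a₂) and -2, while u'(τ) = w(τ) and
u''(τ) = 2 w'(τ). So both conditions are the same. -/
theorem eval_iterate_derivative_logPoly (hp2 : 2 < p) {a₁ a₂ : ℕ} (h1 : a₁ < p - 1)
    (h2 : a₂ < p - 1) {τ : k} (h0 : τ ≠ 0) (hτ : τ ≠ 1) {w : k[X]} (hw : w.eval τ ≠ 0) :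
    (derivative^[p - 1] (logPoly p a₁ a₂ ((X - C τ) * w))).eval τ = 0 ↔
      (odeOp a₁ a₂ ((X - C τ) * w)).eval τ = 0 := by
  set P := X ^ (p - 1 - a₁) * (X - 1) ^ (p - 1 - a₂) * w ^ (p - 2) with hP
  have e1 : logPoly p a₁ a₂ ((X - C τ) * w) = (X - C τ) ^ (p - 2) * P := by
    rw [logPoly, hP, mul_pow]; ring
  have hP0 : P.eval τ ≠ 0 := by
    simp only [hP, eval_mul, eval_pow, eval_X, eval_sub, eval_one]
    exact mul_ne_zero (mul_ne_zero (pow_ne_zero _ h0) (pow_ne_zero _ (sub_ne_zero.2 hτ)))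
      (pow_ne_zero _ hw)
  have hX := mul_derivative_pow (k := k) (n := p - 1 - a₁) (by omega) X
  have hX1 := mul_derivative_pow (k := k) (n := p - 1 - a₂) (by omega) (X - 1)
  have hW := mul_derivative_pow (k := k) (n := p - 2) (by omega) w
  rw [natCast_sub_one_sub h1] at hX
  rw [natCast_sub_one_sub h2] at hX1
  have hc : ((p - 2 : ℕ) : k) = -2 := by
    rw [Nat.cast_sub hp2.le, CharP.cast_eq_zero]; simp
  rw [hc] at hW
  have key : X * (X - 1) * w * derivative P = P * (C (-(1 + a₁) : k) * (X - 1) * w +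
      C (-(1 + a₂) : k) * X * w + C (-2) * X * (X - 1) * derivative w) := by
    simp only [derivative_X, derivative_sub, derivative_one, sub_zero, mul_one] at hX hX1
    rw [hP]
    simp only [derivative_mul]
    linear_combination ((X - 1) ^ (p - 1 - a₂) * w ^ (p - 2) * (X - 1) * w) * hX +
      (X ^ (p - 1 - a₁) * w ^ (p - 2) * X * w) * hX1 +
      (X ^ (p - 1 - a₁) * (X - 1) ^ (p - 1 - a₂) * X * (X - 1)) * hW
  have key2 := congrArg (eval τ) key
  have e2 : (odeOp a₁ a₂ ((X - C τ) * w)).eval τ = -(C (-(1 + a₁) : k) * (X - 1) * w +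
      C (-(1 + a₂) : k) * X * w + C (-2) * X * (X - 1) * derivative w).eval τ := by
    rw [odeOp]; simp; ring
  rw [eval_mul, eval_mul (p := P)] at key2
  have hfac : (((p - 2 + 1).factorial : ℕ) : k) ≠ 0 := by
    rw [Ne, CharP.cast_eq_zero_iff k p, hp.out.dvd_factorial]; omega
  rw [e1, show p - 1 = p - 2 + 1 by omega, eval_iterate_derivative_X_sub_C_pow_mul, e2,
    neg_eq_zero, mul_eq_zero, or_iff_right hfac]
  constructor
  · intro h; rw [h, mul_zero] at key2
    exact (mul_eq_zero.1 key2.symm).resolve_left hP0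
  · intro h; rw [h, mul_zero] at key2
    refine (mul_eq_zero.1 key2).resolve_left ?_
    simp only [eval_mul, eval_X, eval_sub, eval_one]
    exact mul_ne_zero (mul_ne_zero h0 (sub_ne_zero.2 hτ)) hw

omit hp in
theorem natDegree_odeOp_le (a₁ a₂ : ℕ) (u : k[X]) : (odeOp a₁ a₂ u).natDegree ≤ u.natDegree := by
  rw [natDegree_le_iff_coeff_eq_zero]
  intro j hj
  rw [coeff_odeOp, coeff_eq_zero_of_natDegree_lt hj,
    coeff_eq_zero_of_natDegree_lt (hj.trans j.lt_succ_self)]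
  ring

omit hp [CharP k p] in
theorem prod_X_sub_C_dvd {S : Finset k} {Q : k[X]} (h : ∀ τ ∈ S, Q.eval τ = 0) :
    ∏ τ ∈ S, (X - C τ) ∣ Q :=
  Finset.prod_dvd_of_coprime (fun _ _ _ _ hab => isCoprime_X_sub_C_of_isUnit_sub
    (sub_ne_zero.2 hab).isUnit) fun τ hτ => dvd_iff_isRoot.2 (h τ hτ)

omit hp [CharP k p] in
theorem exists_prod_eq_X_sub_C_mul {S : Finset k} {τ : k} (hτ : τ ∈ S) :
    ∃ w : k[X], w.eval τ ≠ 0 ∧ ∏ τ ∈ S, (X - C τ) = (X - C τ) * w := by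
  classical
  refine ⟨∏ σ ∈ S.erase τ, (X - C σ), ?_, (Finset.mul_prod_erase S _ hτ).symm⟩
  rw [eval_prod, Finset.prod_ne_zero_iff]
  intro σ hσ
  simpa [sub_eq_zero] using (Finset.ne_of_mem_erase hσ).symm

omit hp [CharP k p] in
theorem natDegree_prod_X_sub_C' (S : Finset k) : (∏ τ ∈ S, (X - C τ)).natDegree = S.card := by
  rw [natDegree_prod_of_monic _ _ fun τ _ => monic_X_sub_C τ]; simp

/-- The operator sends u to a polynomial vanishing at all roots of u and of no larger degree, hence
to a constant multiple of u; the leading coefficients give the constant. -/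
theorem hypergeometric_of_logPoly (hp2 : 2 < p) {a₁ a₂ a₃ : ℕ} (h1 : a₁ < p - 1)
    (h2 : a₂ < p - 1) {S : Finset k} (h0S : (0 : k) ∉ S) (h1S : (1 : k) ∉ S)
    (hd : 2 * S.card + (a₁ + a₂ + a₃) = p - 1) {c : k}
    (hlog : derivative^[p - 1] (logPoly p a₁ a₂ (∏ τ ∈ S, (X - C τ))) =
      C c * (∏ τ ∈ S, (X - C τ)) ^ p) :
    odeOp a₁ a₂ (∏ τ ∈ S, (X - C τ)) +
      C (S.card * (S.card + a₃) : k) * ∏ τ ∈ S, (X - C τ) = 0 := by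
  have hdeg := natDegree_prod_X_sub_C' S
  have hmon : (∏ τ ∈ S, (X - C τ)).Monic := monic_prod_of_monic _ _ fun τ _ => monic_X_sub_C τ
  have hroot : ∀ τ ∈ S, (odeOp a₁ a₂ (∏ τ ∈ S, (X - C τ))).eval τ = 0 := by
    intro τ hτ
    obtain ⟨w, hw, e⟩ := exists_prod_eq_X_sub_C_mul hτ
    rw [e] at hlog ⊢
    rw [← eval_iterate_derivative_logPoly hp2 h1 h2 (ne_of_mem_of_not_mem hτ h0S)
      (ne_of_mem_of_not_mem hτ h1S) hw, hlog]
    simp [hp.out.ne_zero]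
  obtain ⟨Q, hQ⟩ := prod_X_sub_C_dvd hroot
  set u := ∏ τ ∈ S, (X - C τ)
  have hQ0 : Q.natDegree = 0 := by
    by_contra hne
    have hQ0 : Q ≠ 0 := by rintro rfl; simp at hne
    have := natDegree_odeOp_le a₁ a₂ u
    rw [hQ, natDegree_mul hmon.ne_zero hQ0] at this
    omega
  rw [eq_C_of_natDegree_eq_zero hQ0] at hQ
  have hc := congrArg (fun q => coeff q S.card) hQ
  simp only [coeff_odeOp, coeff_mul_C] at hc
  have hlead : u.coeff S.card = 1 := by rw [← hdeg]; exact hmon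
  rw [hlead, coeff_eq_zero_of_natDegree_lt (by omega)] at hc
  have hh : ((2 * S.card + (a₁ + a₂ + a₃) + 1 : ℕ) : k) = 0 := by
    rw [hd, Nat.sub_add_cancel hp.out.one_le, CharP.cast_eq_zero]
  push_cast at hh
  have : Q.coeff 0 = -(S.card * (S.card + a₃)) := by
    linear_combination -hc + (S.card : k) * hh
  rw [hQ, this, C_neg]; ring

omit hp in
theorem iterate_derivative_char (hp0 : p ≠ 0) (f : k[X]) : derivative^[p] f = 0 := by
  rw [← factorial_smul_hasseDeriv]
  have : ((p.factorial : ℕ) : k) = 0 := by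
    rw [CharP.cast_eq_zero_iff k p]; exact Nat.dvd_factorial (Nat.pos_of_ne_zero hp0) le_rfl
  ext j
  simp [nsmul_eq_mul, this]

theorem exists_eq_pow_of_derivative_eq_zero [PerfectRing k p] {f : k[X]}
    (h : derivative f = 0) : ∃ R : k[X], f = R ^ p := by
  refine ⟨(contract p f).map (frobeniusEquiv k p).symm.toRingHom, ?_⟩
  rw [← map_frobenius_expand, map_expand, Polynomial.map_map]
  have : (frobenius k p).comp (frobeniusEquiv k p).symm.toRingHom = RingHom.id k := by
    ext x; simp
  rw [this, Polynomial.map_id, expand_contract p h hp.out.ne_zero]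

/-- Only the monomials X^n with p ∣ n + 1 lack a primitive. For these n(n-1)⋯(n-p+2) is prime to p,
so p - 1 derivatives detect their coefficients. -/
theorem exists_antiderivative {P : k[X]} (h : derivative^[p - 1] P = 0) :
    ∃ S : k[X], derivative S = P ∧ S.natDegree ≤ P.natDegree + 1 := by
  have hcoeff : ∀ n : ℕ, ((n + 1 : ℕ) : k) = 0 → P.coeff n = 0 := by
    intro n hn
    have hdvd := (CharP.cast_eq_zero_iff k p _).1 hn
    have hle := Nat.le_of_dvd n.succ_pos hdvd
    have h1 := congrArg (fun q => coeff q (n - (p - 1))) h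
    simp only [coeff_iterate_derivative, coeff_zero] at h1
    rw [show n - (p - 1) + (p - 1) = n by omega, nsmul_eq_mul] at h1
    refine (mul_eq_zero.1 h1).resolve_left ?_
    intro hz
    rw [CharP.cast_eq_zero_iff k p, Nat.descFactorial_eq_prod_range,
      hp.out.prime.dvd_finsetProd_iff] at hz
    obtain ⟨i, hi, hdi⟩ := hz
    rw [Finset.mem_range] at hi
    have h3 := (Nat.dvd_sub hdvd hdi)
    have := Nat.le_of_dvd (by omega) h3
    omega
  refine ⟨∑ n ∈ Finset.range (P.natDegree + 1), monomial (n + 1) (P.coeff n / ((n + 1 : ℕ) : k)),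
    ?_, ?_⟩
  · conv_rhs => rw [P.as_sum_range]
    rw [derivative_sum]
    refine Finset.sum_congr rfl fun n _ => ?_
    rw [derivative_monomial, Nat.add_sub_cancel]
    congr 1
    by_cases hn : ((n + 1 : ℕ) : k) = 0
    · rw [hn, hcoeff n hn]; simp
    · exact div_mul_cancel₀ _ hn
  · refine natDegree_sum_le_of_forall_le _ _ fun n hn => (natDegree_monomial_le _).trans ?_
    rw [Finset.mem_range] at hn; omega

theorem natDegree_logPoly (hp2 : 2 < p) {a₁ a₂ a₃ : ℕ} (h1 : a₁ < p - 1)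
    (h2 : a₂ < p - 1) {u : k[X]} (hu : u ≠ 0)
    (hd : 2 * u.natDegree + (a₁ + a₂ + a₃) = p - 1) :
    (logPoly p a₁ a₂ u).natDegree = p * u.natDegree + a₃ + (p - 1) := by
  have hX : (X - 1 : k[X]) ≠ 0 := by simpa using X_sub_C_ne_zero (1 : k)
  have hX' : (X - 1 : k[X]).natDegree = 1 := by simpa using natDegree_X_sub_C (1 : k)
  rw [logPoly, natDegree_mul (mul_ne_zero (pow_ne_zero _ X_ne_zero) (pow_ne_zero _ hX))
    (pow_ne_zero _ hu), natDegree_mul (pow_ne_zero _ X_ne_zero) (pow_ne_zero _ hX),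
    natDegree_pow, natDegree_pow, natDegree_pow, natDegree_X, hX']
  obtain ⟨q, rfl⟩ := Nat.exists_eq_add_of_lt hp2
  simp only [show 2 + q + 1 - 2 = q + 1 by omega]
  have : (2 + q + 1) * u.natDegree = (q + 1) * u.natDegree + 2 * u.natDegree := by ring
  rw [this]
  omega

/-- `logPoly` of a split polynomial is not exact. -/
theorem iterate_derivative_logPoly_ne_zero [IsAlgClosed k] (hp2 : 2 < p) {a₁ a₂ a₃ : ℕ}
    (h1 : a₁ < p - 1) (h2 : a₂ < p - 1) {S : Finset k} (h0S : (0 : k) ∉ S) (h1S : (1 : k) ∉ S)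
    (hd : 2 * S.card + (a₁ + a₂ + a₃) = p - 1) :
    derivative^[p - 1] (logPoly p a₁ a₂ (∏ τ ∈ S, (X - C τ))) ≠ 0 := by
  classical
  intro h
  have hdeg := natDegree_prod_X_sub_C' S
  have hmon : (∏ τ ∈ S, (X - C τ)).Monic := monic_prod_of_monic _ _ fun τ _ => monic_X_sub_C τ
  have hlogdeg := natDegree_logPoly hp2 h1 h2 hmon.ne_zero (a₃ := a₃) (by omega)
  obtain ⟨A, hA, hAdeg⟩ := exists_antiderivative h
  set u := ∏ τ ∈ S, (X - C τ) with hu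
  let N : Finset k := insert 0 (insert 1 S)
  have hN : N.card = S.card + 2 := by
    rw [Finset.card_insert_of_notMem (by simp [h0S]), Finset.card_insert_of_notMem h1S]
  have hroots : ∀ r : k, ∃ t, t ^ p = A.eval r := fun r =>
    IsAlgClosed.exists_pow_nat_eq _ hp.out.pos
  choose t ht using hroots
  -- An antiderivative may be changed by a p-th power. T interpolates p-th roots of the values of A,
  -- so A - T^p vanishes at 0, 1 and on S.
  let T := Lagrange.interpolate N id t
  have hTdeg : T.natDegree ≤ S.card + 1 := by
    have := Lagrange.degree_interpolate_lt (s := N) (v := id) t (Function.injective_id.injOn)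
    rw [hN] at this
    by_cases hT0 : T = 0
    · simp [hT0]
    · exact Nat.le_of_lt_succ ((natDegree_lt_iff_degree_lt hT0).2 this)
  have hT : ∀ r ∈ N, (A - T ^ p).eval r = 0 := by
    intro r hr
    rw [eval_sub, eval_pow, show T.eval r = t r from
      Lagrange.eval_interpolate_at_node t Function.injective_id.injOn hr, ht, sub_self]
  have hder : derivative (A - T ^ p) = logPoly p a₁ a₂ u := by
    rw [derivative_sub, derivative_pow, hA]; simp
  let e : k → ℕ := fun r => if r = 0 then p - 1 - a₁ else if r = 1 then p - 1 - a₂ else p - 2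
  have hdvd : ∀ r ∈ N, (X - C r) ^ (e r + 1) ∣ A - T ^ p := by
    intro r hr
    refine X_sub_C_pow_dvd_of_derivative (p := p) ?_ (hT r hr) ?_
    · simp only [e]; split_ifs <;> omega
    · rw [hder, logPoly]
      simp only [e]
      split_ifs with c1 c2
      · subst c1; rw [C_0, sub_zero, mul_assoc]; exact Dvd.intro _ rfl
      · subst c2; rw [C_1, mul_right_comm]; exact Dvd.intro_left _ rfl
      · refine Dvd.dvd.mul_left (pow_dvd_pow_of_dvd ?_ _) _
        have : r ∈ S := by simpa [N, c1, c2] using hr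
        exact Finset.dvd_prod_of_mem (fun τ => X - C τ) this
  have hprod : ∏ r ∈ N, (X - C r) ^ (e r + 1) ∣ A - T ^ p :=
    Finset.prod_dvd_of_coprime (fun _ _ _ _ hab => (isCoprime_X_sub_C_of_isUnit_sub
      (sub_ne_zero.2 hab).isUnit).pow) hdvd
  have hprodeg : (∏ r ∈ N, (X - C r) ^ (e r + 1)).natDegree =
      (p - 1 - a₁ + 1) + ((p - 1 - a₂ + 1) + S.card * (p - 1)) := by
    rw [natDegree_prod_of_monic _ _ fun r _ => (monic_X_sub_C r).pow _]
    simp only [natDegree_pow, natDegree_X_sub_C, mul_one]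
    rw [Finset.sum_insert (by simp [h0S]), Finset.sum_insert h1S]
    congr 1
    · simp [e]
    · congr 1
      · simp [e]
      · rw [Finset.sum_const_nat]
        intro r hr
        have c0 : r ≠ 0 := ne_of_mem_of_not_mem hr h0S
        have c1 : r ≠ 1 := ne_of_mem_of_not_mem hr h1S
        simp [e, c0, c1]; omega
  -- With d the number of elements of S, the prescribed zeros have total order p d + p + 1 + d + a₃,
  -- more than the bounds p d + a₃ + p for the degree of A and p (d + 1) for that of T^p.
  have hzero : A - T ^ p = 0 := by
    refine eq_zero_of_dvd_of_natDegree_lt hprod ?_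
    have hTp : (T ^ p).natDegree ≤ p * (S.card + 1) := by
      rw [natDegree_pow]; exact Nat.mul_le_mul_left _ hTdeg
    refine (natDegree_sub_le _ _).trans_lt ?_
    rw [hprodeg]
    rw [hlogdeg, hdeg] at hAdeg
    obtain ⟨q, rfl⟩ := Nat.exists_eq_add_of_lt hp2
    have e1 : S.card * (2 + q + 1 - 1) + S.card = (2 + q + 1) * S.card := by
      rw [show 2 + q + 1 - 1 = 2 + q by omega]; ring
    have e2 : (2 + q + 1) * (S.card + 1) = (2 + q + 1) * S.card + (2 + q + 1) := by ring
    rw [e2] at hTp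
    generalize (2 + q + 1) * S.card = M at *
    generalize S.card * (2 + q + 1 - 1) = M' at *
    omega
  rw [hzero, derivative_zero] at hder
  have hX : (X - 1 : k[X]) ≠ 0 := by simpa using X_sub_C_ne_zero (1 : k)
  exact mul_ne_zero (mul_ne_zero (pow_ne_zero _ X_ne_zero) (pow_ne_zero _ hX))
    (pow_ne_zero _ hmon.ne_zero) hder.symm

/-- The left side is killed by one more derivative, so it is R^p, and u divides R by the equation.
Its degree is at most p deg u + a₃ with a₃ < p, so R is a constant multiple of u. -/
theorem exists_iterate_derivative_logPoly [IsAlgClosed k] (hp2 : 2 < p) {a₁ a₂ a₃ : ℕ}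
    (h1 : a₁ < p - 1) (h2 : a₂ < p - 1) {S : Finset k} (h0S : (0 : k) ∉ S) (h1S : (1 : k) ∉ S)
    (h3 : a₃ < p - 1)
    (hd : 2 * S.card + (a₁ + a₂ + a₃) = p - 1)
    (hode : odeOp a₁ a₂ (∏ τ ∈ S, (X - C τ)) +
      C (S.card * (S.card + a₃) : k) * ∏ τ ∈ S, (X - C τ) = 0) :
    ∃ c : k, c ≠ 0 ∧ derivative^[p - 1] (logPoly p a₁ a₂ (∏ τ ∈ S, (X - C τ))) =
      C c * (∏ τ ∈ S, (X - C τ)) ^ p := by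
  have hne := iterate_derivative_logPoly_ne_zero hp2 h1 h2 h0S h1S hd
  have hdeg := natDegree_prod_X_sub_C' S
  have hmon : (∏ τ ∈ S, (X - C τ)).Monic := monic_prod_of_monic _ _ fun τ _ => monic_X_sub_C τ
  have hlogdeg := natDegree_logPoly hp2 h1 h2 hmon.ne_zero (a₃ := a₃) (by omega)
  have hroot : ∀ τ ∈ S,
      (derivative^[p - 1] (logPoly p a₁ a₂ (∏ τ ∈ S, (X - C τ)))).eval τ = 0 := by
    intro τ hτ
    have := congrArg (eval τ) hode
    obtain ⟨w, hw, e⟩ := exists_prod_eq_X_sub_C_mul hτ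
    rw [e] at this ⊢
    rw [eval_iterate_derivative_logPoly hp2 h1 h2 (ne_of_mem_of_not_mem hτ h0S)
      (ne_of_mem_of_not_mem hτ h1S) hw]
    simpa using this
  set u := ∏ τ ∈ S, (X - C τ)
  obtain ⟨R, hR⟩ := exists_eq_pow_of_derivative_eq_zero (p := p)
    (f := derivative^[p - 1] (logPoly p a₁ a₂ u)) (by
      rw [← Function.iterate_succ_apply' derivative, Nat.succ_eq_add_one,
        Nat.sub_add_cancel hp.out.one_le, iterate_derivative_char hp.out.ne_zero])
  rw [hR] at hroot hne ⊢
  have hR0 : R ≠ 0 := by rintro rfl; simp [hp.out.ne_zero] at hne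
  obtain ⟨Q, hQ⟩ : u ∣ R := prod_X_sub_C_dvd fun τ hτ => by
    have := hroot τ hτ
    rw [eval_pow] at this
    exact pow_eq_zero_iff hp.out.ne_zero |>.1 this
  have hQ0 : Q ≠ 0 := by rintro rfl; simp [hQ] at hR0
  have hQdeg : Q.natDegree = 0 := by
    have hle := natDegree_iterate_derivative (logPoly p a₁ a₂ u) (p - 1)
    rw [hR, hlogdeg, natDegree_pow, hQ, natDegree_mul hmon.ne_zero hQ0, mul_add] at hle
    by_contra hne
    have := Nat.le_mul_of_pos_right p (Nat.pos_of_ne_zero hne)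
    omega
  rw [eq_C_of_natDegree_eq_zero hQdeg] at hQ hQ0
  refine ⟨Q.coeff 0 ^ p, pow_ne_zero _ fun h => hQ0 (by rw [h, C_0]), ?_⟩
  rw [hQ, mul_pow, C_pow, mul_comm]

end LogarithmicPolynomials


/-! ### Rational functions with prescribed divisor. -/

section RationalFunctions

variable {k : Type*} [Field k]

theorem ordAt_div {c : k} {a b : Polynomial k} (ha : a ≠ 0) (hb : b ≠ 0) :
    ordAt (c : OnePoint k) (algebraMap _ (RatFunc k) a / algebraMap _ (RatFunc k) b) =
      a.rootMultiplicity c - b.rootMultiplicity c := by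
  set g := algebraMap _ (RatFunc k) a / algebraMap _ (RatFunc k) b with hg
  have ha' := RatFunc.algebraMap_ne_zero ha
  have hb' := RatFunc.algebraMap_ne_zero hb
  have hg0 : g ≠ 0 := div_ne_zero ha' hb'
  have hn := RatFunc.num_ne_zero hg0
  have hd := RatFunc.denom_ne_zero g
  have h1 : g.num * b = a * g.denom := by
    apply RatFunc.algebraMap_injective k
    have h2 := RatFunc.num_div_denom g
    rw [map_mul, map_mul]
    rw [div_eq_iff (RatFunc.algebraMap_ne_zero hd)] at h2
    rw [h2, hg]
    field_simp
  have h2 := congrArg (Polynomial.rootMultiplicity c) h1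
  rw [Polynomial.rootMultiplicity_mul (mul_ne_zero hn hb),
    Polynomial.rootMultiplicity_mul (mul_ne_zero ha hd)] at h2
  change (g.num.rootMultiplicity c : ℤ) - g.denom.rootMultiplicity c = _
  omega

theorem ordAt_infty_div {a b : Polynomial k} (ha : a ≠ 0) (hb : b ≠ 0) :
    ordAt OnePoint.infty (algebraMap _ (RatFunc k) a / algebraMap _ (RatFunc k) b) =
      b.natDegree - a.natDegree := by
  change -(RatFunc.intDegree _) = _
  rw [div_eq_mul_inv, RatFunc.intDegree_mul (RatFunc.algebraMap_ne_zero ha)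
    (inv_ne_zero (RatFunc.algebraMap_ne_zero hb)), RatFunc.intDegree_inv,
    RatFunc.intDegree_polynomial, RatFunc.intDegree_polynomial]
  ring

theorem exists_eq_C_mul_of_rootMultiplicity_eq [IsAlgClosed k] {a b : Polynomial k} (ha : a ≠ 0)
    (hb : b ≠ 0) (h : ∀ c, a.rootMultiplicity c = b.rootMultiplicity c) :
    ∃ c : k, c ≠ 0 ∧ a = Polynomial.C c * b := by
  classical
  have hr : a.roots = b.roots := by
    ext c; rw [Polynomial.count_roots, Polynomial.count_roots, h]
  have ha1 := (IsAlgClosed.splits a).eq_prod_roots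
  have hb1 := (IsAlgClosed.splits b).eq_prod_roots
  have hb0 := Polynomial.leadingCoeff_ne_zero.2 hb
  refine ⟨a.leadingCoeff / b.leadingCoeff,
    div_ne_zero (Polynomial.leadingCoeff_ne_zero.2 ha) hb0, ?_⟩
  have hc : Polynomial.C (a.leadingCoeff / b.leadingCoeff) * Polynomial.C b.leadingCoeff =
      Polynomial.C a.leadingCoeff := by rw [← Polynomial.C_mul, div_mul_cancel₀ _ hb0]
  generalize Polynomial.C (a.leadingCoeff / b.leadingCoeff) = e at *
  rw [hr, ← hc, mul_assoc, ← hb1] at ha1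
  exact ha1

theorem exists_eq_C_mul_div_of_ordAt_eq [IsAlgClosed k] {g : RatFunc k} (hg : g ≠ 0)
    {a b : Polynomial k} (ha : a ≠ 0) (hb : b ≠ 0) (h : ∀ c : k, ordAt (c : OnePoint k) g =
      a.rootMultiplicity c - b.rootMultiplicity c) :
    ∃ c : k, c ≠ 0 ∧ g = algebraMap _ (RatFunc k) (Polynomial.C c * a) /
      algebraMap _ (RatFunc k) b := by
  have hn := RatFunc.num_ne_zero hg
  have hd := RatFunc.denom_ne_zero g
  obtain ⟨c, hc, e⟩ := exists_eq_C_mul_of_rootMultiplicity_eq (a := g.num * b) (b := a * g.denom)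
    (mul_ne_zero hn hb) (mul_ne_zero ha hd) fun c => by
      rw [Polynomial.rootMultiplicity_mul (mul_ne_zero hn hb),
        Polynomial.rootMultiplicity_mul (mul_ne_zero ha hd)]
      have h1 : (g.num.rootMultiplicity c : ℤ) - g.denom.rootMultiplicity c = _ := h c
      omega
  refine ⟨c, hc, ?_⟩
  rw [← mul_assoc] at e
  have e' := congrArg (algebraMap _ (RatFunc k)) e
  rw [map_mul, map_mul] at e'
  rw [← RatFunc.num_div_denom g, div_eq_div_iff (RatFunc.algebraMap_ne_zero hd)
    (RatFunc.algebraMap_ne_zero hb), e']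

variable {p : ℕ} {a₁ a₂ : ℕ}

theorem X_sub_one_ne_zero : (Polynomial.X - 1 : Polynomial k) ≠ 0 := by
  simpa using Polynomial.X_sub_C_ne_zero (1 : k)

theorem logPoly_ne_zero {u : Polynomial k} (hu : u ≠ 0) : logPoly p a₁ a₂ u ≠ 0 :=
  mul_ne_zero (mul_ne_zero (pow_ne_zero _ Polynomial.X_ne_zero) (pow_ne_zero _ X_sub_one_ne_zero))
    (pow_ne_zero _ hu)

theorem rootMultiplicity_pow' (a : Polynomial k) (c : k) (n : ℕ) :
    (a ^ n).rootMultiplicity c = n * a.rootMultiplicity c := by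
  classical
  rw [← Polynomial.count_roots, Polynomial.roots_pow, Multiset.count_nsmul, Polynomial.count_roots]

theorem rootMultiplicity_logPoly [DecidableEq k] {u : Polynomial k} (hu : u ≠ 0) (c : k) :
    (logPoly p a₁ a₂ u).rootMultiplicity c = (if c = 0 then p - 1 - a₁ else 0) +
      (if c = 1 then p - 1 - a₂ else 0) + (p - 2) * u.rootMultiplicity c := by
  have h1 : (Polynomial.X : Polynomial k).rootMultiplicity c = if c = 0 then 1 else 0 := by
    have := Polynomial.rootMultiplicity_X_sub_C (x := c) (y := (0 : k))
    simpa using this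
  have h2 : (Polynomial.X - 1 : Polynomial k).rootMultiplicity c = if c = 1 then 1 else 0 := by
    have := Polynomial.rootMultiplicity_X_sub_C (x := c) (y := (1 : k))
    simpa using this
  have h3 := logPoly_ne_zero (p := p) (a₁ := a₁) (a₂ := a₂) hu
  rw [logPoly] at h3 ⊢
  rw [Polynomial.rootMultiplicity_mul h3, Polynomial.rootMultiplicity_mul (left_ne_zero_of_mul h3),
    rootMultiplicity_pow', rootMultiplicity_pow',
    rootMultiplicity_pow', h1, h2]
  simp

theorem rootMultiplicity_prod_X_sub_C [DecidableEq k] (S : Finset k) (c : k) :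
    (∏ τ ∈ S, (Polynomial.X - Polynomial.C τ)).rootMultiplicity c = if c ∈ S then 1 else 0 := by
  rw [← Polynomial.count_roots, Polynomial.roots_prod_X_sub_C,
    Multiset.count_eq_of_nodup S.nodup]
  rfl

/-- The rational function `c x ^ (a₁ - (p - 1)) (x - 1) ^ (a₂ - (p - 1)) u ^ 2`. -/
noncomputable def ratPow (p a₁ a₂ : ℕ) (c : k) (u : Polynomial k) : RatFunc k :=
  algebraMap _ (RatFunc k) (Polynomial.C c * u ^ p) / algebraMap _ (RatFunc k) (logPoly p a₁ a₂ u)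

theorem ratPow_ne_zero {c : k} (hc : c ≠ 0) {u : Polynomial k} (hu : u ≠ 0) :
    ratPow p a₁ a₂ c u ≠ 0 :=
  div_ne_zero (RatFunc.algebraMap_ne_zero (mul_ne_zero (Polynomial.C_ne_zero.2 hc)
    (pow_ne_zero _ hu))) (RatFunc.algebraMap_ne_zero (logPoly_ne_zero hu))

theorem rootMultiplicity_C_mul_pow {c : k} (hc : c ≠ 0) {u : Polynomial k} (hu : u ≠ 0) (τ : k)
    (n : ℕ) : (Polynomial.C c * u ^ n).rootMultiplicity τ = n * u.rootMultiplicity τ := by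
  rw [Polynomial.rootMultiplicity_mul (mul_ne_zero (Polynomial.C_ne_zero.2 hc) (pow_ne_zero _ hu)),
    Polynomial.rootMultiplicity_C, zero_add, rootMultiplicity_pow']

variable [hp : Fact p.Prime] [CharP k p]

section
omit [CharP k p]
variable (hp2 : 2 < p) (h1 : a₁ < p - 1) (h2 : a₂ < p - 1) {c : k} (hc : c ≠ 0) {S : Finset k}
  (h0S : (0 : k) ∉ S) (h1S : (1 : k) ∉ S)
include hp2 h1 h2 hc

omit hp in
include h0S h1S in
theorem scaledSigma_ratPow_coe [DecidableEq k] (τ : k) :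
    GaloisCover.scaledSigma p (ratPow p a₁ a₂ c (∏ τ ∈ S, (Polynomial.X - Polynomial.C τ)))
      (τ : OnePoint k) = if τ = 0 then (a₁ : ℤ) else if τ = 1 then (a₂ : ℤ) else
        if τ ∈ S then (p : ℤ) + 1 else (p : ℤ) - 1 := by
  have hu : (∏ τ ∈ S, (Polynomial.X - Polynomial.C τ)) ≠ 0 :=
    (Polynomial.monic_prod_of_monic _ _ fun τ _ => Polynomial.monic_X_sub_C τ).ne_zero
  change ordAt _ _ + ((p : ℤ) - 1) = _
  rw [ratPow, ordAt_div (mul_ne_zero (Polynomial.C_ne_zero.2 hc) (pow_ne_zero _ hu))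
    (logPoly_ne_zero hu), rootMultiplicity_C_mul_pow hc hu, rootMultiplicity_logPoly hu,
    rootMultiplicity_prod_X_sub_C]
  by_cases c0 : τ = 0
  · subst c0
    simp only [h0S, if_true, if_false, zero_ne_one]
    omega
  by_cases c1 : τ = 1
  · subst c1
    simp only [h1S, if_true, if_false, one_ne_zero]
    omega
  by_cases cS : τ ∈ S
  · simp only [c0, c1, cS, if_true, if_false]
    omega
  · simp only [c0, c1, cS, if_false]
    omega

theorem scaledSigma_ratPow_infty :
    GaloisCover.scaledSigma p (ratPow p a₁ a₂ c (∏ τ ∈ S, (Polynomial.X - Polynomial.C τ)))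
      OnePoint.infty = (p : ℤ) - 1 - a₁ - a₂ - 2 * S.card := by
  have hu : (∏ τ ∈ S, (Polynomial.X - Polynomial.C τ)) ≠ 0 :=
    (Polynomial.monic_prod_of_monic _ _ fun τ _ => Polynomial.monic_X_sub_C τ).ne_zero
  have hX' : (Polynomial.X - 1 : Polynomial k).natDegree = 1 := by
    simpa using Polynomial.natDegree_X_sub_C (1 : k)
  change ordAt _ _ - ((p : ℤ) - 1) = _
  rw [ratPow, ordAt_infty_div (mul_ne_zero (Polynomial.C_ne_zero.2 hc) (pow_ne_zero _ hu))
    (logPoly_ne_zero hu), Polynomial.natDegree_C_mul hc, logPoly,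
    Polynomial.natDegree_mul (mul_ne_zero (pow_ne_zero _ Polynomial.X_ne_zero)
      (pow_ne_zero _ X_sub_one_ne_zero)) (pow_ne_zero _ hu),
    Polynomial.natDegree_mul (pow_ne_zero _ Polynomial.X_ne_zero)
      (pow_ne_zero _ X_sub_one_ne_zero), Polynomial.natDegree_pow, Polynomial.natDegree_pow,
    Polynomial.natDegree_pow, Polynomial.natDegree_pow, Polynomial.natDegree_X, hX',
    natDegree_prod_X_sub_C']
  push_cast [Nat.cast_sub h1.le, Nat.cast_sub h2.le, Nat.cast_sub hp2.le,
    Nat.cast_sub hp.out.one_le]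
  ring

end

end RationalFunctions

/-! ### Logarithmic differentials. -/

section LogarithmicDifferentials

variable {k L : Type*} [Field k] [Field L] [Algebra (RatFunc k) L] [Algebra k L]
  [IsScalarTower k (RatFunc k) L] [Algebra.IsSeparable (RatFunc k) L]

theorem diffEquiv_diffMap {L' : Type*} [Field L'] [Algebra (RatFunc k) L'] [Algebra k L']
    [IsScalarTower k (RatFunc k) L'] [Algebra.IsSeparable (RatFunc k) L'] (φ : L →ₐ[k] L')
    (hφ : φ (algebraMap (RatFunc k) L RatFunc.X) = algebraMap (RatFunc k) L' RatFunc.X)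
    (ω : Ω[L⁄k]) : diffEquiv k L' (diffMap φ ω) = φ (diffEquiv k L ω) := by
  conv_lhs => rw [← diffEquiv_smul_dx ω]
  rw [diffMap_smul, diffMap_D, hφ, map_smul, diffEquiv_D, ddx_X, smul_eq_mul, mul_one]

variable {p : ℕ} [hp : Fact p.Prime] [CharP k p] [PerfectRing k p]

/-- A differential `F dx` is logarithmic if and only if `(d/dx) ^ (p - 1) F ^ (1 - p) = -1`. -/
theorem logarithmic_iff (hp2 : 2 < p) {ω : Ω[L⁄k]} {G : L}
    (hG : G = diffEquiv k L ω ^ (p - 1)) (hω : ω ≠ 0) :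
    (∃ f : L, f ≠ 0 ∧ ω = f⁻¹ • D k L f) ↔ (ddx k L)^[p - 1] G⁻¹ = -1 := by
  have hchar : CharP L p := charP_of_injective_algebraMap (algebraMap k L).injective p
  set F := diffEquiv k L ω with hF
  have hF0 : F ≠ 0 := by rw [hF]; simpa using hω
  have h1 : (∃ f : L, f ≠ 0 ∧ ω = f⁻¹ • D k L f) ↔ ∃ f : L, f ≠ 0 ∧ ddx k L f = F * f := by
    refine exists_congr fun f => and_congr_right fun hf => ?_
    rw [← (diffEquiv k L).injective.eq_iff, map_smul, diffEquiv_D, ← hF, smul_eq_mul,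
      eq_inv_mul_iff_mul_eq₀ hf, eq_comm, mul_comm]
  rw [h1, exists_logDeriv_iff (ddx k L) p hp2 (ddx_iterate_char p)]
  have h2 : F = F ^ p * G⁻¹ := by
    rw [hG, eq_mul_inv_iff_mul_eq₀ (pow_ne_zero _ hF0), ← pow_succ',
      Nat.sub_add_cancel hp.out.one_le]
  have h3 : (ddx k L)^[p - 1] F = F ^ p * (ddx k L)^[p - 1] G⁻¹ := by
    conv_lhs => rw [h2, derivation_pow_char_mul]
  rw [h3, ← mul_add_one, mul_eq_zero, or_iff_right (pow_ne_zero _ hF0), eq_neg_iff_add_eq_zero]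

/-- The denominator c u^p of 1/G is a p-th power, c having a p-th root in k, so it passes through
d/dx. -/
theorem logarithmic_ratPow_iff (hp2 : 2 < p) {ω : Ω[L⁄k]} {a₁ a₂ : ℕ} {c : k} (hc : c ≠ 0)
    {u : Polynomial k} (hu : u ≠ 0)
    (hG : algebraMap (RatFunc k) L (ratPow p a₁ a₂ c u) = diffEquiv k L ω ^ (p - 1))
    (hω : ω ≠ 0) :
    (∃ f : L, f ≠ 0 ∧ ω = f⁻¹ • D k L f) ↔
      Polynomial.derivative^[p - 1] (logPoly p a₁ a₂ u) = Polynomial.C (-c) * u ^ p := by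
  have hchar : CharP L p := charP_of_injective_algebraMap (algebraMap k L).injective p
  rw [logarithmic_iff hp2 hG hω]
  set y := algebraMap (RatFunc k) L RatFunc.X
  have hy : ∀ q : Polynomial k, Polynomial.aeval y q =
      algebraMap (RatFunc k) L (algebraMap (Polynomial k) (RatFunc k) q) := by
    intro q
    rw [Polynomial.aeval_algebraMap_apply, RatFunc.aeval_X_left_eq_algebraMap]
  have hinj : Function.Injective (Polynomial.aeval (R := k) y) := by
    intro a b hab
    rw [hy, hy] at hab
    exact RatFunc.algebraMap_injective k ((algebraMap (RatFunc k) L).injective hab)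
  obtain ⟨b, hb⟩ : ∃ b : k, b ^ p = c := by
    obtain ⟨b, hb⟩ := (PerfectRing.bijective_frobenius (R := k) (p := p)).2 c
    exact ⟨b, hb⟩
  have hb0 : b ≠ 0 := by rintro rfl; rw [zero_pow hp.out.ne_zero] at hb; exact hc hb.symm
  set z := Polynomial.aeval y (Polynomial.C b * u) with hz
  have hz0 : z ≠ 0 := by
    rw [hz, Ne, map_eq_zero_iff _ hinj]; exact mul_ne_zero (Polynomial.C_ne_zero.2 hb0) hu
  have hzp : z ^ p = Polynomial.aeval y (Polynomial.C c * u ^ p) := by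
    rw [hz, ← map_pow, mul_pow, ← Polynomial.C_pow, hb]
  have h1 : (algebraMap (RatFunc k) L (ratPow p a₁ a₂ c u))⁻¹ =
      z⁻¹ ^ p * Polynomial.aeval y (logPoly p a₁ a₂ u) := by
    rw [ratPow, map_div₀, inv_div, inv_pow, hzp, hy, hy, div_eq_mul_inv, mul_comm]
  rw [h1, derivation_pow_char_mul, ddx_iterate_aeval, inv_pow,
    inv_mul_eq_iff_eq_mul₀ (pow_ne_zero _ hz0), hzp, mul_neg_one, ← map_neg, hinj.eq_iff]
  rw [Polynomial.C_neg, neg_mul]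

end LogarithmicDifferentials


/-! ### Critical points read off from G. -/

namespace GaloisCover

section CriticalPoints

variable {k : Type u} [Field k] [IsAlgClosed k] {H : Type v} [Group H] [Finite H]
  {Z : GaloisCover k H} {p : ℕ} [hp : Fact p.Prime] [CharP k p] {ω : Ω[Z.L⁄k]} {ξ : Point k Z.L}
  {τ : OnePoint k} {G : RatFunc k}

omit [IsAlgClosed k] [Finite H] [CharP k p] [Fact p.Prime] in
theorem eq_diffEquiv_smul : ω = diffEquiv k Z.L ω • D k Z.L Z.x := (diffEquiv_smul_dx ω).symm

omit [IsAlgClosed k] [Finite H] [CharP k p] in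
theorem sub_one_pos : (0 : ℚ) < (p : ℚ) - 1 := by
  have : (1 : ℚ) < p := by exact_mod_cast hp.out.one_lt
  linarith

variable (hcop : (Nat.card H).Coprime p) (hG0 : G ≠ 0)
  (hG : algebraMap (RatFunc k) Z.L G = diffEquiv k Z.L ω ^ (p - 1))
include hcop hG0 hG

theorem sigma_eq_div (hξ : Z.LiesOver ξ τ) :
    Z.sigma ω ξ = scaledSigma p G τ / ((p : ℚ) - 1) := by
  rw [eq_div_iff (sub_one_pos (p := p)).ne', mul_comm]
  exact sigma_eq hcop eq_diffEquiv_smul hG0 hG hξ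

theorem h_eq_zero_iff (hξ : Z.LiesOver ξ τ) : Z.h ω ξ = 0 ↔ scaledSigma p G τ = 0 := by
  have h1 := h_mul_eq hcop eq_diffEquiv_smul hG0 hG hξ
  have h2 := (m_eq_ord_localParam hcop hξ).2.1
  have h3 := hp.out.two_le
  constructor
  · intro h
    rw [h, mul_zero, eq_comm, mul_eq_zero] at h1
    exact h1.resolve_left (by omega)
  · intro h
    rw [h, mul_zero, mul_eq_zero] at h1
    exact h1.resolve_left (by omega)

theorem scaledSigma_of_eq_one (hξ : Z.LiesOver ξ τ) (h : (Z.m ξ, Z.h ω ξ) = (1, 1)) :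
    scaledSigma p G τ = (p : ℤ) - 1 := by
  have h1 := h_mul_eq hcop eq_diffEquiv_smul hG0 hG hξ
  rw [Prod.mk.injEq] at h
  rw [h.1, h.2] at h1
  simpa using h1.symm

theorem mem_critical_of_ne (h : scaledSigma p G τ ≠ (p : ℤ) - 1) : τ ∈ Z.critical ω := by
  obtain ⟨ξ, hξ⟩ := Z.exists_liesOver τ
  exact ⟨ξ, hξ, fun h1 => h (scaledSigma_of_eq_one hcop hG0 hG hξ h1)⟩

theorem mem_wild_iff : τ ∈ Z.wild ω ↔ scaledSigma p G τ = 0 := by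
  constructor
  · rintro ⟨-, ξ, hξ, h⟩
    exact (h_eq_zero_iff hcop hG0 hG hξ).1 h
  · intro h
    obtain ⟨ξ, hξ⟩ := Z.exists_liesOver τ
    refine ⟨mem_critical_of_ne hcop hG0 hG ?_, ξ, hξ, (h_eq_zero_iff hcop hG0 hG hξ).2 h⟩
    have := hp.out.two_le
    omega

theorem sigma_pos_iff (hξ : Z.LiesOver ξ τ) : 0 < Z.sigma ω ξ ↔ 0 < scaledSigma p G τ := by
  rw [sigma_eq_div hcop hG0 hG hξ, div_pos_iff_of_pos_right sub_one_pos, Int.cast_pos]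

theorem sigma_le_one_iff (hξ : Z.LiesOver ξ τ) :
    Z.sigma ω ξ ≤ 1 ↔ scaledSigma p G τ ≤ (p : ℤ) - 1 := by
  rw [sigma_eq_div hcop hG0 hG hξ, div_le_one sub_one_pos]
  norm_cast

theorem sigma_eq_one_iff (hξ : Z.LiesOver ξ τ) :
    Z.sigma ω ξ = 1 ↔ scaledSigma p G τ = (p : ℤ) - 1 := by
  rw [sigma_eq_div hcop hG0 hG hξ, div_eq_one_iff_eq (sub_one_pos (p := p)).ne']
  norm_cast

theorem mem_primitive_of_lt (h0 : 0 < scaledSigma p G τ) (h1 : scaledSigma p G τ < (p : ℤ) - 1) :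
    τ ∈ Z.primitive ω := by
  obtain ⟨ξ, hξ⟩ := Z.exists_liesOver τ
  exact ⟨mem_critical_of_ne hcop hG0 hG h1.ne, ξ, hξ, (sigma_pos_iff hcop hG0 hG hξ).2 h0,
    (sigma_le_one_iff hcop hG0 hG hξ).2 h1.le⟩

theorem scaledSigma_of_mem_primitive (h : τ ∈ Z.primitive ω) :
    0 < scaledSigma p G τ ∧ scaledSigma p G τ ≤ (p : ℤ) - 1 := by
  obtain ⟨-, ξ, hξ, h0, h1⟩ := h
  exact ⟨(sigma_pos_iff hcop hG0 hG hξ).1 h0, (sigma_le_one_iff hcop hG0 hG hξ).1 h1⟩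

/-- If `χ` is injective, the points with `σ = 1` are not critical. -/
theorem not_mem_critical {χ : H →* (ZMod p)ˣ} (hχ : Function.Injective χ)
    (hF : ∀ β, Z.pull β (diffEquiv k Z.L ω) =
      algebraMap k Z.L (ZMod.castHom (dvd_refl p) k (χ β : ZMod p)) * diffEquiv k Z.L ω)
    (h : scaledSigma p G τ = (p : ℤ) - 1) : τ ∉ Z.critical ω := by
  rintro ⟨ξ, hξ, hne⟩
  -- σ = 1 means that G has order 0 at a finite point and 2(p-1) at infinity.
  have hdvd : ((p : ℤ) - 1) ∣ ordAt τ G := by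
    cases τ with
    | infty =>
      change ordAt OnePoint.infty G - ((p : ℤ) - 1) = _ at h
      exact ⟨2, by linarith⟩
    | coe c =>
      change ordAt (c : OnePoint k) G + ((p : ℤ) - 1) = _ at h
      exact ⟨0, by linarith⟩
  have hm := m_eq_one hχ hF hG0 hG hξ hdvd
  have h1 := h_mul_eq hcop eq_diffEquiv_smul hG0 hG hξ
  rw [h, hm, mul_comm] at h1
  have := hp.out.two_le
  exact hne (by rw [hm, mul_right_cancel₀ (by omega) h1]; rfl)

end CriticalPoints

end GaloisCover

/-! ### The rational function G of a datum, and part (i). -/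

namespace SpecialDatum

open GaloisCover

theorem diffEquiv_ne_zero {p : ℕ} {k : Type u} [Field k] [CharP k p] {H : Type v} [Group H]
    {χ : H →* (ZMod p)ˣ} (E : SpecialDatum p k H χ) : diffEquiv k E.L E.ω ≠ 0 := by
  simpa using E.ω_ne_zero

section Structure

variable {p : ℕ} [hp : Fact p.Prime] {k : Type u} [Field k] [CharP k p] {H : Type v} [Group H]
  {χ : H →* (ZMod p)ˣ} (E : SpecialDatum p k H χ)

/-- dx is invariant under H, so F transforms like ω. -/
theorem pull_diffEquiv (β : H) : E.pull β (diffEquiv k E.L E.ω) =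
    algebraMap k E.L (ZMod.castHom (dvd_refl p) k (χ β : ZMod p)) * diffEquiv k E.L E.ω := by
  have h := diffEquiv_diffMap ((E.pull β).restrictScalars k : E.L →ₐ[k] E.L)
    ((E.pull β).commutes _) E.ω
  have h1 : diffMap ((E.pull β).restrictScalars k : E.L →ₐ[k] E.L) E.ω = _ := E.pull_ω β
  rw [h1, ← algebraMap_smul E.L, map_smul, smul_eq_mul] at h
  exact h.symm

theorem exists_algebraMap_eq_pow : ∃ G : RatFunc k, G ≠ 0 ∧
    algebraMap (RatFunc k) E.L G = diffEquiv k E.L E.ω ^ (p - 1) := by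
  obtain ⟨G, hG⟩ := E.exists_algebraMap_eq (f := diffEquiv k E.L E.ω ^ (p - 1)) fun β => by
    rw [map_pow, pull_diffEquiv, mul_pow, ← map_pow, ← map_pow, ← Units.val_pow_eq_pow_val,
      ZMod.units_pow_card_sub_one_eq_one]
    simp
  refine ⟨G, ?_, hG⟩
  rintro rfl
  rw [map_zero] at hG
  exact pow_ne_zero _ E.diffEquiv_ne_zero hG.symm

variable [IsAlgClosed k] [Finite H]

theorem exists_hasSignature (hcop : (Nat.card H).Coprime p) :
    ∃ a₁ a₂ a₃ : ℕ, E.HasSignature a₁ a₂ a₃ := by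
  obtain ⟨G, hG0, hG⟩ := E.exists_algebraMap_eq_pow
  have key : ∀ τ, ∃ a, E.HasExponent τ a := by
    intro τ
    have hp1 : (0 : ℤ) < (p : ℤ) - 1 := by have := hp.out.two_le; omega
    obtain ⟨a, ha⟩ := Int.eq_ofNat_of_zero_le (Int.emod_nonneg (scaledSigma p G τ) hp1.ne')
    have hlt := Int.emod_lt_of_pos (scaledSigma p G τ) hp1
    refine ⟨a, by omega, fun ξ hξ => ⟨scaledSigma p G τ / ((p : ℤ) - 1), ?_⟩⟩
    rw [sigma_eq hcop eq_diffEquiv_smul hG0 hG hξ]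
    have h1 := Int.emod_add_mul_ediv (scaledSigma p G τ) ((p : ℤ) - 1)
    rw [ha] at h1
    conv_lhs => rw [← h1]
    push_cast; ring
  obtain ⟨a₁, h1⟩ := key ((0 : k) : OnePoint k)
  obtain ⟨a₂, h2⟩ := key ((1 : k) : OnePoint k)
  obtain ⟨a₃, h3⟩ := key OnePoint.infty
  exact ⟨a₁, a₂, a₃, h1, h2, h3⟩

/-- At wild points and at primitive points with σ ≠ 1, the integer (p-1)σ lies between 0 and p - 2,
so the congruence defining the signature is an equality. -/
theorem scaledSigma_eq_of_hasExponent (hcop : (Nat.card H).Coprime p) {G : RatFunc k} (hG0 : G ≠ 0)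
    (hG : algebraMap (RatFunc k) E.L G = diffEquiv k E.L E.ω ^ (p - 1)) {τ : OnePoint k}
    (hτ : τ ∈ E.primitive E.ω ∪ E.wild E.ω)
    (hprim : ∀ τ ∈ E.primitive E.ω, ∀ ξ, E.LiesOver ξ τ → E.sigma E.ω ξ ≠ 1) {a : ℕ}
    (ha : E.HasExponent τ a) : scaledSigma p G τ = a := by
  obtain ⟨ξ, hξ⟩ := E.exists_liesOver τ
  obtain ⟨hlt, hmod⟩ := ha
  obtain ⟨n, hn⟩ := hmod ξ hξ
  rw [sigma_eq hcop eq_diffEquiv_smul hG0 hG hξ] at hn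
  have hn' : scaledSigma p G τ = a + n * ((p : ℤ) - 1) := by exact_mod_cast hn
  have hs : 0 ≤ scaledSigma p G τ ∧ scaledSigma p G τ < (p : ℤ) - 1 := by
    rcases hτ with hτ | hτ
    · obtain ⟨h0, h1⟩ := scaledSigma_of_mem_primitive hcop hG0 hG hτ
      exact ⟨h0.le, lt_of_le_of_ne h1 fun h =>
        hprim τ hτ ξ hξ ((sigma_eq_one_iff hcop hG0 hG hξ).2 h)⟩
    · rw [(mem_wild_iff hcop hG0 hG).1 hτ]
      have := hp.out.two_le
      omega
  have ha' : (a : ℤ) < (p : ℤ) - 1 := by omega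
  have h1 : n = 0 := by
    have h3 : n < 1 := by by_contra! h; nlinarith
    have h4 : -1 < n := by by_contra! h; nlinarith
    omega
  rw [hn', h1]; ring

theorem sigma_ne_one_of_injective (hχ : Function.Injective χ) (hcop : (Nat.card H).Coprime p) :
    ∀ τ ∈ E.primitive E.ω, ∀ ξ, E.LiesOver ξ τ → E.sigma E.ω ξ ≠ 1 := by
  intro τ hτ ξ hξ h
  obtain ⟨G, hG0, hG⟩ := E.exists_algebraMap_eq_pow
  exact not_mem_critical hcop hG0 hG hχ E.pull_diffEquiv
    ((sigma_eq_one_iff hcop hG0 hG hξ).1 h) hτ.1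

/-- The rational function `(ω / dx) ^ (p - 1)` attached to a normalised hypergeometric datum. -/
theorem exists_ratPow_eq (hp2 : 2 < p) (hcop : (Nat.card H).Coprime p) (hE : E.IsHypergeometric)
    (hN : E.IsNormalised) {a₁ a₂ a₃ : ℕ} (ha : E.HasSignature a₁ a₂ a₃)
    (hprim : ∀ τ ∈ E.primitive E.ω, ∀ ξ, E.LiesOver ξ τ → E.sigma E.ω ξ ≠ 1) :
    ∃ (c : k) (S : Finset k), c ≠ 0 ∧ 0 ∉ S ∧ 1 ∉ S ∧ 2 * S.card + (a₁ + a₂ + a₃) = p - 1 ∧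
      E.newPoly = ∏ τ ∈ S, (Polynomial.X - Polynomial.C τ) ∧
      algebraMap (RatFunc k) E.L (ratPow p a₁ a₂ c E.newPoly) = diffEquiv k E.L E.ω ^ (p - 1) ∧
      Polynomial.derivative^[p - 1] (logPoly p a₁ a₂ E.newPoly) =
        Polynomial.C (-c) * E.newPoly ^ p := by
  classical
  obtain ⟨G, hG0, hG⟩ := E.exists_algebraMap_eq_pow
  have hmem : ∀ τ, τ ∈ E.primitive E.ω ∪ E.wild E.ω ↔
      τ = ((0 : k) : OnePoint k) ∨ τ = ((1 : k) : OnePoint k) ∨ τ = OnePoint.infty := by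
    intro τ
    rw [show E.primitive E.ω ∪ E.wild E.ω = _ from hN]
    rfl
  have s0 := E.scaledSigma_eq_of_hasExponent hcop hG0 hG ((hmem _).2 (Or.inl rfl)) hprim ha.1
  have s1 := E.scaledSigma_eq_of_hasExponent hcop hG0 hG ((hmem _).2 (Or.inr (Or.inl rfl))) hprim
    ha.2.1
  have s3 := E.scaledSigma_eq_of_hasExponent hcop hG0 hG ((hmem _).2 (Or.inr (Or.inr rfl))) hprim
    ha.2.2
  have hnew : ∀ τ, τ ∈ E.new E.ω ↔
      τ ∈ E.critical E.ω ∧ τ ∉ E.primitive E.ω ∪ E.wild E.ω := by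
    intro τ; rw [Set.union_comm]; rfl
  have snew : ∀ τ ∈ E.new E.ω, scaledSigma p G τ = (p : ℤ) + 1 := by
    intro τ hτ
    obtain ⟨ξ, hξ⟩ := E.exists_liesOver τ
    have h1 := hE τ hτ ξ hξ
    rw [sigma_eq_div hcop hG0 hG hξ, div_left_inj' (sub_one_pos (p := p)).ne'] at h1
    exact_mod_cast h1
  have sother : ∀ c : k, c ≠ 0 → c ≠ 1 → (c : OnePoint k) ∉ E.new E.ω →
      scaledSigma p G (c : OnePoint k) = (p : ℤ) - 1 := by
    intro c c0 c1 hc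
    by_contra hne
    refine hc ((hnew _).2 ⟨mem_critical_of_ne hcop hG0 hG hne, fun h => ?_⟩)
    rcases (hmem _).1 h with h | h | h
    · exact c0 (OnePoint.coe_injective h)
    · exact c1 (OnePoint.coe_injective h)
    · exact OnePoint.coe_ne_infty _ h
  -- G has a zero of order 2 at each finite new point.
  have hfin : {τ : k | (τ : OnePoint k) ∈ E.new E.ω}.Finite := by
    refine (G.num.roots.toFinset.finite_toSet).subset fun τ hτ => ?_
    have h1 : (G.num.rootMultiplicity τ : ℤ) - G.denom.rootMultiplicity τ + ((p : ℤ) - 1) = _ :=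
      snew _ hτ
    rw [Finset.mem_coe, Multiset.mem_toFinset, ← Multiset.one_le_count_iff_mem,
      Polynomial.count_roots]
    omega
  let S := hfin.toFinset
  have hS : ∀ τ, τ ∈ S ↔ (τ : OnePoint k) ∈ E.new E.ω := fun τ => hfin.mem_toFinset
  have h0S : (0 : k) ∉ S := fun h => ((hnew _).1 ((hS _).1 h)).2 ((hmem _).2 (Or.inl rfl))
  have h1S : (1 : k) ∉ S := fun h => ((hnew _).1 ((hS _).1 h)).2 ((hmem _).2 (Or.inr (Or.inl rfl)))
  have hu : E.newPoly = ∏ τ ∈ S, (Polynomial.X - Polynomial.C τ) :=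
    finprod_mem_eq_finite_toFinset_prod _ hfin
  have hu0 : (∏ τ ∈ S, (Polynomial.X - Polynomial.C τ)) ≠ 0 :=
    (Polynomial.monic_prod_of_monic _ _ fun τ _ => Polynomial.monic_X_sub_C τ).ne_zero
  have h1 := ha.1.1
  have h2 := ha.2.1.1
  obtain ⟨c, hc, hGc⟩ : ∃ c : k, c ≠ 0 ∧
      G = ratPow p a₁ a₂ c (∏ τ ∈ S, (Polynomial.X - Polynomial.C τ)) := by
    refine exists_eq_C_mul_div_of_ordAt_eq hG0 (pow_ne_zero _ hu0) (logPoly_ne_zero hu0)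
      fun τ => ?_
    have e1 := scaledSigma_ratPow_coe hp2 h1 h2 (one_ne_zero (α := k)) h0S h1S τ
    change ordAt _ _ + ((p : ℤ) - 1) = _ at e1
    rw [ratPow, ordAt_div (mul_ne_zero (Polynomial.C_ne_zero.2 one_ne_zero) (pow_ne_zero _ hu0))
      (logPoly_ne_zero hu0), Polynomial.C_1, one_mul] at e1
    have e2 : scaledSigma p G (τ : OnePoint k) = ordAt (τ : OnePoint k) G + ((p : ℤ) - 1) := rfl
    have e3 : scaledSigma p G (τ : OnePoint k) = if τ = 0 then (a₁ : ℤ) else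
        if τ = 1 then (a₂ : ℤ) else if τ ∈ S then (p : ℤ) + 1 else (p : ℤ) - 1 := by
      split_ifs with c0 c1 cS
      · rw [c0, s0]
      · rw [c1, s1]
      · exact snew _ ((hS τ).1 cS)
      · exact sother τ c0 c1 fun h => cS ((hS τ).2 h)
    linarith
  -- The value at infinity is also a₃, which yields the degree relation.
  have hdeg := scaledSigma_ratPow_infty hp2 h1 h2 hc (S := S)
  rw [← hGc, s3] at hdeg
  refine ⟨c, S, hc, h0S, h1S, by omega, hu, ?_, ?_⟩
  · rw [hu, ← hGc, hG]
  · rw [hu]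
    refine (logarithmic_ratPow_iff hp2 hc hu0 (ω := E.ω) ?_ E.ω_ne_zero).1 E.logarithmic
    rw [← hGc, hG]

theorem solvesHypergeometric_newPoly (hp2 : 2 < p) (hcop : (Nat.card H).Coprime p)
    (hE : E.IsHypergeometric) (hN : E.IsNormalised) {a₁ a₂ a₃ : ℕ} (ha : E.HasSignature a₁ a₂ a₃)
    (hprim : ∀ τ ∈ E.primitive E.ω, ∀ ξ, E.LiesOver ξ τ → E.sigma E.ω ξ ≠ 1) :
    SolvesHypergeometric ((1 + a₁ + a₂ + a₃) / 2 : k) ((1 + a₁ + a₂ - a₃) / 2 : k)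
      (1 + a₁ : k) E.newPoly ∧ 2 * E.newPoly.natDegree + (a₁ + a₂ + a₃) = p - 1 := by
  obtain ⟨c, S, -, h0S, h1S, hd, hu, -, hlog⟩ := E.exists_ratPow_eq hp2 hcop hE hN ha hprim
  rw [hu] at hlog ⊢
  rw [natDegree_prod_X_sub_C']
  exact ⟨(solvesHypergeometric_iff hp2 hd _).2
    (hypergeometric_of_logPoly hp2 ha.1.1 ha.2.1.1 h0S h1S hd hlog), hd⟩

end Structure

end SpecialDatum


/-! ### Roots of unity of order dividing p - 1. -/

section PrimeField

variable {p : ℕ} [hp : Fact p.Prime] {k A : Type*} [Field k] [CharP k p] [Field A] [Algebra k A]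

/-- Such an element is fixed by Frobenius, hence lies in the prime field. -/
theorem exists_units_of_pow_eq_one {a : A} (ha : a ^ (p - 1) = 1) :
    ∃ ζ : (ZMod p)ˣ, algebraMap k A (ZMod.castHom (dvd_refl p) k (ζ : ZMod p)) = a := by
  have hchar : CharP A p := charP_of_injective_algebraMap (algebraMap k A).injective p
  have h1 : a ∈ (⊥ : Subfield A) := by
    rw [Subfield.mem_bot_iff_pow_eq_self A p, ← mul_one a]
    conv_lhs => rw [mul_one, ← Nat.sub_add_cancel hp.out.one_le, pow_succ', ha]
  rw [← ZMod.fieldRange_castHom_eq_bot p] at h1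
  obtain ⟨z, hz⟩ := h1
  have hz0 : z ≠ 0 := by
    rintro rfl
    rw [map_zero] at hz
    rw [← hz, zero_pow (by have := hp.out.two_le; omega)] at ha
    exact zero_ne_one ha
  refine ⟨Units.mk0 z hz0, ?_⟩
  rw [← hz, Units.val_mk0, ← RingHom.comp_apply]
  exact RingHom.congr_fun (RingHom.ext_zmod _ _) z

theorem exists_units_of_pow_eq_pow {a b : A} (hb : b ≠ 0) (h : a ^ (p - 1) = b ^ (p - 1)) :
    ∃ ζ : (ZMod p)ˣ, a = algebraMap k A (ZMod.castHom (dvd_refl p) k (ζ : ZMod p)) * b := by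
  obtain ⟨ζ, hζ⟩ := exists_units_of_pow_eq_one (p := p) (k := k) (a := a / b) (by
    rw [div_pow, h, div_self (pow_ne_zero _ hb)])
  exact ⟨ζ, by rw [hζ, div_mul_cancel₀ _ hb]⟩

omit [Field A] [Algebra k A] in
theorem algebraMap_castHom_injective [Field A] [Algebra k A] : Function.Injective
    fun ζ : (ZMod p)ˣ => algebraMap k A (ZMod.castHom (dvd_refl p) k (ζ : ZMod p)) :=
  fun _ _ h => Units.ext ((ZMod.castHom (dvd_refl p) k).injective ((algebraMap k A).injective h))

end PrimeField

/-! ### Uniqueness of a datum. -/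

section Uniqueness

open IntermediateField

theorem exists_algEquiv_of_fieldRange_eq {K L L' : Type*} [Field K] [Field L] [Field L'] [Algebra K L]
    [Algebra K L'] {M : Type*} [Field M] [Algebra K M] (i : L →ₐ[K] M) (i' : L' →ₐ[K] M)
    (h : i.fieldRange = i'.fieldRange) : ∃ φ : L ≃ₐ[K] L', ∀ f, i' (φ f) = i f := by
  let e := (AlgEquiv.ofInjectiveField i).trans
    ((Subalgebra.equivOfEq _ _ (congrArg IntermediateField.toSubalgebra h)).trans
      (AlgEquiv.ofInjectiveField i').symm)
  refine ⟨e, fun f => ?_⟩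
  have h1 : (AlgEquiv.ofInjectiveField i') (e f) =
      Subalgebra.equivOfEq _ _ (congrArg IntermediateField.toSubalgebra h)
        (AlgEquiv.ofInjectiveField i f) :=
    AlgEquiv.apply_symm_apply _ _
  exact congrArg Subtype.val h1

namespace SpecialDatum

variable {p : ℕ} [hp : Fact p.Prime] {k : Type u} [Field k] [CharP k p] {H : Type v} [Group H]
  {χ : H →* (ZMod p)ˣ} (E E' : SpecialDatum p k H χ)

theorem algEquiv_ext (hχ : Function.Injective χ) {σ τ : E.L ≃ₐ[RatFunc k] E.L}
    (h : σ (diffEquiv k E.L E.ω) = τ (diffEquiv k E.L E.ω)) : σ = τ := by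
  obtain ⟨β, rfl⟩ : ∃ β, E.pull β = σ :=
    ⟨E.pullback.symm (MulOpposite.op σ), by simp [GaloisCover.pull]⟩
  obtain ⟨γ, rfl⟩ : ∃ β, E.pull β = τ :=
    ⟨E.pullback.symm (MulOpposite.op τ), by simp [GaloisCover.pull]⟩
  rw [pull_diffEquiv, pull_diffEquiv] at h
  rw [hχ (algebraMap_castHom_injective (k := k) (A := E.L)
    (mul_right_cancel₀ E.diffEquiv_ne_zero h))]

/-- An automorphism fixing F comes from some β with χ(β) = 1, so it is trivial; the Galois
correspondence concludes. -/
theorem adjoin_diffEquiv_eq_top (hχ : Function.Injective χ) :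
    (RatFunc k)⟮diffEquiv k E.L E.ω⟯ = ⊤ := by
  have h1 : (RatFunc k)⟮diffEquiv k E.L E.ω⟯.fixingSubgroup = (⊤ : IntermediateField
      (RatFunc k) E.L).fixingSubgroup := by
    rw [fixingSubgroup_top, Subgroup.eq_bot_iff_forall]
    intro σ hσ
    exact E.algEquiv_ext hχ ((mem_fixingSubgroup_iff _ _).1 hσ _ (mem_adjoin_simple_self _ _))
  rw [← IsGalois.fixedField_fixingSubgroup (RatFunc k)⟮diffEquiv k E.L E.ω⟯, h1,
    IsGalois.fixedField_fixingSubgroup]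

/-- In an algebraic closure of k(x) the two functions have the same (p-1)-st power, so they differ
by an element of 𝔽_p^× and generate the same subfield. -/
theorem equivUpToScalar_of_pow_eq (hχ : Function.Injective χ) {G : RatFunc k}
    (hG : algebraMap (RatFunc k) E.L G = diffEquiv k E.L E.ω ^ (p - 1))
    (hG' : algebraMap (RatFunc k) E'.L G = diffEquiv k E'.L E'.ω ^ (p - 1)) :
    E.EquivUpToScalar E' := by
  set F := diffEquiv k E.L E.ω with hF
  set F' := diffEquiv k E'.L E'.ω with hF'
  let i : E.L →ₐ[RatFunc k] AlgebraicClosure (RatFunc k) := IsAlgClosed.lift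
  let i' : E'.L →ₐ[RatFunc k] AlgebraicClosure (RatFunc k) := IsAlgClosed.lift
  obtain ⟨c, hc⟩ := exists_units_of_pow_eq_pow (p := p) (k := RatFunc k) (a := i F) (b := i' F')
    ((map_ne_zero i').2 E'.diffEquiv_ne_zero) (by
      rw [← map_pow i, ← map_pow i', ← hG, ← hG', AlgHom.commutes, AlgHom.commutes])
  set a : RatFunc k := ZMod.castHom (dvd_refl p) (RatFunc k) (c : ZMod p) with ha
  have hca : a = algebraMap k (RatFunc k) (ZMod.castHom (dvd_refl p) k (c : ZMod p)) := by
    rw [ha, ← RingHom.comp_apply (algebraMap k (RatFunc k))]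
    exact RingHom.congr_fun (RingHom.ext_zmod _ _) _
  have ha0 : a ≠ 0 := (map_ne_zero _).2 c.ne_zero
  have hrange : i.fieldRange = i'.fieldRange := by
    have h1 : i.fieldRange = (RatFunc k)⟮i F⟯ := by
      rw [AlgHom.fieldRange_eq_map, ← E.adjoin_diffEquiv_eq_top hχ, adjoin_map,
        Set.image_singleton]
    have h2 : i'.fieldRange = (RatFunc k)⟮i' F'⟯ := by
      rw [AlgHom.fieldRange_eq_map, ← E'.adjoin_diffEquiv_eq_top hχ, adjoin_map,
        Set.image_singleton]
    rw [h1, h2]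
    apply le_antisymm
    · rw [adjoin_simple_le_iff, hc]
      exact mul_mem (IntermediateField.algebraMap_mem _ _) (mem_adjoin_simple_self _ _)
    · rw [adjoin_simple_le_iff, show i' F' = algebraMap (RatFunc k) _ a⁻¹ * i F by
        rw [hc, map_inv₀, inv_mul_cancel_left₀ (by simpa using ha0)]]
      exact mul_mem (IntermediateField.algebraMap_mem _ _) (mem_adjoin_simple_self _ _)
  obtain ⟨φ, hφ⟩ := exists_algEquiv_of_fieldRange_eq i i' hrange
  have hφF : φ F = algebraMap k E'.L (ZMod.castHom (dvd_refl p) k (c : ZMod p)) * F' := by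
    apply i'.injective
    change i' _ = i' _
    rw [hφ, hc, map_mul, IsScalarTower.algebraMap_apply k (RatFunc k) E'.L, ← hca, i'.commutes]
  refine ⟨φ, fun β f => ?_, c, ?_⟩
  -- Equivariance can be tested on F, on which both sides act by χ(β).
  · have h1 : E.pull β = (φ.trans (E'.pull β)).trans φ.symm := by
      apply E.algEquiv_ext hχ
      apply φ.injective
      simp only [AlgEquiv.trans_apply, AlgEquiv.apply_symm_apply]
      rw [← hF, hφF, pull_diffEquiv, map_mul, map_mul, hφF, pull_diffEquiv, ← hF',
        GaloisCover.pull_algebraMap', IsScalarTower.algebraMap_apply k (RatFunc k) E.L,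
        AlgEquiv.commutes, ← IsScalarTower.algebraMap_apply]
      ring
    rw [h1]
    simp
  · apply (diffEquiv k E'.L).injective
    rw [diffEquiv_diffMap _ (φ.commutes _), ← algebraMap_smul E'.L, map_smul, smul_eq_mul]
    exact hφF

end SpecialDatum

end Uniqueness


namespace SpecialDatum

section Uniqueness

variable {p : ℕ} [hp : Fact p.Prime] {k : Type u} [Field k] [CharP k p] [IsAlgClosed k]
  {H : Type v} [Group H] [Finite H] {χ : H →* (ZMod p)ˣ} (E E' : SpecialDatum p k H χ)

/-- A normalised hypergeometric datum is determined by its signature. -/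
theorem equivUpToScalar_of_hasSignature (hp2 : 2 < p) (hcop : (Nat.card H).Coprime p)
    (hχ : Function.Injective χ) {a₁ a₂ a₃ : ℕ} (hE : E.IsHypergeometric) (hN : E.IsNormalised)
    (ha : E.HasSignature a₁ a₂ a₃) (hE' : E'.IsHypergeometric) (hN' : E'.IsNormalised)
    (ha' : E'.HasSignature a₁ a₂ a₃) : E.EquivUpToScalar E' := by
  obtain ⟨c, S, -, h0S, h1S, hd, hu, hG, hlog⟩ :=
    E.exists_ratPow_eq hp2 hcop hE hN ha (E.sigma_ne_one_of_injective hχ hcop)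
  obtain ⟨c', S', -, h0S', h1S', hd', hu', hG', hlog'⟩ :=
    E'.exists_ratPow_eq hp2 hcop hE' hN' ha' (E'.sigma_ne_one_of_injective hχ hcop)
  have hmon : ∀ S : Finset k, (∏ τ ∈ S, (Polynomial.X - Polynomial.C τ)).Monic := fun S =>
    Polynomial.monic_prod_of_monic _ _ fun τ _ => Polynomial.monic_X_sub_C τ
  have hcard : S'.card = S.card := by omega
  have h1 := hypergeometric_of_logPoly hp2 ha.1.1 ha.2.1.1 h0S h1S hd (hu ▸ hlog)
  have h2 := hypergeometric_of_logPoly hp2 ha.1.1 ha.2.1.1 h0S' h1S' hd' (hu' ▸ hlog')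
  rw [hcard] at h2
  have huu : E'.newPoly = E.newPoly := by
    rw [hu, hu']
    exact hypergeometric_polynomial_unique ha.2.2.1 hd (hmon _) (hmon _)
      ((natDegree_prod_X_sub_C' _).trans hcard) (natDegree_prod_X_sub_C' _) h2 h1
  rw [huu] at hG' hlog'
  have hu0 : E.newPoly ≠ 0 := by rw [hu]; exact (hmon _).ne_zero
  -- The logarithmic identity recovers the constant from u.
  have hcc : c' = c := neg_injective (Polynomial.C_injective
    (mul_right_cancel₀ (pow_ne_zero p hu0) (hlog'.symm.trans hlog)))
  rw [hcc] at hG'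
  exact E.equivUpToScalar_of_pow_eq E' hχ hG hG'

end Uniqueness

end SpecialDatum

/-! ### Construction of the Kummer cover. -/

section ExistsCover

variable {p : ℕ} [hp : Fact p.Prime] {k : Type u} [Field k] [CharP k p]

/-- The Kummer cover defined by `F ^ (p - 1) = G`, for a function `G` such that a connected
component has degree `Nat.card H`. -/
theorem exists_cover {H : Type v} [CommGroup H] [Finite H] {χ : H →* (ZMod p)ˣ}
    (hχ : Function.Injective χ) {G : RatFunc k} (hG0 : G ≠ 0)
    {n : ℕ} (hn : n * Nat.card H = p - 1) {g : RatFunc k} (hg : g ^ n = G)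
    (hdvd : ∀ (r : ℕ) (h : RatFunc k), h ^ (p - 1) = G ^ r → Nat.card H ∣ r) :
    ∃ (Z : GaloisCover k H) (F : Z.L), algebraMap (RatFunc k) Z.L G = F ^ (p - 1) ∧
      ∀ β, Z.pull β F = algebraMap k Z.L (ZMod.castHom (dvd_refl p) k (χ β : ZMod p)) * F := by
  classical
  have hp1 : p - 1 ≠ 0 := by have := hp.out.two_le; omega
  have hcast : ((p - 1 : ℕ) : RatFunc k) ≠ 0 := by
    have hchar : CharP (RatFunc k) p :=
      charP_of_injective_algebraMap (algebraMap k (RatFunc k)).injective p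
    rw [Ne, CharP.cast_eq_zero_iff (RatFunc k) p]
    intro h
    have := Nat.le_of_dvd (by omega) h
    have := hp.out.pos
    omega
  let P : Polynomial (RatFunc k) := Polynomial.X ^ (p - 1) - Polynomial.C G
  have hPsep : P.Separable := Polynomial.separable_X_pow_sub_C G hcast hG0
  let L := P.SplittingField
  have hgal : IsGalois (RatFunc k) L := IsGalois.of_separable_splitting_field hPsep
  obtain ⟨F, hF⟩ : ∃ F : L, F ^ (p - 1) = algebraMap (RatFunc k) L G := by
    have hdeg : (P.map (algebraMap (RatFunc k) L)).degree ≠ 0 := by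
      rw [Polynomial.degree_map, Polynomial.degree_X_pow_sub_C (by omega)]
      exact_mod_cast hp1
    obtain ⟨F, hF⟩ := Polynomial.Splits.exists_eval_eq_zero
      (Polynomial.SplittingField.splits P) hdeg
    refine ⟨F, ?_⟩
    simpa [P, sub_eq_zero] using hF
  have hF0 : F ≠ 0 := by
    rintro rfl
    rw [zero_pow hp1, eq_comm, map_eq_zero] at hF
    exact hG0 hF
  let ι : (ZMod p)ˣ → RatFunc k :=
    fun ζ => algebraMap k (RatFunc k) (ZMod.castHom (dvd_refl p) k (ζ : ZMod p))
  have hι_mul : ∀ a b, ι (a * b) = ι a * ι b := fun a b => by simp [ι]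
  have hι_pow : ∀ a (m : ℕ), ι (a ^ m) = ι a ^ m := fun a m => by simp [ι]
  have hι_inj : Function.Injective ι := algebraMap_castHom_injective
  have hroot : ∀ y : L, y ^ (p - 1) = F ^ (p - 1) →
      ∃ ζ : (ZMod p)ˣ, y = algebraMap (RatFunc k) L (ι ζ) * F := by
    intro y hy
    obtain ⟨ζ, hζ⟩ := exists_units_of_pow_eq_pow (p := p) (k := k) hF0 hy
    refine ⟨ζ, ?_⟩
    rw [hζ, IsScalarTower.algebraMap_apply k (RatFunc k) L]
  have hρ : ∀ σ : L ≃ₐ[RatFunc k] L, ∃ ζ, σ F = algebraMap (RatFunc k) L (ι ζ) * F := fun σ =>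
    hroot _ (by rw [← map_pow, hF, AlgEquiv.commutes])
  choose r hr using hρ
  have hcancel : ∀ ζ ζ' : (ZMod p)ˣ, algebraMap (RatFunc k) L (ι ζ) * F =
      algebraMap (RatFunc k) L (ι ζ') * F → ζ = ζ' := fun ζ ζ' h =>
    hι_inj ((algebraMap (RatFunc k) L).injective (mul_right_cancel₀ hF0 h))
  let ρ : (L ≃ₐ[RatFunc k] L) →* (ZMod p)ˣ := MonoidHom.mk' r fun σ τ => by
    apply hcancel
    rw [← hr, AlgEquiv.mul_apply, hr, map_mul, AlgEquiv.commutes, hr, hι_mul, map_mul]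
    ring
  have hρF : ∀ σ, σ F = algebraMap (RatFunc k) L (ι (ρ σ)) * F := hr
  have hρ_inj : Function.Injective ρ := by
    rw [injective_iff_map_eq_one]
    intro σ hσ
    have hσF : σ F = F := by rw [hρF, hσ]; simp [ι]
    have h1 : (σ : L →ₐ[RatFunc k] L) = AlgHom.id (RatFunc k) L := by
      refine AlgHom.ext_of_adjoin_eq_top (Polynomial.SplittingField.adjoin_rootSet P) ?_
      intro y hy
      rw [Polynomial.mem_rootSet] at hy
      have hy' : y ^ (p - 1) = F ^ (p - 1) := by
        rw [hF]; simpa [P, sub_eq_zero] using hy.2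
      obtain ⟨ζ, rfl⟩ := hroot y hy'
      change σ _ = _
      rw [map_mul, AlgEquiv.commutes, hσF]; rfl
    ext y
    exact DFunLike.congr_fun h1 y
  set m := Nat.card H with hm
  have hm0 : 0 < m := Nat.card_pos
  -- H and the Galois group are identified because χ and the Kummer character ρ are both injective
  -- with image T.
  let T : Finset (ZMod p)ˣ := {a | a ^ m = 1}
  have hT : T.card ≤ m := IsCyclic.card_pow_eq_one_le hm0
  have hχT : ∀ β, χ β ∈ T := fun β => by simp [T, ← map_pow, hm, pow_card_eq_one']
  have hg0 : g ≠ 0 := by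
    rintro rfl
    have : n ≠ 0 := by rintro rfl; omega
    rw [zero_pow this] at hg
    exact hG0 hg.symm
  -- F^m and g have the same (p-1)-st power, so F^m lies in k(x) and is fixed by σ.
  have hρT : ∀ σ, ρ σ ∈ T := by
    intro σ
    obtain ⟨ζ, hζ⟩ := exists_units_of_pow_eq_one (p := p) (k := RatFunc k)
      (a := F ^ m / algebraMap (RatFunc k) L g) (by
        rw [div_pow, ← pow_mul, mul_comm, pow_mul, hF, ← map_pow, ← map_pow, ← hg, ← pow_mul, hn]
        exact div_self (by simpa using pow_ne_zero _ hg0))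
    have hFm : F ^ m = algebraMap (RatFunc k) L
        (ZMod.castHom (dvd_refl p) (RatFunc k) (ζ : ZMod p) * g) := by
      rw [map_mul, hζ, div_mul_cancel₀]
      simpa using hg0
    have h1 : σ (F ^ m) = F ^ m := by rw [hFm, AlgEquiv.commutes]
    rw [map_pow, hρF, mul_pow, ← map_pow, ← hι_pow, mul_eq_right₀ (pow_ne_zero _ hF0)] at h1
    simp only [T, Finset.mem_filter, Finset.mem_univ, true_and]
    apply hι_inj
    apply (algebraMap (RatFunc k) L).injective
    rw [h1]; simp [ι]
  have hfin : Finite (L ≃ₐ[RatFunc k] L) := inferInstance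
  -- Raised to the order of the Galois group, F becomes invariant, so that power of G is a (p-1)-st
  -- power and m divides the order.
  have hmle : m ≤ Nat.card (L ≃ₐ[RatFunc k] L) := by
    refine Nat.le_of_dvd Nat.card_pos ?_
    obtain ⟨h, hh⟩ := (IsGalois.mem_range_algebraMap_iff_fixed
      (F := RatFunc k) (F ^ Nat.card (L ≃ₐ[RatFunc k] L))).2 fun σ => by
        rw [map_pow, hρF, mul_pow, ← map_pow, ← hι_pow, ← map_pow, pow_card_eq_one']; simp [ι]
    refine hdvd _ h ?_
    apply (algebraMap (RatFunc k) L).injective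
    rw [map_pow, hh, map_pow, ← hF, ← pow_mul, ← pow_mul, mul_comm]
  have himage : ∀ a ∈ T, (∃ β, χ β = a) ∧ ∃ σ, ρ σ = a := by
    have := Fintype.ofFinite H
    have := Fintype.ofFinite (L ≃ₐ[RatFunc k] L)
    have h1 : Finset.univ.image χ = T := by
      refine Finset.eq_of_subset_of_card_le (fun a ha => ?_) ?_
      · obtain ⟨β, -, rfl⟩ := Finset.mem_image.1 ha; exact hχT β
      · rw [Finset.card_image_of_injective _ hχ, Finset.card_univ, ← Nat.card_eq_fintype_card]
        exact hT
    have h2 : Finset.univ.image ρ = T := by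
      refine Finset.eq_of_subset_of_card_le (fun a ha => ?_) ?_
      · obtain ⟨β, -, rfl⟩ := Finset.mem_image.1 ha; exact hρT β
      · rw [Finset.card_image_of_injective _ hρ_inj, Finset.card_univ, ← Nat.card_eq_fintype_card]
        exact hT.trans hmle
    intro a ha
    refine ⟨?_, ?_⟩
    · rw [← h1] at ha; simpa using ha
    · rw [← h2] at ha; simpa using ha
  choose s hs using fun β => (himage _ (hχT β)).2
  let e : H →* (L ≃ₐ[RatFunc k] L)ᵐᵒᵖ := MonoidHom.mk' (fun β => MulOpposite.op (s β))
    fun β γ => by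
      rw [← MulOpposite.op_mul]
      congr 1
      apply hρ_inj
      rw [map_mul, hs, hs, hs, map_mul, mul_comm]
  have he : Function.Bijective e := by
    constructor
    · intro β γ h
      have h1 : s β = s γ := MulOpposite.op_injective h
      apply hχ
      rw [← hs, ← hs, h1]
    · intro σ
      obtain ⟨β, hβ⟩ := (himage _ (hρT σ.unop)).1
      refine ⟨β, ?_⟩
      apply MulOpposite.unop_injective
      apply hρ_inj
      rw [← hβ, ← hs]; rfl
  refine ⟨{ L := L, pullback := MulEquiv.ofBijective e he }, F, hF.symm, fun β => ?_⟩
  change s β F = _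
  rw [hρF, hs, IsScalarTower.algebraMap_apply k (RatFunc k) L]

end ExistsCover


/-! ### Arithmetic of the order of the cyclic group. -/

section CyclicOrder

variable {p a₁ a₂ a₃ : ℕ}

/-- These divisibilities make G an n-th power: n divides its orders at 0 and 1, and its order 2 at
the new points unless there are none. -/
theorem exists_mul_cyclicOrder_eq (hpe : Even (p - 1))
    (hsum : a₁ + a₂ + a₃ ≤ p - 1) : ∃ n, n * cyclicOrder p a₁ a₂ a₃ = p - 1 ∧
      n ∣ a₁ ∧ n ∣ a₂ ∧ (n ∣ 2 ∨ a₁ + a₂ + a₃ = p - 1) := by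
  unfold cyclicOrder
  split_ifs with h1 h2
  · exact ⟨2, Nat.mul_div_cancel' hpe.two_dvd, h2.1.two_dvd, h2.2.1.two_dvd, Or.inl dvd_rfl⟩
  · exact ⟨1, one_mul _, one_dvd _, one_dvd _, Or.inl (one_dvd _)⟩
  · have hs : a₁ + a₂ + a₃ = p - 1 := by omega
    have d1 : a₁.gcd (a₂.gcd a₃) ∣ a₁ := Nat.gcd_dvd_left _ _
    have d2 : a₁.gcd (a₂.gcd a₃) ∣ a₂ := (Nat.gcd_dvd_right _ _).trans (Nat.gcd_dvd_left _ _)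
    have d3 : a₁.gcd (a₂.gcd a₃) ∣ a₃ := (Nat.gcd_dvd_right _ _).trans (Nat.gcd_dvd_right _ _)
    exact ⟨_, Nat.mul_div_cancel' (hs ▸ dvd_add (dvd_add d1 d2) d3), d1, d2, Or.inr hs⟩

/-- Conversely, the assumptions express that p - 1 divides the orders of G^r at 0, at 1 and at a new
point, if there is one. Together they make r a multiple of m. -/
theorem cyclicOrder_dvd (hpe : Even (p - 1)) (hp0 : 0 < p - 1) (hsum : a₁ + a₂ + a₃ ≤ p - 1)
    (he : Even (a₁ + a₂ + a₃)) {r : ℕ} (h1 : p - 1 ∣ r * a₁) (h2 : p - 1 ∣ r * a₂)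
    (h3 : a₁ + a₂ + a₃ < p - 1 → p - 1 ∣ r * 2) : cyclicOrder p a₁ a₂ a₃ ∣ r := by
  obtain ⟨q, hq⟩ := hpe.two_dvd
  rw [hq] at h1 h2
  unfold cyclicOrder
  split_ifs with hlt hev
  · have := h3 hlt
    rw [hq, mul_comm] at this
    rw [hq, Nat.mul_div_cancel_left _ two_pos]
    exact Nat.dvd_of_mul_dvd_mul_right two_pos this
  · have := h3 hlt
    rw [hq, mul_comm] at this
    obtain ⟨t, rfl⟩ := Nat.dvd_of_mul_dvd_mul_right two_pos this
    have hq0 : 0 < q := by omega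
    rw [mul_comm 2 q, mul_assoc] at h1 h2
    have e1 := Nat.dvd_of_mul_dvd_mul_left hq0 h1
    have e2 := Nat.dvd_of_mul_dvd_mul_left hq0 h2
    rw [hq, mul_comm]
    refine mul_dvd_mul_left q ?_
    -- For odd t both a₁ and a₂ would be even, and then a₃ too, the sum being even.
    by_contra ht
    have f1 := (Nat.prime_two.dvd_mul.1 e1).resolve_left ht
    have f2 := (Nat.prime_two.dvd_mul.1 e2).resolve_left ht
    exact hev ⟨even_iff_two_dvd.2 f1, even_iff_two_dvd.2 f2, by
      rw [even_iff_two_dvd] at he ⊢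
      exact (Nat.dvd_add_right (dvd_add f1 f2)).1 he⟩
  · rw [← hq] at h1 h2
    have hs : a₁ + a₂ + a₃ = p - 1 := by omega
    have h4 : p - 1 ∣ r * a₃ := by
      refine (Nat.dvd_add_right (dvd_add h1 h2)).1 ?_
      rw [← mul_add, ← mul_add, hs]
      exact dvd_mul_left _ _
    have h5 := Nat.dvd_gcd h1 (Nat.dvd_gcd h2 h4)
    rw [Nat.gcd_mul_left, Nat.gcd_mul_left] at h5
    have d1 : a₁.gcd (a₂.gcd a₃) ∣ a₁ := Nat.gcd_dvd_left _ _
    have d2 : a₁.gcd (a₂.gcd a₃) ∣ a₂ := (Nat.gcd_dvd_right _ _).trans (Nat.gcd_dvd_left _ _)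
    have d3 : a₁.gcd (a₂.gcd a₃) ∣ a₃ := (Nat.gcd_dvd_right _ _).trans (Nat.gcd_dvd_right _ _)
    obtain ⟨t, ht⟩ : a₁.gcd (a₂.gcd a₃) ∣ p - 1 := hs ▸ dvd_add (dvd_add d1 d2) d3
    have hg : 0 < a₁.gcd (a₂.gcd a₃) := Nat.pos_of_ne_zero fun h => by
      rw [h, zero_mul] at ht; omega
    rw [ht, mul_comm r] at h5
    rw [ht, Nat.mul_div_cancel_left _ hg]
    exact Nat.dvd_of_mul_dvd_mul_left hg h5

end CyclicOrder

/-! ### Powers of rational functions, and the roots of u. -/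

section RationalFunctions

variable {k : Type*} [Field k]

theorem ordAt_pow {g : RatFunc k} (hg : g ≠ 0) (c : k) (n : ℕ) :
    ordAt (c : OnePoint k) (g ^ n) = n * ordAt (c : OnePoint k) g := by
  have hn := RatFunc.num_ne_zero hg
  have hd := RatFunc.denom_ne_zero g
  have h1 : g ^ n = algebraMap _ (RatFunc k) (g.num ^ n) / algebraMap _ (RatFunc k)
      (g.denom ^ n) := by
    rw [map_pow, map_pow, ← div_pow, RatFunc.num_div_denom]
  rw [h1, ordAt_div (pow_ne_zero _ hn) (pow_ne_zero _ hd), rootMultiplicity_pow',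
    rootMultiplicity_pow']
  change _ = (n : ℤ) * (g.num.rootMultiplicity c - g.denom.rootMultiplicity c)
  push_cast; ring

/-- After cancelling u^(p-2), the function is c u^2 over powers of x and x - 1, and each factor is
an n-th power. -/
theorem exists_pow_eq_ratPow [IsAlgClosed k] {p a₁ a₂ n : ℕ} (hp2 : 2 < p) (hn : 0 < n)
    (h1 : n ∣ p - 1 - a₁) (h2 : n ∣ p - 1 - a₂) {u w : Polynomial k} (hu : u ≠ 0)
    (hw : w ^ n = u ^ 2) (c : k) : ∃ g, g ^ n = ratPow p a₁ a₂ c u := by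
  obtain ⟨b, hb⟩ := IsAlgClosed.exists_pow_nat_eq c hn
  obtain ⟨α, hα⟩ := h1
  obtain ⟨β, hβ⟩ := h2
  refine ⟨algebraMap _ (RatFunc k) (Polynomial.C b * w) /
    algebraMap (Polynomial k) (RatFunc k) (Polynomial.X ^ α * (Polynomial.X - 1) ^ β), ?_⟩
  have hXY : (Polynomial.X ^ (p - 1 - a₁) * (Polynomial.X - 1) ^ (p - 1 - a₂) :
      Polynomial k) ≠ 0 :=
    mul_ne_zero (pow_ne_zero _ Polynomial.X_ne_zero) (pow_ne_zero _ X_sub_one_ne_zero)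
  rw [div_pow, ← map_pow, ← map_pow, mul_pow, mul_pow, ← pow_mul, ← pow_mul, mul_comm α,
    mul_comm β, ← hα, ← hβ, hw, ← Polynomial.C_pow, hb, ratPow,
    div_eq_div_iff (RatFunc.algebraMap_ne_zero hXY)
    (RatFunc.algebraMap_ne_zero (logPoly_ne_zero hu)), ← map_mul, ← map_mul, logPoly]
  congr 1
  rw [show u ^ p = u ^ 2 * u ^ (p - 2) by rw [← pow_add]; congr 1; omega]
  ring

variable {p : ℕ} [hp : Fact p.Prime] [CharP k p] [IsAlgClosed k]

theorem exists_finset_hypergeometric {a₁ a₂ a₃ d : ℕ} (h1 : a₁ < p - 1)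
    (h2 : a₂ < p - 1) (h3 : a₃ < p - 1) (hd : 2 * d + (a₁ + a₂ + a₃) = p - 1) :
    ∃ S : Finset k, S.card = d ∧ 0 ∉ S ∧ 1 ∉ S ∧
      odeOp a₁ a₂ (∏ τ ∈ S, (Polynomial.X - Polynomial.C τ)) +
        Polynomial.C (d * (d + a₃) : k) * ∏ τ ∈ S, (Polynomial.X - Polynomial.C τ) = 0 := by
  classical
  obtain ⟨u, hmon, hdeg, hode⟩ := exists_hypergeometric_polynomial (k := k) h3 hd
  obtain ⟨h0, h1', hr⟩ := rootMultiplicity_of_hypergeometric (p := p) h1 h2 hd hmon.ne_zero hdeg hode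
  have hnodup : u.roots.Nodup := Multiset.nodup_iff_count_le_one.2 fun τ => by
    rw [Polynomial.count_roots]; exact hr τ
  have hprod : ∏ τ ∈ u.roots.toFinset, (Polynomial.X - Polynomial.C τ) = u := by
    conv_rhs => rw [(IsAlgClosed.splits u).eq_prod_roots_of_monic hmon]
    rw [Finset.prod, Multiset.toFinset_val, hnodup.dedup]
  have hcard : u.roots.toFinset.card = d := by
    rw [← hdeg, ← natDegree_prod_X_sub_C', hprod]
  refine ⟨u.roots.toFinset, hcard, fun h => h0 ?_, fun h => h1' ?_, by rw [hprod]; exact hode⟩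
  · exact Polynomial.isRoot_of_mem_roots (Multiset.mem_toFinset.1 h)
  · exact Polynomial.isRoot_of_mem_roots (Multiset.mem_toFinset.1 h)

end RationalFunctions

/-! ### Existence of the datum. -/

section Existence

open GaloisCover

variable {p : ℕ} [hp : Fact p.Prime] {k : Type u} [Field k] [CharP k p] [IsAlgClosed k]

omit [IsAlgClosed k] in
theorem ncard_zero_one_infty : ({((0 : k) : OnePoint k), ((1 : k) : OnePoint k),
    OnePoint.infty} : Set (OnePoint k)).ncard = 3 := by
  rw [Set.ncard_eq_three]
  exact ⟨_, _, _, fun h => zero_ne_one (OnePoint.coe_injective h), OnePoint.coe_ne_infty _,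
    OnePoint.coe_ne_infty _, rfl⟩

/-- The datum on a cover `Z` given by a function `F` such that `F ^ (p - 1)` is `ratPow`. -/
theorem exists_specialDatum (hp2 : 2 < p) {H : Type v} [Group H] [Finite H] {χ : H →* (ZMod p)ˣ}
    (hcop : (Nat.card H).Coprime p) (hχ : Function.Injective χ) {a₁ a₂ a₃ : ℕ} (h1 : a₁ < p - 1)
    (h2 : a₂ < p - 1) (h3 : a₃ < p - 1) {S : Finset k} (h0S : 0 ∉ S) (h1S : 1 ∉ S)
    (hd : 2 * S.card + (a₁ + a₂ + a₃) = p - 1) {c : k} (hc : c ≠ 0)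
    (hlog : Polynomial.derivative^[p - 1]
      (logPoly p a₁ a₂ (∏ τ ∈ S, (Polynomial.X - Polynomial.C τ))) =
        Polynomial.C (-c) * (∏ τ ∈ S, (Polynomial.X - Polynomial.C τ)) ^ p)
    (Z : GaloisCover k H) {F : Z.L}
    (hG : algebraMap (RatFunc k) Z.L
      (ratPow p a₁ a₂ c (∏ τ ∈ S, (Polynomial.X - Polynomial.C τ))) = F ^ (p - 1))
    (hF : ∀ β, Z.pull β F = algebraMap k Z.L (ZMod.castHom (dvd_refl p) k (χ β : ZMod p)) * F) :
    ∃ E : SpecialDatum p k H χ, E.IsHypergeometric ∧ E.IsNormalised ∧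
      E.HasSignature a₁ a₂ a₃ := by
  classical
  have hu0 : (∏ τ ∈ S, (Polynomial.X - Polynomial.C τ)) ≠ 0 :=
    (Polynomial.monic_prod_of_monic _ _ fun τ _ => Polynomial.monic_X_sub_C τ).ne_zero
  set u := ∏ τ ∈ S, (Polynomial.X - Polynomial.C τ) with hu
  set G := ratPow p a₁ a₂ c u with hGdef
  have hG0 : G ≠ 0 := ratPow_ne_zero hc hu0
  have hp1 : p - 1 ≠ 0 := by omega
  have hF0 : F ≠ 0 := by
    rintro rfl
    rw [zero_pow hp1, map_eq_zero] at hG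
    exact hG0 hG
  let ω : Ω[Z.L⁄k] := F • D k Z.L Z.x
  have hωF : diffEquiv k Z.L ω = F := by
    change diffEquiv k Z.L (F • D k Z.L (algebraMap (RatFunc k) Z.L RatFunc.X)) = F
    rw [map_smul, diffEquiv_D, ddx_X, smul_eq_mul, mul_one]
  have hω0 : ω ≠ 0 := by
    intro h; rw [h, map_zero] at hωF; exact hF0 hωF.symm
  rw [← hωF] at hG hF
  have s0 : scaledSigma p G ((0 : k) : OnePoint k) = a₁ := by
    rw [hGdef, hu, scaledSigma_ratPow_coe hp2 h1 h2 hc h0S h1S, if_pos rfl]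
  have s1 : scaledSigma p G ((1 : k) : OnePoint k) = a₂ := by
    rw [hGdef, hu, scaledSigma_ratPow_coe hp2 h1 h2 hc h0S h1S, if_neg one_ne_zero, if_pos rfl]
  have s3 : scaledSigma p G OnePoint.infty = a₃ := by
    rw [hGdef, hu, scaledSigma_ratPow_infty hp2 h1 h2 hc]
    omega
  have sother : ∀ τ, τ = ((0 : k) : OnePoint k) ∨ τ = ((1 : k) : OnePoint k) ∨
      τ = OnePoint.infty ∨ scaledSigma p G τ = (p : ℤ) + 1 ∨ scaledSigma p G τ = (p : ℤ) - 1 := by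
    intro τ
    cases τ with
    | infty => exact Or.inr (Or.inr (Or.inl rfl))
    | coe t =>
      rw [hGdef, hu, scaledSigma_ratPow_coe hp2 h1 h2 hc h0S h1S]
      split_ifs with c0 c1 cS
      · exact Or.inl (by rw [c0])
      · exact Or.inr (Or.inl (by rw [c1]))
      · exact Or.inr (Or.inr (Or.inr (Or.inl rfl)))
      · exact Or.inr (Or.inr (Or.inr (Or.inr rfl)))
  -- Injectivity of χ excludes critical points with σ = 1, so only 0, 1, infinity and the roots of u
  -- can be critical.
  have hcrit : ∀ τ ∈ Z.critical ω, scaledSigma p G τ ≠ (p : ℤ) - 1 := fun τ hτ h =>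
    not_mem_critical hcop hG0 hG hχ hF h hτ
  have hmem : ∀ τ, τ ∈ Z.primitive ω ∪ Z.wild ω ↔ 0 ≤ scaledSigma p G τ ∧
      scaledSigma p G τ < (p : ℤ) - 1 := by
    intro τ
    constructor
    · rintro (h | h)
      · obtain ⟨e0, e1⟩ := scaledSigma_of_mem_primitive hcop hG0 hG h
        exact ⟨e0.le, lt_of_le_of_ne e1 (hcrit τ h.1)⟩
      · rw [(mem_wild_iff hcop hG0 hG).1 h]; omega
    · rintro ⟨e0, e1⟩
      rcases e0.eq_or_lt with h | h
      · exact Or.inr ((mem_wild_iff hcop hG0 hG).2 h.symm)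
      · exact Or.inl (mem_primitive_of_lt hcop hG0 hG h e1)
  have hset : Z.primitive ω ∪ Z.wild ω =
      {((0 : k) : OnePoint k), ((1 : k) : OnePoint k), OnePoint.infty} := by
    ext τ
    rw [hmem]
    constructor
    · rintro ⟨e0, e1⟩
      rcases sother τ with h | h | h | h | h
      · exact Or.inl h
      · exact Or.inr (Or.inl h)
      · exact Or.inr (Or.inr h)
      · omega
      · omega
    · rintro (rfl | rfl | rfl)
      · omega
      · omega
      · omega
  let E : SpecialDatum p k H χ :=
    { Z with
      ω := ω
      ω_ne_zero := hω0
      logarithmic := (logarithmic_ratPow_iff hp2 hc hu0 hG hω0).2 hlog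
      pull_ω := fun β => by
        apply (diffEquiv k Z.L).injective
        refine (diffEquiv_diffMap ((Z.pull β).restrictScalars k : Z.L →ₐ[k] Z.L)
          ((Z.pull β).commutes _) ω).trans ?_
        rw [← algebraMap_smul Z.L (_ : k), (diffEquiv k Z.L).map_smul (algebraMap k Z.L _) ω]
        exact hF β
      sigma_mem := fun τ hτ ξ hξ => by
        have hξ' : Z.LiesOver ξ τ := hξ
        have hw : scaledSigma p G τ ≠ 0 := fun h => hτ.2 ((mem_wild_iff hcop hG0 hG).2 h)
        -- At the roots of u the bound is p + 1 ≤ 2(p - 1), that is p ≥ 3.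
        have hb : 0 < scaledSigma p G τ ∧ scaledSigma p G τ ≤ 2 * ((p : ℤ) - 1) := by
          rcases sother τ with rfl | rfl | rfl | h | h <;> omega
        refine ⟨(sigma_pos_iff hcop hG0 hG hξ').2 hb.1, ?_⟩
        refine (sigma_eq_div hcop hG0 hG hξ').le.trans ?_
        rw [div_le_iff₀ (sub_one_pos (p := p))]
        exact_mod_cast hb.2
      card_eq := by
        rw [hset, ncard_zero_one_infty] }
  have hexp : ∀ (τ : OnePoint k) (a : ℕ), a < p - 1 → scaledSigma p G τ = a →
      E.HasExponent τ a := by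
    intro τ a ha hs
    refine ⟨ha, fun ξ hξ => ⟨0, ?_⟩⟩
    have := sigma_eq (Z := Z) hcop eq_diffEquiv_smul hG0 hG hξ
    refine this.trans ?_
    rw [hs]; simp
  refine ⟨E, ?_, hset, hexp _ _ h1 s0, hexp _ _ h2 s1, hexp _ _ h3 s3⟩
  intro τ hτ ξ hξ
  refine (sigma_eq_div (Z := Z) hcop hG0 hG hξ).trans ?_
  have hτ' : τ ∈ Z.critical ω ∧ τ ∉ Z.primitive ω ∪ Z.wild ω := by
    refine ⟨hτ.1, ?_⟩
    rw [Set.union_comm]; exact hτ.2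
  have e1 := hcrit τ hτ'.1
  have e2 := mt (hmem τ).2 hτ'.2
  have e3 : scaledSigma p G τ = (p : ℤ) + 1 := by
    rcases sother τ with rfl | rfl | rfl | h | h <;> omega
  rw [e3]; push_cast; rfl

theorem exists_hypergeometric_datum (hp2 : 2 < p) {a₁ a₂ a₃ : ℕ} (h1 : a₁ < p - 1)
    (h2 : a₂ < p - 1) (h3 : a₃ < p - 1) (hsum : a₁ + a₂ + a₃ ≤ p - 1)
    (he : Even (a₁ + a₂ + a₃)) {H : Type v} [CommGroup H] [Finite H]
    (hH : Nat.card H = cyclicOrder p a₁ a₂ a₃) (hcop : (Nat.card H).Coprime p)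
    {χ : H →* (ZMod p)ˣ} (hχ : Function.Injective χ) :
    ∃ E : SpecialDatum p k H χ, E.IsHypergeometric ∧ E.IsNormalised ∧
      E.HasSignature a₁ a₂ a₃ := by
  have hpe : Even (p - 1) := hp.out.even_sub_one (by omega)
  obtain ⟨d, hd⟩ : ∃ d, 2 * d + (a₁ + a₂ + a₃) = p - 1 := by
    obtain ⟨x, hx⟩ := hpe
    obtain ⟨y, hy⟩ := he
    exact ⟨x - y, by omega⟩
  obtain ⟨S, rfl, h0S, h1S, hode⟩ := exists_finset_hypergeometric (k := k) h1 h2 h3 hd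
  obtain ⟨c', hc', hlog⟩ := exists_iterate_derivative_logPoly hp2 h1 h2 h0S h1S h3 hd hode
  have hu0 : (∏ τ ∈ S, (Polynomial.X - Polynomial.C τ)) ≠ 0 :=
    (Polynomial.monic_prod_of_monic _ _ fun τ _ => Polynomial.monic_X_sub_C τ).ne_zero
  have hc : -c' ≠ 0 := neg_ne_zero.2 hc'
  have hG0 := ratPow_ne_zero (p := p) (a₁ := a₁) (a₂ := a₂) hc hu0
  obtain ⟨n, hn, d1, d2, hn2⟩ := exists_mul_cyclicOrder_eq hpe hsum
  have hn0 : 0 < n := Nat.pos_of_ne_zero fun h => by rw [h, zero_mul] at hn; omega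
  have hnp : n ∣ p - 1 := Dvd.intro _ hn
  -- Either n divides 2, or there are no new points and u = 1.
  obtain ⟨w, hw⟩ : ∃ w : Polynomial k, w ^ n = (∏ τ ∈ S, (Polynomial.X - Polynomial.C τ)) ^ 2 := by
    rcases hn2 with hn2 | hs
    · obtain ⟨t, ht⟩ := hn2
      exact ⟨(∏ τ ∈ S, (Polynomial.X - Polynomial.C τ)) ^ t, by rw [← pow_mul, mul_comm, ← ht]⟩
    · have : S = ∅ := Finset.card_eq_zero.1 (by omega)
      exact ⟨1, by simp [this]⟩
  obtain ⟨g, hg⟩ := exists_pow_eq_ratPow hp2 hn0 (Nat.dvd_sub hnp d1) (Nat.dvd_sub hnp d2) hu0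
    hw (-c')
  obtain ⟨Z, F, hGF, hF⟩ := exists_cover hχ hG0 (by rw [hH, hn]) hg fun r h hh => by
    classical
    have hh0 : h ≠ 0 := by
      rintro rfl
      rw [zero_pow (by omega)] at hh
      exact pow_ne_zero _ hG0 hh.symm
    -- All orders of the (p-1)-st power G^r are divisible by p - 1, and at finite points the scaled
    -- σ differs from the order of G by p - 1.
    have key : ∀ τ : k, ((p - 1 : ℕ) : ℤ) ∣ r * scaledSigma p
        (ratPow p a₁ a₂ (-c') (∏ τ ∈ S, (Polynomial.X - Polynomial.C τ))) (τ : OnePoint k) := by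
      intro τ
      have h4 := congrArg (ordAt (τ : OnePoint k)) hh
      rw [ordAt_pow hh0, ordAt_pow hG0] at h4
      change _ ∣ (r : ℤ) * (_ + ((p : ℤ) - 1))
      rw [mul_add, ← h4]
      refine dvd_add (dvd_mul_right _ _) (Dvd.intro_left r ?_)
      push_cast [Nat.cast_sub hp.out.one_le]; rfl
    simp only [scaledSigma_ratPow_coe hp2 h1 h2 hc h0S h1S] at key
    rw [hH]
    refine cyclicOrder_dvd hpe (by omega) hsum he ?_ ?_ ?_
    · have := key 0
      rw [if_pos rfl] at this
      exact_mod_cast this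
    · have := key 1
      rw [if_neg one_ne_zero, if_pos rfl] at this
      exact_mod_cast this
    · intro hlt
      obtain ⟨τ, hτ⟩ : S.Nonempty := Finset.card_pos.1 (by omega)
      have := key τ
      rw [if_neg (ne_of_mem_of_not_mem hτ h0S), if_neg (ne_of_mem_of_not_mem hτ h1S),
        if_pos hτ] at this
      have h5 : (r : ℤ) * (p + 1) = r * ((p - 1 : ℕ) : ℤ) + (r * 2 : ℕ) := by
        push_cast [Nat.cast_sub hp.out.one_le]; ring
      rw [h5] at this
      exact_mod_cast (dvd_add_right (dvd_mul_left _ _)).1 this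
  exact exists_specialDatum hp2 hcop hχ h1 h2 h3 h0S h1S hd hc (by rw [neg_neg]; exact hlog) Z
    hGF hF

end Existence

end DeformationData

/-! ### The main theorem. -/

theorem mainTheorem5 (p : ℕ) [Fact p.Prime] (hp : 2 < p) (k : Type u) [Field k] [IsAlgClosed k]
    [CharP k p] :
    -- (i)
    (∀ (H : Type v) [Group H] [Finite H] (χ : H →* (ZMod p)ˣ)
      (E : DeformationData.SpecialDatum p k H χ), (Nat.card H).Coprime p →
      E.IsHypergeometric → E.IsNormalised →
      (∃ a₁ a₂ a₃ : ℕ, E.HasSignature a₁ a₂ a₃) ∧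
      ∀ a₁ a₂ a₃ : ℕ, E.HasSignature a₁ a₂ a₃ → a₁ + a₂ + a₃ < p - 1 →
        (∀ τ ∈ E.primitive E.ω, ∀ ξ, E.LiesOver ξ τ → E.sigma E.ω ξ ≠ 1) →
        DeformationData.SolvesHypergeometric
          ((1 + a₁ + a₂ + a₃) / 2 : k) ((1 + a₁ + a₂ - a₃) / 2 : k) (1 + a₁ : k) E.newPoly ∧
        2 * E.newPoly.natDegree + (a₁ + a₂ + a₃) = p - 1) ∧
    -- (ii)
    (∀ a₁ a₂ a₃ : ℕ, a₁ < p - 1 → a₂ < p - 1 → a₃ < p - 1 → a₁ + a₂ + a₃ ≤ p - 1 →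
      Even (a₁ + a₂ + a₃) →
      ∀ χ : Multiplicative (ZMod (DeformationData.cyclicOrder p a₁ a₂ a₃)) →* (ZMod p)ˣ,
        Function.Injective χ →
        (∃ E : DeformationData.SpecialDatum p k _ χ,
          E.IsHypergeometric ∧ E.IsNormalised ∧ E.HasSignature a₁ a₂ a₃) ∧
        ∀ E E' : DeformationData.SpecialDatum p k _ χ,
          E.IsHypergeometric → E.IsNormalised → E.HasSignature a₁ a₂ a₃ →
          E'.IsHypergeometric → E'.IsNormalised → E'.HasSignature a₁ a₂ a₃ →
          E.EquivUpToScalar E') := by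
  have hp' : p.Prime := Fact.out
  refine ⟨fun H _ _ χ E hcop hE hN => ⟨E.exists_hasSignature hcop, fun a₁ a₂ a₃ ha _ hprim =>
    E.solvesHypergeometric_newPoly hp hcop hE hN ha hprim⟩, ?_⟩
  intro a₁ a₂ a₃ h1 h2 h3 hsum he χ hχ
  obtain ⟨n, hn, -⟩ := DeformationData.exists_mul_cyclicOrder_eq
    (hp'.even_sub_one (by omega)) hsum
  have hm : NeZero (DeformationData.cyclicOrder p a₁ a₂ a₃) :=
    ⟨fun h => by rw [h, mul_zero] at hn; omega⟩
  have hcard : Nat.card (Multiplicative (ZMod (DeformationData.cyclicOrder p a₁ a₂ a₃))) =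
      DeformationData.cyclicOrder p a₁ a₂ a₃ := by
    rw [Nat.card_congr Multiplicative.toAdd, Nat.card_zmod]
  -- The order m divides p - 1, hence is prime to p.
  have hcop : (Nat.card (Multiplicative (ZMod
      (DeformationData.cyclicOrder p a₁ a₂ a₃)))).Coprime p := by
    rw [hcard, Nat.coprime_comm, hp'.coprime_iff_not_dvd]
    intro h
    have := Nat.le_of_dvd (by omega) (h.trans (Dvd.intro_left _ hn))
    omega
  exact ⟨DeformationData.exists_hypergeometric_datum hp h1 h2 h3 hsum he hcard hcop hχ,
    fun E E' hE hN ha hE' hN' ha' =>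
      E.equivUpToScalar_of_hasSignature E' hp hcop hχ hE hN ha hE' hN' ha'⟩
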